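/- Let $K$ be a field of characteristic $0$. A quarter plane walk is a finite walk on $\mathbb Z^2$ with steps $\mathsf E=(1,0)$, $\mathsf N=(0,1)$, $\mathsf W=(-1,0)$, $\mathsf S=(0,-1)$ that starts at $(0,0)$ and stays in $\{x\ge 0,\ y\ge 0\}$; it is a loop if it ends at $(0,0)$; its corners are its factors $\mathsf{NW}$ and $\mathsf{ES}$ (two consecutive steps). Reading $\mathsf E,\mathsf N$ as input to stack 1, stack 2 and $\mathsf W,\mathsf S$ as output from stack 1, stack 2, a loop of length $2n$ is an operation sequence on two parallel stacks, or an arch system: each of the $n$ items gives an arch joining the time $i$ at which it enters a stack to the time $j$ at which it leaves it, coloured red for stack 1 and blue for stack 2. Two arches $(i,j)$, $(i',j')$ of different colours cross if $i<i'<j<j'$ or $i'<i<j'<j$. The arch system is connected if the graph on its arches formed by the crossings is connected and non-empty, and standard if in each connected component of this graph the arch with the smallest left endpoint is red. Corners of the loop are also called left-right pairs of the arch system. **Theorem.** 1. Let $\mathcal Q(a,u;x,y)\in K[a,x,y][[u]]$ be the generating function of quarter plane walks, counted by length ($u$), number of corners ($a$) and coordinates $(x,y)$ of the endpoint. Then $\mathcal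 Q(x,y)\equiv\mathcal Q(a,u;x,y)$ is the unique series in $K[a,x,y][[u]]$ satisfying, with $\bar x=1/x$ and $\bar y=1/y$, $$\bigl(1-u(x+\bar x+y+\bar y)-u^2(a-1)(x\bar y+y\bar x)\bigr)\mathcal Q(x,y)=1-u\bar y\,(1+ux(a-1))\,\mathcal Q(x,0)-u\bar x\,(1+uy(a-1))\,\mathcal Q(0,y).$$ 2. Let $Q(a,u)$ be the generating function of quarter plane loops, counted by half-length ($u$) and number of corners ($a$). Then $Q(a,u)=\mathcal Q(a,\sqrt u;0,0)$, that is, $Q(a,u^2)=\mathcal Q(a,u;0,0)$. 3. Let $C(b,v)$ be the generating function of connected standard arch systems, counted by number of arches ($v$) and number of left-right pairs ($b$). Then $C$ is the unique series in $K[[b,v]]$ satisfying, in $K[[a,u]]$ and with $Q=Q(a,u)$ (which has constant term $1$), $$Q=1+2\,C\left(1-\frac{1-a}{Q},\ uQ^2\right).$$ 4. Let $S(t)$ be the generating function of the permutations of $\{1,\dots,n\}$, $n\ge 0$, that can be produced from the input $1,2,\dots,n$ by two parallel stacks, counted by size $n$. Then $S(t)$ has constant term $1$, and it is the unique series in $K[[t]]$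 with non-zero constant term satisfying $$S=1+C\left(1-\frac1S,\ tS^2\right).$$ All the substitutions into $C$ in 3 and 4 are well defined: each coefficient of the result is a finite sum. -/

import Mathlib

/-! Words over four letters encode both square lattice walks and operation sequences of a machine
made of two parallel stacks: `E` is an input to stack 1, `N` an input to stack 2, `W` an output
from stack 1 and `S` an output from stack 2. -/

namespace ParallelStacks

/-- The four steps `(1,0)`, `(0,1)`, `(-1,0)`, `(0,-1)`, also read as the letters
`I₁`, `I₂`, `O₁`, `O₂`. -/
inductive Step : Type
  | E | N | W | S
  deriving DecidableEq

open Step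

instance : Fintype Step := ⟨{E, N, W, S}, fun s => by cases s <;> simp⟩

/-! ### Quarter plane walks -/

/-- Abscissa of the endpoint of a walk that starts at the origin. -/
def xCoord (w : List Step) : ℤ := (w.count E : ℤ) - (w.count W : ℤ)

/-- Ordinate of the endpoint of a walk that starts at the origin. -/
def yCoord (w : List Step) : ℤ := (w.count N : ℤ) - (w.count S : ℤ)

/-- The walk stays in the quadrant: every prefix ends in it. -/
def IsQuarterPlane (w : List Step) : Prop :=
  ∀ p : List Step, p <+: w → 0 ≤ xCoord p ∧ 0 ≤ yCoord p

/-- A quarter plane walk that ends at the origin; equivalently, an operation sequence (no output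
from an empty stack, both stacks empty at the end), or an arch system. -/
def IsQuarterPlaneLoop (w : List Step) : Prop :=
  IsQuarterPlane w ∧ xCoord w = 0 ∧ yCoord w = 0

/-- The number of corners, that is, of factors `NW` or `ES`. In terms of operation sequences these
are the factors `I₂O₁` and `I₁O₂`, the left-right pairs. -/
def corners : List Step → ℕ
  | [] => 0
  | [_] => 0
  | s :: t :: w => (if (s = N ∧ t = W) ∨ (s = E ∧ t = S) then 1 else 0) + corners (t :: w)

open scoped Classical in
/-- The quarter plane walks of length `n`. -/
noncomputable def quarterPlaneWalks (n : ℕ) : Finset (List.Vector Step n) :=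
  Finset.univ.filter fun w => IsQuarterPlane w.toList

/-! ### Arch systems -/

/-- Arches above the line (stack 1) are red, arches below the line (stack 2) are blue. -/
inductive Colour : Type
  | red | blue

/-- The letter that inputs an item to the stack of the given colour. -/
def inputLetter : Colour → Step
  | .red => E
  | .blue => N

/-- The letter that outputs an item from the stack of the given colour. -/
def outputLetter : Colour → Step
  | .red => W
  | .blue => S

/-- The number of items in the stack of colour `c` after the operations `w`. -/
def stackHeight (c : Colour) (w : List Step) : ℤ :=
  (w.count (inputLetter c) : ℤ) - (w.count (outputLetter c) : ℤ)

/-- The arches of an operation sequence `w`, whose letters are at the times `0, 1, 2, …`: an item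
enters the stack of colour `colour` at the time `left`, stays there as long as the stack is higher
than it was before that time, and leaves it at the time `right`. -/
structure Arch (w : List Step) : Type where
  left : ℕ
  right : ℕ
  colour : Colour
  lt : left < right
  getElem_left : w[left]? = some (inputLetter colour)
  getElem_right : w[right]? = some (outputLetter colour)
  stays : ∀ m : ℕ, left < m → m ≤ right →
    stackHeight colour (w.take left) < stackHeight colour (w.take m)
  leaves : stackHeight colour (w.take (right + 1)) = stackHeight colour (w.take left)

/-- `A` and `B` have different colours and, once drawn on the same side of the line, cross, the
left endpoint of `A` being the first one. -/
def CrossesAfter {w : List Step} (A B : Arch w) : Prop :=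
  A.colour ≠ B.colour ∧ A.left < B.left ∧ B.left < A.right ∧ A.right < B.right

/-- The graph of an arch system: the vertices are the arches, two of them being adjacent if they
cross. -/
def archGraph (w : List Step) : SimpleGraph (Arch w) where
  Adj A B := CrossesAfter A B ∨ CrossesAfter B A
  symm := ⟨fun _ _ h => h.symm⟩
  loopless := ⟨fun _ h => h.elim (fun h' => h'.1 rfl) (fun h' => h'.1 rfl)⟩

/-- The first arch of every connected component is red. -/
def IsStandard (w : List Step) : Prop :=
  ∀ A : Arch w, (∀ B : Arch w, (archGraph w).Reachable A B → A.left ≤ B.left) →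
    A.colour = Colour.red

/-- The words of the connected standard arch systems with `n` arches and `k` left-right pairs
(connectedness includes that there is at least one arch). -/
def connectedStandard (k n : ℕ) : Set (List Step) :=
  {w | w.length = 2 * n ∧ IsQuarterPlaneLoop w ∧ corners w = k ∧
    (archGraph w).Connected ∧ IsStandard w}

/-! ### The machine with two parallel stacks -/

/-- A state of the machine: the items still to be read, the two stacks (top first), and the items
output so far, the most recent one first. -/
structure MachineState (α : Type) : Type where
  input : List α
  stack₁ : List α
  stack₂ : List α
  outputRev : List α

/-- One operation, `none` if it is impossible. -/
def operate {α : Type} : Step → MachineState α → Option (MachineState α)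
  | E, ⟨i :: inp, s₁, s₂, out⟩ => some ⟨inp, i :: s₁, s₂, out⟩
  | N, ⟨i :: inp, s₁, s₂, out⟩ => some ⟨inp, s₁, i :: s₂, out⟩
  | W, ⟨inp, i :: s₁, s₂, out⟩ => some ⟨inp, s₁, s₂, i :: out⟩
  | S, ⟨inp, s₁, i :: s₂, out⟩ => some ⟨inp, s₁, s₂, i :: out⟩
  | _, _ => none

/-- A sequence of operations, `none` if one of them is impossible. -/
def run {α : Type} : List Step → MachineState α → Option (MachineState α)
  | [], σ => some σ
  | s :: w, σ => (operate s σ).bind (run w)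

/-- The permutation `π 0, π 1, …, π (n-1)` of `0, 1, …, n-1` can be produced from the input
`0, 1, …, n-1` by two parallel stacks. -/
def IsAchievable {n : ℕ} (π : Equiv.Perm (Fin n)) : Prop :=
  ∃ w : List Step,
    run w ⟨List.finRange n, [], [], []⟩ = some ⟨[], [], [], (List.ofFn π).reverse⟩

/-! ### Generating functions

`K[a,x,y]` is `MvPolynomial (Fin 3) K`, its variables `0`, `1`, `2` being `a`, `x`, `y`; the series
in `K[a,x,y][[u]]` are the power series over it. The rings `K[[a,u]]` and `K[[b,v]]` are
`MvPowerSeries (Fin 2) K`, the corner variable being `0` and the length variable being `1`. -/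

section Series

variable (K : Type*) [Field K]

/-- The series `𝒬(a,u;x,y)` of quarter plane walks, counted by length (`u`), corners (`a`) and
coordinates of the endpoint (`x`, `y`). -/
noncomputable def walkSeries : PowerSeries (MvPolynomial (Fin 3) K) :=
  PowerSeries.mk fun n => ∑ w ∈ quarterPlaneWalks n,
    MvPolynomial.X 0 ^ corners w.toList * MvPolynomial.X 1 ^ (xCoord w.toList).toNat *
      MvPolynomial.X 2 ^ (yCoord w.toList).toNat

/-- The series `Q(a,u)` of quarter plane loops, counted by half-length (`u`) and corners (`a`). -/
noncomputable def loopSeries : MvPowerSeries (Fin 2) K := fun e =>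
  (({w : List Step | w.length = 2 * e 1 ∧ IsQuarterPlaneLoop w ∧ corners w = e 0}.ncard : ℕ) : K)

/-- The series `C(b,v)` of connected standard arch systems, counted by arches (`v`) and left-right
pairs (`b`). -/
noncomputable def connectedSeries : MvPowerSeries (Fin 2) K := fun e =>
  (((connectedStandard (e 0) (e 1)).ncard : ℕ) : K)

/-- The series `S(t)` of permutations that two parallel stacks can produce, counted by size. -/
noncomputable def achievableSeries : PowerSeries K :=
  PowerSeries.mk fun n => (({π : Equiv.Perm (Fin n) | IsAchievable π}.ncard : ℕ) : K)

variable {K}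

/-- The series `F(a,u;0,0)`. -/
noncomputable def atOrigin (F : PowerSeries (MvPolynomial (Fin 3) K)) :
    MvPowerSeries (Fin 2) K := fun e =>
  (MvPolynomial.aeval ![(Polynomial.X : Polynomial K), 0, 0]
    (PowerSeries.coeff (e 1) F)).coeff (e 0)

/-- The kernel equation for an unknown series `F(x,y)` in `K[a,x,y][[u]]`,
`(1 - u(x + 1/x + y + 1/y) - u²(a-1)(x/y + y/x)) F(x,y)
  = 1 - (u/y)(1 + ux(a-1)) F(x,0) - (u/x)(1 + uy(a-1)) F(0,y)`,
an identity between power series in `u` over the field `K(a,x,y)` of rational functions. -/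
def KernelEquation (F : PowerSeries (MvPolynomial (Fin 3) K)) : Prop :=
  let R := FractionRing (MvPolynomial (Fin 3) K)
  let ι : MvPolynomial (Fin 3) K →+* R := algebraMap (MvPolynomial (Fin 3) K) R
  let u : PowerSeries R := PowerSeries.X
  let a : PowerSeries R := PowerSeries.C (ι (MvPolynomial.X 0))
  let x : PowerSeries R := PowerSeries.C (ι (MvPolynomial.X 1))
  let y : PowerSeries R := PowerSeries.C (ι (MvPolynomial.X 2))
  let x' : PowerSeries R := PowerSeries.C (ι (MvPolynomial.X 1))⁻¹
  let y' : PowerSeries R := PowerSeries.C (ι (MvPolynomial.X 2))⁻¹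
  let setX : MvPolynomial (Fin 3) K →+* MvPolynomial (Fin 3) K :=
    (MvPolynomial.aeval ![MvPolynomial.X 0, 0, MvPolynomial.X 2]).toRingHom
  let setY : MvPolynomial (Fin 3) K →+* MvPolynomial (Fin 3) K :=
    (MvPolynomial.aeval ![MvPolynomial.X 0, MvPolynomial.X 1, 0]).toRingHom
  let Fxy : PowerSeries R := F.map ι
  let F0y : PowerSeries R := (F.map setX).map ι
  let Fx0 : PowerSeries R := (F.map setY).map ι
  (1 - u * (x + x' + y + y') - u ^ 2 * (a - 1) * (x * y' + y * x')) * Fxy =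
    1 - u * y' * (1 + u * x * (a - 1)) * Fx0 - u * x' * (1 + u * y * (a - 1)) * F0y

/-- The substitution `F(B,V)` is well defined: every coefficient of
`∑ f_{k,n} B ^ k V ^ n` is a finite sum. -/
def Composable {τ : Type*} (F : MvPowerSeries (Fin 2) K) (B V : MvPowerSeries τ K) : Prop :=
  ∀ e : τ →₀ ℕ, (Function.support fun d : Fin 2 →₀ ℕ =>
    MvPowerSeries.coeff d F * MvPowerSeries.coeff e (B ^ d 0 * V ^ d 1)).Finite

/-- The substitution `F(B,V) = ∑ f_{k,n} B ^ k V ^ n`, computed coefficient by coefficient. -/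
noncomputable def comp {τ : Type*} (F : MvPowerSeries (Fin 2) K) (B V : MvPowerSeries τ K) :
    MvPowerSeries τ K := fun e =>
  ∑ᶠ d : Fin 2 →₀ ℕ, MvPowerSeries.coeff d F * MvPowerSeries.coeff e (B ^ d 0 * V ^ d 1)

/-- Where Mathlib's substitution is defined, `comp` agrees with it. -/
theorem comp_eq_subst {τ : Type*} (F : MvPowerSeries (Fin 2) K) (B V : MvPowerSeries τ K)
    (h : MvPowerSeries.HasSubst ![B, V]) : comp F B V = MvPowerSeries.subst ![B, V] F := by
  ext e
  rw [MvPowerSeries.coeff_subst h]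
  refine finsum_congr fun d => ?_
  rw [Finsupp.prod_fintype _ _ (by simp)]
  simp [Fin.prod_univ_two]

end Series

end ParallelStacks

open ParallelStacks

namespace ParallelStacks

open Step

/-! ### Heights and loops -/

/-! Loops are assembled from simple loops. A non-empty loop is simple if no non-empty loop is a
factor of its tail; this is enough to exclude every proper loop factor, since what follows a loop
prefix of a loop is again a loop. Each non-empty loop arises in exactly one way from a simple loop
by inserting a loop, possibly empty, after each letter (`exists_interleave_simple`,
`interleave_injective`). Both facts about uniqueness and about components rest on
`interleave_factor_mem`: a loop factor that avoids the first letter lies inside a single inserted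
word.

An inserted non-empty loop begins with an input and ends with an output, so no corner straddles its
boundary, and a corner of the simple loop survives exactly when its gap stays empty. If `Q` counts
the words allowed in the gaps, a gap at a corner contributes `Q - 1 + a = Q (1 - (1 - a) / Q)` and
any other gap contributes `Q`. A simple loop with `n` arches and `k` corners thus accounts for `u ^
n Q ^ (2 n) (1 - (1 - a) / Q) ^ k`, which is the substitution in the theorem. This is
`wordSeries_eq_one_add_comp`, proved for every class of loops compatible with the decomposition.

In terms of arches, simple means connected (`connected_iff_isSimple`), and the components of the
inserted words remain components (`isStandard_interleave`). The class of all loops uses simple loops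
with either first letter, in bijection by exchanging the stacks, whence the factor 2; the class of
standard loops uses only those that begin with `E`.

For permutations, the two letters of a corner commute, so every achievable permutation has a word
without corners; exchanging the stacks inside a loop factor does not change the action, so the word
may also be taken standard. Such a word is unique: without corners the output determines the times
of inputs and outputs (`map_isInput_eq`), these determine the endpoints of the arches, and
standardness determines the colours (`eq_of_same_arches`). Hence `S` is the series of standard loops
at `a = 0`.

The kernel equation is a recursion on the last step, of order two because a corner involves the last
two steps. Uniqueness holds by this recursion for walks, by triangularity of the substitution for
`C` (`comp_injective`), and by a contraction argument for `S` (`X_pow_dvd_comp_sub`). -/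

@[simp] theorem stackHeight_nil (c : Colour) : stackHeight c [] = 0 := by simp [stackHeight]

@[simp] theorem stackHeight_append (c : Colour) (v w : List Step) :
    stackHeight c (v ++ w) = stackHeight c v + stackHeight c w := by
  simp only [stackHeight, List.count_append, Nat.cast_add]; ring

theorem stackHeight_cons (c : Colour) (s : Step) (w : List Step) :
    stackHeight c (s :: w) = stackHeight c [s] + stackHeight c w :=
  stackHeight_append c [s] w

/-- All prefixes of `w` have height at least `k` in the stack `c`. -/
def StaysAbove (k : ℤ) (c : Colour) (w : List Step) : Prop :=
  ∀ p : List Step, p <+: w → k ≤ stackHeight c p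

theorem prefix_append_cases {α : Type*} {p u v : List α} (h : p <+: u ++ v) :
    p <+: u ∨ ∃ q, q <+: v ∧ p = u ++ q := by
  obtain ⟨t, ht⟩ := h
  rcases List.append_eq_append_iff.1 ht with ⟨a, rfl, _⟩ | ⟨a, rfl, h2⟩
  · exact Or.inl (List.prefix_append _ _)
  · exact Or.inr ⟨a, ⟨t, h2.symm⟩, rfl⟩

theorem staysAbove_append {k : ℤ} {c : Colour} {u v : List Step} :
    StaysAbove k c (u ++ v) ↔ StaysAbove k c u ∧ StaysAbove (k - stackHeight c u) c v := by
  constructor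
  · intro h
    refine ⟨fun p hp => h p (hp.trans (List.prefix_append _ _)), fun p hp => ?_⟩
    have := h (u ++ p) ((List.prefix_append_right_inj u).2 hp)
    rw [stackHeight_append] at this
    linarith
  · rintro ⟨h1, h2⟩ p hp
    rcases prefix_append_cases hp with hp | ⟨q, hq, rfl⟩
    · exact h1 p hp
    · have := h2 q hq
      rw [stackHeight_append]
      linarith

theorem StaysAbove.le {k : ℤ} {c : Colour} {w : List Step} (h : StaysAbove k c w) :
    k ≤ stackHeight c w := h w (List.prefix_refl w)

theorem StaysAbove.mono {k k' : ℤ} {c : Colour} {w : List Step} (h : StaysAbove k c w)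
    (hk : k' ≤ k) : StaysAbove k' c w := fun p hp => hk.trans (h p hp)

theorem isQuarterPlane_iff {w : List Step} : IsQuarterPlane w ↔ ∀ c, StaysAbove 0 c w := by
  constructor
  · rintro h (_ | _) p hp
    exacts [(h p hp).1, (h p hp).2]
  · exact fun h p hp => ⟨h .red p hp, h .blue p hp⟩

theorem isQuarterPlaneLoop_iff {w : List Step} :
    IsQuarterPlaneLoop w ↔ ∀ c, StaysAbove 0 c w ∧ stackHeight c w = 0 := by
  unfold IsQuarterPlaneLoop
  rw [isQuarterPlane_iff]
  constructor
  · rintro ⟨h, h1, h2⟩ (_ | _)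
    exacts [⟨h _, h1⟩, ⟨h _, h2⟩]
  · exact fun h => ⟨fun c => (h c).1, (h .red).2, (h .blue).2⟩

theorem IsQuarterPlaneLoop.staysAbove {w : List Step} (h : IsQuarterPlaneLoop w) (c : Colour) :
    StaysAbove 0 c w := (isQuarterPlaneLoop_iff.1 h c).1

theorem IsQuarterPlaneLoop.height {w : List Step} (h : IsQuarterPlaneLoop w) (c : Colour) :
    stackHeight c w = 0 := (isQuarterPlaneLoop_iff.1 h c).2

theorem isQuarterPlaneLoop_nil : IsQuarterPlaneLoop [] := by
  rw [isQuarterPlaneLoop_iff]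
  intro c
  refine ⟨fun p hp => ?_, by simp⟩
  rw [List.prefix_nil.1 hp]; simp

theorem IsQuarterPlaneLoop.append {u v : List Step} (hu : IsQuarterPlaneLoop u)
    (hv : IsQuarterPlaneLoop v) : IsQuarterPlaneLoop (u ++ v) := by
  rw [isQuarterPlaneLoop_iff]
  intro c
  rw [staysAbove_append, stackHeight_append, hu.height c, hv.height c]
  exact ⟨⟨hu.staysAbove c, by simpa using hv.staysAbove c⟩, by simp⟩

theorem IsQuarterPlaneLoop.of_append {u v : List Step} (h : IsQuarterPlaneLoop (u ++ v))
    (hu : ∀ c, stackHeight c u = 0) : IsQuarterPlaneLoop u ∧ IsQuarterPlaneLoop v := by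
  simp only [isQuarterPlaneLoop_iff] at *
  refine ⟨fun c => ⟨(staysAbove_append.1 (h c).1).1, hu c⟩, fun c => ⟨?_, ?_⟩⟩
  · have := (staysAbove_append.1 (h c).1).2
    rwa [hu c, sub_zero] at this
  · have := (h c).2
    rwa [stackHeight_append, hu c, zero_add] at this

/-- If `u ++ v` is a loop, whose second half is the first half of a quarter plane walk, then both
are loops. -/
theorem IsQuarterPlaneLoop.of_append_of_nonneg {u v : List Step}
    (h : IsQuarterPlaneLoop (u ++ v)) (hv : ∀ c, 0 ≤ stackHeight c v) :
    IsQuarterPlaneLoop u ∧ IsQuarterPlaneLoop v := by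
  refine h.of_append fun c => ?_
  have h1 := (staysAbove_append.1 (h.staysAbove c)).1.le
  have h2 := h.height c
  rw [stackHeight_append] at h2
  linarith [hv c]

/-! ### Inserting loops after the letters of a word -/

/-- The word `s₁ L₁ s₂ L₂ ⋯` obtained from the list of pairs `(sᵢ, Lᵢ)`. -/
def interleave : List (Step × List Step) → List Step
  | [] => []
  | (s, L) :: l => s :: (L ++ interleave l)

@[simp] theorem interleave_nil : interleave [] = [] := rfl

@[simp] theorem interleave_cons (s : Step) (L : List Step) (l : List (Step × List Step)) :
    interleave ((s, L) :: l) = s :: (L ++ interleave l) := rfl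

@[simp] theorem interleave_append (l m : List (Step × List Step)) :
    interleave (l ++ m) = interleave l ++ interleave m := by
  induction l with
  | nil => rfl
  | cons p l ih => obtain ⟨s, L⟩ := p; simp [ih]

/-- All inserted words are loops. -/
def LoopsInserted (l : List (Step × List Step)) : Prop := ∀ p ∈ l, IsQuarterPlaneLoop p.2

theorem LoopsInserted.tail {p : Step × List Step} {l : List (Step × List Step)}
    (h : LoopsInserted (p :: l)) : LoopsInserted l := fun q hq => h q (List.mem_cons_of_mem _ hq)

theorem LoopsInserted.head {p : Step × List Step} {l : List (Step × List Step)}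
    (h : LoopsInserted (p :: l)) : IsQuarterPlaneLoop p.2 := h p List.mem_cons_self

theorem loopsInserted_append {l m : List (Step × List Step)} :
    LoopsInserted (l ++ m) ↔ LoopsInserted l ∧ LoopsInserted m := by
  simp only [LoopsInserted, List.mem_append, or_imp, forall_and]

theorem stackHeight_interleave {l : List (Step × List Step)} (h : LoopsInserted l) (c : Colour) :
    stackHeight c (interleave l) = stackHeight c (l.map Prod.fst) := by
  induction l with
  | nil => rfl
  | cons p l ih =>
    obtain ⟨s, L⟩ := p
    rw [interleave_cons, stackHeight_cons, stackHeight_append, h.head.height, ih h.tail, zero_add]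
    exact (stackHeight_cons c s _).symm

theorem staysAbove_cons {k : ℤ} {c : Colour} {s : Step} {v : List Step} :
    StaysAbove k c (s :: v) ↔ k ≤ 0 ∧ StaysAbove (k - stackHeight c [s]) c v := by
  have := staysAbove_append (k := k) (c := c) (u := [s]) (v := v)
  rw [List.singleton_append] at this
  rw [this]
  constructor
  · rintro ⟨h1, h2⟩
    exact ⟨by simpa using h1 [] List.nil_prefix, h2⟩
  · rintro ⟨h1, h2⟩
    refine ⟨fun p hp => ?_, h2⟩
    rcases List.prefix_cons_iff.1 hp with rfl | ⟨t, rfl, ht⟩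
    · simpa using h1
    · rw [List.prefix_nil.1 ht]
      have := h2 [] List.nil_prefix
      rw [stackHeight_nil] at this
      linarith

/-- An inserted loop never goes below the height at which it starts and returns to it, so it changes
neither the minimum nor the final height. -/
theorem staysAbove_interleave {l : List (Step × List Step)} (h : LoopsInserted l) {c : Colour}
    {k : ℤ} : StaysAbove k c (interleave l) ↔ StaysAbove k c (l.map Prod.fst) := by
  induction l generalizing k with
  | nil => rfl
  | cons p l ih =>
    obtain ⟨s, L⟩ := p
    rw [interleave_cons, List.map_cons, staysAbove_cons, staysAbove_cons, staysAbove_append,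
      ih h.tail, h.head.height, sub_zero]
    refine ⟨fun H => ⟨H.1, H.2.2⟩, fun H => ⟨H.1, ?_, H.2⟩⟩
    refine (h.head.staysAbove c).mono ?_
    simpa using H.2 [] List.nil_prefix

theorem isQuarterPlaneLoop_interleave {l : List (Step × List Step)} (h : LoopsInserted l) :
    IsQuarterPlaneLoop (interleave l) ↔ IsQuarterPlaneLoop (l.map Prod.fst) := by
  simp only [isQuarterPlaneLoop_iff, staysAbove_interleave h, stackHeight_interleave h]

theorem length_interleave_le (l : List (Step × List Step)) :
    l.length ≤ (interleave l).length := by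
  induction l with
  | nil => simp
  | cons p l ih => obtain ⟨s, L⟩ := p; simp; omega

/-- The cut falls after the letter of some block; a cut between two blocks can be attributed to the
end of the earlier one. Non-emptiness of `a` guarantees that such a block exists. -/
theorem interleave_eq_append {l : List (Step × List Step)} {a r : List Step} (ha : a ≠ [])
    (h : interleave l = a ++ r) :
    ∃ l₁ s L₁ L₂ l₂, l = l₁ ++ (s, L₁ ++ L₂) :: l₂ ∧ a = interleave l₁ ++ s :: L₁ ∧
      r = L₂ ++ interleave l₂ := by
  induction l generalizing a with
  | nil => simp at h; exact absurd h.1 ha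
  | cons p l ih =>
    obtain ⟨s, L⟩ := p
    obtain ⟨t, a, rfl⟩ := List.exists_cons_of_ne_nil ha
    rw [interleave_cons, List.cons_append, List.cons.injEq] at h
    obtain ⟨rfl, h⟩ := h
    rcases List.append_eq_append_iff.1 h with ⟨b, rfl, h2⟩ | ⟨b, rfl, h2⟩
    · rcases eq_or_ne b [] with rfl | hb
      · exact ⟨[], s, L, [], l, by simp, by simp, by simpa using h2.symm⟩
      · obtain ⟨l₁, t, L₁, L₂, l₂, rfl, rfl, rfl⟩ := ih hb h2
        exact ⟨(s, L) :: l₁, t, L₁, L₂, l₂, by simp, by simp, rfl⟩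
    · exact ⟨[], s, a, b, l, by simp, by simp, h2⟩

/-! ### Simple loops -/

/-- The only factor of `w` that is a loop is the empty one. -/
def LoopFree (w : List Step) : Prop := ∀ v, v <:+: w → IsQuarterPlaneLoop v → v = []

/-- A non-empty loop such that no proper factor is a non-empty loop. -/
def IsSimple (w : List Step) : Prop := w ≠ [] ∧ IsQuarterPlaneLoop w ∧ LoopFree w.tail

theorem LoopFree.infix {v w : List Step} (h : LoopFree w) (hv : v <:+: w) : LoopFree v :=
  fun u hu => h u (hu.trans hv)

/-- Suppose that the loop `g` started in one block and ended in a later one. The part of `g` in the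
last inserted word is a prefix of a loop, so it has non-negative heights and can be cut off, leaving
a loop. The part of `g` in the first inserted word is a suffix of a loop and a prefix of a loop, so
it has height zero and can be removed too. What remains reduces to a non-empty loop in the tail of
the underlying word. -/
theorem interleave_factor_mem {l : List (Step × List Step)} {a g b : List Step}
    (hl : LoopsInserted l) (hf : LoopFree (l.map Prod.fst).tail) (ha : a ≠ [])
    (hg : IsQuarterPlaneLoop g) (h : interleave l = a ++ (g ++ b)) :
    ∃ l₁ s L₁ L₂ l₂, l = l₁ ++ (s, L₁ ++ (g ++ L₂)) :: l₂ ∧ a = interleave l₁ ++ s :: L₁ ∧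
      b = L₂ ++ interleave l₂ := by
  obtain ⟨l₁, s, L₁, L₂, l₂, rfl, rfl, h2⟩ := interleave_eq_append ha h
  rcases List.append_eq_append_iff.1 h2 with ⟨d, rfl, h3⟩ | ⟨d, rfl, h3⟩
  · exact ⟨l₁, s, L₁, d, l₂, rfl, rfl, h3⟩
  · rcases eq_or_ne d [] with rfl | hd
    · simp only [List.append_nil, List.nil_append] at h3 ⊢
      exact ⟨l₁, s, L₁, [], l₂, by simp, rfl, by simp [h3]⟩
    · exfalso
      obtain ⟨l₃, t, M₁, M₂, l₄, rfl, rfl, rfl⟩ := interleave_eq_append hd h3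
      rw [loopsInserted_append] at hl
      obtain ⟨hl₁, hl⟩ := hl
      have hL := hl.head
      obtain ⟨hl₃, hl₄⟩ := loopsInserted_append.1 hl.tail
      have hM := hl₄.head
      have key : IsQuarterPlaneLoop ((L₂ ++ (interleave l₃ ++ [t])) ++ M₁) := by
        simpa using hg
      have hM1 : ∀ c, 0 ≤ stackHeight c M₁ := fun c => (hM.staysAbove c) _ (List.prefix_append _ _)
      have h5 := (key.of_append_of_nonneg hM1).1
      have h6 := (h5.of_append fun c => le_antisymm ?_ ?_).2
      -- The trimmed loop consists of the blocks `l₃` and the bare letter `t`, whose inserted prefix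
      -- `M₁` has been cut off.
      · have h7 : LoopsInserted (l₃ ++ [(t, [])]) := by
          refine loopsInserted_append.2 ⟨hl₃, fun p hp => ?_⟩
          rw [List.mem_singleton.1 hp]; exact isQuarterPlaneLoop_nil
        have h8 := (isQuarterPlaneLoop_interleave h7).1 (by simpa using h6)
        have := hf _ ?_ h8
        · simp at this
        · cases l₁ with
          | nil => exact ⟨[], l₄.map Prod.fst, by simp⟩
          | cons p l₁ => exact ⟨l₁.map Prod.fst ++ [s], l₄.map Prod.fst, by simp⟩
      · have h7 := hL.height c
        rw [stackHeight_append] at h7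
        have := (hL.staysAbove c) _ (List.prefix_append L₁ L₂)
        linarith
      · exact (h5.staysAbove c) _ (List.prefix_append _ _)

/-- The inserted word after the first letter is the longest possible. If one choice `L` were a
prefix of another choice `L ++ d`, then `d` would be a loop factor starting at the end of the block
of `L`; by `interleave_factor_mem` it would lie inside one block, and its position leaves room only
for `d = []`. -/
theorem interleave_injective {l m : List (Step × List Step)} (hl : LoopsInserted l)
    (hm : LoopsInserted m) (hfl : LoopFree (l.map Prod.fst).tail)
    (hfm : LoopFree (m.map Prod.fst).tail) (h : interleave l = interleave m) : l = m := by
  have aux : ∀ {l m : List (Step × List Step)} {s : Step} {L M : List Step},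
      LoopsInserted ((s, L) :: l) → LoopsInserted ((s, M) :: m) →
      LoopFree (((s, L) :: l).map Prod.fst).tail →
      interleave ((s, L) :: l) = interleave ((s, M) :: m) → ∀ d, M = L ++ d → d = [] := by
    rintro l m s L M hl hm hfl h d rfl
    have hL := hl.head
    have hd : IsQuarterPlaneLoop d := (hm.head.of_append fun c => hL.height c).2
    obtain ⟨l₁, t, L₁, L₂, l₂, h1, h2, h3⟩ := interleave_factor_mem hl hfl (a := s :: L)
      (b := interleave m) (by simp) hd (by simpa using h)
    cases l₁ with
    | nil =>
      simp only [List.nil_append, interleave_nil, List.cons.injEq, Prod.mk.injEq] at h1 h2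
      have := h1.1.2
      rw [← h2.2] at this
      exact (by simpa using congrArg List.length this : d = [] ∧ L₂ = []).1
    | cons p l₁ =>
      exfalso
      simp only [List.cons_append, List.cons.injEq] at h1
      rw [← h1.1] at h2
      have := congrArg List.length h2
      simp at this
  induction l generalizing m with
  | nil =>
    cases m with
    | nil => rfl
    | cons p m => simp [interleave] at h
  | cons p l ih =>
    cases m with
    | nil => simp [interleave] at h
    | cons q m =>
      obtain ⟨s, L⟩ := p
      obtain ⟨t, M⟩ := q
      have h0 := h
      rw [interleave_cons, interleave_cons, List.cons.injEq] at h
      obtain ⟨rfl, h⟩ := h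
      have hLM : L = M := by
        rcases List.append_eq_append_iff.1 h with ⟨d, hd, _⟩ | ⟨d, hd, _⟩
        · rw [hd, aux hl hm hfl h0 d hd, List.append_nil]
        · rw [hd, aux hm hl hfm h0.symm d hd, List.append_nil]
      subst hLM
      have := ih hl.tail hm.tail (hfl.infix (List.tail_suffix _).isInfix)
        (hfm.infix (List.tail_suffix _).isInfix) (List.append_cancel_left h)
      rw [this]

/-- As long as the tail of the underlying word contains a non-empty loop, the blocks that spell it
can be absorbed into the word inserted just before them. The number of blocks decreases each time.
-/
theorem exists_interleave_loopFree (l : List (Step × List Step)) (hl : LoopsInserted l)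
    (hne : l ≠ []) : ∃ m, m ≠ [] ∧ LoopsInserted m ∧ LoopFree (m.map Prod.fst).tail ∧
      interleave m = interleave l := by
  induction h : l.length using Nat.strong_induction_on generalizing l with
  | _ n ih =>
    by_cases hf : LoopFree (l.map Prod.fst).tail
    · exact ⟨l, hne, hl, hf, rfl⟩
    · simp only [LoopFree, not_forall] at hf
      obtain ⟨v, ⟨a, b, hv⟩, hloop, hv0⟩ := hf
      obtain ⟨p, l, rfl⟩ := List.exists_cons_of_ne_nil hne
      rw [List.map_cons, List.tail_cons] at hv
      obtain ⟨l', lb, rfl, hl', hb⟩ := List.map_eq_append_iff.1 hv.symm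
      obtain ⟨la, lv, rfl, ha, hv⟩ := List.map_eq_append_iff.1 hl'
      -- The block `q` that absorbs the loop exists because the loop avoids the first letter.
      obtain ⟨x, q, hx⟩ : ∃ x q, p :: la = x ++ [q] :=
        ⟨(p :: la).dropLast, (p :: la).getLast (by simp), (List.dropLast_append_getLast _).symm⟩
      obtain ⟨s, L⟩ := q
      have e : p :: ((la ++ lv) ++ lb) = x ++ ((s, L) :: (lv ++ lb)) := by
        rw [List.append_assoc, ← List.cons_append, hx]; simp
      rw [e] at hl h ⊢
      obtain ⟨h1, h2⟩ := loopsInserted_append.1 hl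
      obtain ⟨h3, h4⟩ := loopsInserted_append.1 h2.tail
      have hlv : IsQuarterPlaneLoop (interleave lv) := by
        rw [isQuarterPlaneLoop_interleave h3, hv]; exact hloop
      have hlen : lv ≠ [] := by
        rintro rfl
        simp at hv
        exact hv0 (by simp [← hv])
      have hpos := List.length_pos_iff.2 hlen
      obtain ⟨m, hm, hm1, hm2, hm3⟩ := ih (x ++ (s, L ++ interleave lv) :: lb).length
        (by subst h; simp; omega) (x ++ (s, L ++ interleave lv) :: lb)
        (loopsInserted_append.2 ⟨h1, fun p hp => by
          rcases List.mem_cons.1 hp with rfl | hp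
          · exact h2.head.append hlv
          · exact h4 p hp⟩) (by simp) rfl
      exact ⟨m, hm, hm1, hm2, by rw [hm3]; simp⟩

theorem interleave_pairs_nil (w : List Step) : interleave (w.map fun s => (s, [])) = w := by
  induction w with
  | nil => rfl
  | cons s w ih => simp [ih]

theorem exists_interleave_simple {w : List Step} (hw : IsQuarterPlaneLoop w) (hne : w ≠ []) :
    ∃ l, IsSimple (l.map Prod.fst) ∧ LoopsInserted l ∧ interleave l = w := by
  obtain ⟨m, h1, h2, h3, h4⟩ := exists_interleave_loopFree (w.map fun s => (s, []))
    (fun p hp => by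
      obtain ⟨s, _, rfl⟩ := List.mem_map.1 hp
      exact isQuarterPlaneLoop_nil) (by simpa using hne)
  rw [interleave_pairs_nil] at h4
  exact ⟨m, ⟨by simpa using h1, (isQuarterPlaneLoop_interleave h2).1 (h4 ▸ hw), h3⟩, h2, h4⟩

/-! ### First and last letters, corners -/

/-- The letters that input an item. -/
def IsInput (s : Step) : Prop := s = E ∨ s = N

instance : DecidablePred IsInput := fun s => inferInstanceAs (Decidable (s = E ∨ s = N))

theorem stackHeight_singleton (c : Colour) (s : Step) :
    stackHeight c [s] = if s = inputLetter c then 1 else if s = outputLetter c then -1 else 0 := by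
  cases c <;> cases s <;> simp [stackHeight, inputLetter, outputLetter]

theorem IsQuarterPlaneLoop.head_isInput {s : Step} {w : List Step}
    (h : IsQuarterPlaneLoop (s :: w)) : IsInput s := by
  have h1 := (staysAbove_cons.1 (h.staysAbove .red)).2 [] List.nil_prefix
  have h2 := (staysAbove_cons.1 (h.staysAbove .blue)).2 [] List.nil_prefix
  rw [stackHeight_singleton] at h1 h2
  cases s <;> simp [IsInput, inputLetter, outputLetter] at *

theorem IsQuarterPlaneLoop.last_not_isInput {s : Step} {w : List Step}
    (h : IsQuarterPlaneLoop (w ++ [s])) : ¬ IsInput s := by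
  have h1 := (h.staysAbove .red) _ (List.prefix_append w [s])
  have h2 := (h.staysAbove .blue) _ (List.prefix_append w [s])
  have h3 := h.height .red
  have h4 := h.height .blue
  rw [stackHeight_append, stackHeight_singleton] at h3 h4
  cases s <;> simp [IsInput, inputLetter, outputLetter] at * <;> omega

/-- The contribution of the first two letters to the number of corners of `s :: w`. -/
def cornerHead (s : Step) : List Step → ℕ
  | [] => 0
  | t :: _ => if (s = N ∧ t = W) ∨ (s = E ∧ t = S) then 1 else 0

theorem corners_cons (s : Step) (w : List Step) :
    corners (s :: w) = cornerHead s w + corners w := by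
  cases w <;> simp [corners, cornerHead]

theorem cornerHead_eq_zero_of_not_isInput {s : Step} (h : ¬ IsInput s) (w : List Step) :
    cornerHead s w = 0 := by
  cases w <;> cases s <;> simp_all [cornerHead, IsInput]

theorem cornerHead_eq_zero_of_isInput {t : Step} (h : IsInput t) (s : Step) (w : List Step) :
    cornerHead s (t :: w) = 0 := by
  cases t <;> simp_all [cornerHead, IsInput]

theorem cornerHead_le_one (s : Step) (w : List Step) : cornerHead s w ≤ 1 := by
  cases w
  · simp [cornerHead]
  · simp only [cornerHead]; split_ifs <;> simp

theorem corners_append_of_not_isInput {s : Step} (h : ¬ IsInput s) (v w : List Step) :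
    corners (v ++ [s] ++ w) = corners (v ++ [s]) + corners w := by
  induction v with
  | nil => simp [corners_cons, cornerHead_eq_zero_of_not_isInput h, corners]
  | cons t v ih =>
    simp only [List.cons_append] at ih ⊢
    rw [corners_cons, corners_cons, ih]
    cases v <;> simp [cornerHead, add_assoc]

theorem corners_loop_append {L : List Step} (hL : IsQuarterPlaneLoop L) (w : List Step) :
    corners (L ++ w) = corners L + corners w := by
  rcases List.eq_nil_or_concat' L with rfl | ⟨v, s, rfl⟩
  · simp [corners]
  · exact corners_append_of_not_isInput hL.last_not_isInput v w

/-- A corner is an input followed by an output. A non-empty loop begins with an input and ends with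
an output, so it destroys a corner in whose middle it is inserted and creates none at its boundary.
-/
theorem corners_cons_loop_append {L : List Step} (hL : IsQuarterPlaneLoop L) (s : Step)
    (w : List Step) : corners (s :: (L ++ w)) =
      (corners L + if L = [] then cornerHead s w else 0) + corners w := by
  rw [corners_cons, corners_loop_append hL]
  cases L with
  | nil => simp [corners]
  | cons t L => simp [cornerHead_eq_zero_of_isInput hL.head_isInput]

theorem cornerHead_interleave (s : Step) (l : List (Step × List Step)) :
    cornerHead s (interleave l) = cornerHead s (l.map Prod.fst) := by
  cases l with
  | nil => rfl
  | cons p l => obtain ⟨t, L⟩ := p; simp [cornerHead]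

theorem corners_interleave_cons {s : Step} {L : List Step} {l : List (Step × List Step)}
    (hL : IsQuarterPlaneLoop L) : corners (interleave ((s, L) :: l)) =
      (corners L + if L = [] then cornerHead s (l.map Prod.fst) else 0) +
        corners (interleave l) := by
  rw [interleave_cons, corners_cons_loop_append hL, cornerHead_interleave]

/-! ### Arches -/

theorem stackHeight_take_succ (c : Colour) {w : List Step} {m : ℕ} {s : Step}
    (h : w[m]? = some s) :
    stackHeight c (w.take (m + 1)) = stackHeight c (w.take m) + stackHeight c [s] := by
  rw [List.take_add_one, h, stackHeight_append]; rfl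

theorem inputLetter_ne_outputLetter (c d : Colour) : inputLetter c ≠ outputLetter d := by
  cases c <;> cases d <;> simp [inputLetter, outputLetter]

theorem inputLetter_injective : Function.Injective inputLetter := by
  rintro (_ | _) (_ | _) <;> simp [inputLetter]

theorem outputLetter_injective : Function.Injective outputLetter := by
  rintro (_ | _) (_ | _) <;> simp [outputLetter]

theorem stackHeight_inputLetter (c : Colour) : stackHeight c [inputLetter c] = 1 := by
  simp [stackHeight_singleton]

theorem stackHeight_outputLetter (c : Colour) : stackHeight c [outputLetter c] = -1 := by
  simp [stackHeight_singleton, (inputLetter_ne_outputLetter c c).symm]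

theorem getElem?_eq_inputLetter {c : Colour} {w : List Step} {m : ℕ}
    (h : stackHeight c (w.take m) < stackHeight c (w.take (m + 1))) :
    w[m]? = some (inputLetter c) ∧
      stackHeight c (w.take (m + 1)) = stackHeight c (w.take m) + 1 := by
  cases hm : w[m]? with
  | none =>
    rw [List.take_add_one, hm] at h
    simp at h
  | some s =>
    rw [stackHeight_take_succ c hm] at h ⊢
    rw [stackHeight_singleton] at h ⊢
    split_ifs at h ⊢ with h1 h2
    · exact ⟨by rw [h1], rfl⟩
    · omega
    · omega

theorem getElem?_eq_outputLetter {c : Colour} {w : List Step} {m : ℕ}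
    (h : stackHeight c (w.take (m + 1)) < stackHeight c (w.take m)) :
    w[m]? = some (outputLetter c) ∧
      stackHeight c (w.take (m + 1)) = stackHeight c (w.take m) - 1 := by
  cases hm : w[m]? with
  | none =>
    rw [List.take_add_one, hm] at h
    simp at h
  | some s =>
    rw [stackHeight_take_succ c hm] at h ⊢
    rw [stackHeight_singleton] at h ⊢
    split_ifs at h ⊢ with h1 h2
    · omega
    · exact ⟨by rw [h2], rfl⟩
    · omega

theorem IsQuarterPlaneLoop.height_take {w : List Step} (h : IsQuarterPlaneLoop w) (c : Colour)
    (m : ℕ) : 0 ≤ stackHeight c (w.take m) := h.staysAbove c _ (List.take_prefix m w)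

/-- The matching input is at the last earlier time at which the stack is no higher than just after
the output. -/
theorem exists_arch_of_output {w : List Step} (hw : IsQuarterPlaneLoop w) {c : Colour} {r : ℕ}
    (hr : w[r]? = some (outputLetter c)) : ∃ A : Arch w, A.right = r ∧ A.colour = c := by
  classical
  have h1 := stackHeight_take_succ c hr
  rw [stackHeight_outputLetter] at h1
  set P : ℕ → Prop := fun l => stackHeight c (w.take l) ≤ stackHeight c (w.take (r + 1)) with hP
  have h0 : P 0 := by simpa [hP] using hw.height_take c (r + 1)
  set l := Nat.findGreatest P r with hl
  have hPl : P l := Nat.findGreatest_spec (Nat.zero_le r) h0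
  have hlr : l ≤ r := Nat.findGreatest_le r
  have hmax : ∀ m, l < m → m ≤ r → ¬ P m := fun m h2 h3 => Nat.findGreatest_is_greatest h2 h3
  have hlt : l < r := by
    rcases hlr.lt_or_eq with h | h
    · exact h
    · rw [h] at hPl
      simp only [hP] at hPl
      omega
  have h2 := hmax (l + 1) (by omega) hlt
  simp only [hP, not_le] at h2 hPl hmax
  obtain ⟨h3, h4⟩ := getElem?_eq_inputLetter (hPl.trans_lt h2)
  exact ⟨⟨l, r, c, hlt, h3, hr, fun m hm hm' => hPl.trans_lt (hmax m hm hm'), by omega⟩, rfl, rfl⟩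

/-- The matching output is the step that first brings the stack back to its height before the input;
it exists because the loop ends with empty stacks. -/
theorem exists_arch_of_input {w : List Step} (hw : IsQuarterPlaneLoop w) {c : Colour} {l : ℕ}
    (hl : w[l]? = some (inputLetter c)) : ∃ A : Arch w, A.left = l ∧ A.colour = c := by
  classical
  have h1 := stackHeight_take_succ c hl
  rw [stackHeight_inputLetter] at h1
  have hlen : l < w.length := (List.getElem?_eq_some_iff.1 hl).1
  have hex : ∃ m, l < m ∧ stackHeight c (w.take m) ≤ stackHeight c (w.take l) :=
    ⟨w.length, hlen, by rw [List.take_length, hw.height]; exact hw.height_take c l⟩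
  obtain ⟨h2, h3⟩ := Nat.find_spec hex
  have hmin : ∀ m, l < m → m < Nat.find hex → stackHeight c (w.take l) < stackHeight c (w.take m) :=
    fun m h4 h5 => by
      have := Nat.find_min hex h5
      simp only [not_and, not_le] at this
      exact this h4
  obtain ⟨r, hr⟩ : ∃ r, Nat.find hex = r + 1 := ⟨Nat.find hex - 1, by omega⟩
  rw [hr] at h2 h3 hmin
  have hlr : l < r := by
    rcases (Nat.lt_succ_iff.1 h2).lt_or_eq with h | h
    · exact h
    · rw [← h] at h3; omega
  have h4 := hmin r hlr (Nat.lt_succ_self r)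
  obtain ⟨h5, h6⟩ := getElem?_eq_outputLetter (h3.trans_lt h4)
  exact ⟨⟨l, r, c, hlr, hl, h5, fun m hm hm' => hmin m hm (by omega), by omega⟩, rfl, rfl⟩

theorem exists_arch_at {w : List Step} (hw : IsQuarterPlaneLoop w) {m : ℕ} (hm : m < w.length) :
    ∃ A : Arch w, A.left = m ∨ A.right = m := by
  have h : w[m]? = some w[m] := List.getElem?_eq_getElem hm
  have : ∃ c, w[m] = inputLetter c ∨ w[m] = outputLetter c := by
    cases w[m]
    exacts [⟨.red, .inl rfl⟩, ⟨.blue, .inl rfl⟩, ⟨.red, .inr rfl⟩, ⟨.blue, .inr rfl⟩]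
  obtain ⟨c, hc | hc⟩ := this
  · obtain ⟨A, hA, _⟩ := exists_arch_of_input hw (h.trans (congrArg some hc))
    exact ⟨A, .inl hA⟩
  · obtain ⟨A, hA, _⟩ := exists_arch_of_output hw (h.trans (congrArg some hc))
    exact ⟨A, .inr hA⟩

namespace Arch

variable {w : List Step}

theorem ext_of {A B : Arch w} (hl : A.left = B.left) (hr : A.right = B.right)
    (hc : A.colour = B.colour) : A = B := by
  cases A; cases B; simp at hl hr hc; subst hl hr hc; rfl

theorem right_lt_length (A : Arch w) : A.right < w.length :=
  (List.getElem?_eq_some_iff.1 A.getElem_right).1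

theorem left_lt_length (A : Arch w) : A.left < w.length := A.lt.trans A.right_lt_length

theorem eq_of_left {A B : Arch w} (h : A.left = B.left) : A = B := by
  have hc : A.colour = B.colour := by
    have h1 := A.getElem_left
    rw [h, B.getElem_left, Option.some_inj] at h1
    exact (inputLetter_injective h1).symm
  have aux : ∀ {A B : Arch w}, A.left = B.left → A.colour = B.colour → B.right ≤ A.right := by
    intro A B h hc
    by_contra! hlt
    have h1 := B.stays (A.right + 1) (by have := A.lt; omega) hlt
    have h2 := A.leaves
    rw [hc, h] at h2
    omega
  exact ext_of h (le_antisymm (aux h.symm hc.symm) (aux h hc)) hc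

theorem eq_of_right {A B : Arch w} (h : A.right = B.right) : A = B := by
  have hc : A.colour = B.colour := by
    have h1 := A.getElem_right
    rw [h, B.getElem_right, Option.some_inj] at h1
    exact (outputLetter_injective h1).symm
  have aux : ∀ {A B : Arch w}, A.right = B.right → A.colour = B.colour → B.left ≤ A.left := by
    intro A B h hc
    by_contra! hlt
    have h1 := A.stays B.left hlt (by have := B.lt; omega)
    have h2 := A.leaves
    have h3 := B.leaves
    rw [hc] at h1 h2
    rw [h] at h2
    omega
  exact ext_of (le_antisymm (aux h.symm hc.symm) (aux h hc)) h hc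

theorem left_ne_right (A B : Arch w) : A.left ≠ B.right := by
  intro h
  have h1 := A.getElem_left
  rw [h, B.getElem_right, Option.some_inj] at h1
  exact inputLetter_ne_outputLetter _ _ h1.symm

/-- Last in, first out: arches of one colour are nested or disjoint. -/
theorem right_lt_of_colour_eq {A B : Arch w} (hc : A.colour = B.colour) (h1 : A.left < B.left)
    (h2 : B.left < A.right) : B.right < A.right := by
  by_contra! h
  rcases h.lt_or_eq with h | h
  · have h3 := B.stays (A.right + 1) (by omega) h
    have h4 := A.leaves
    have h5 := A.stays B.left h1 h2.le
    rw [hc] at h4 h5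
    omega
  · rw [eq_of_right h] at h1
    exact lt_irrefl _ h1

/-- The colour condition is automatic, so adjacency depends on the endpoints alone. This allows
graphs of words with different colours to be compared. -/
theorem crossesAfter_iff {A B : Arch w} :
    CrossesAfter A B ↔ A.left < B.left ∧ B.left < A.right ∧ A.right < B.right :=
  ⟨fun h => h.2, fun h => ⟨fun hc => by
    have := right_lt_of_colour_eq hc h.1 h.2.1
    omega, h⟩⟩

theorem adj_iff {A B : Arch w} : (archGraph w).Adj A B ↔
    (A.left < B.left ∧ B.left < A.right ∧ A.right < B.right) ∨
      (B.left < A.left ∧ A.left < B.right ∧ B.right < A.right) := by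
  rw [← crossesAfter_iff, ← crossesAfter_iff]; rfl

theorem colour_ne_of_adj {A B : Arch w} (h : (archGraph w).Adj A B) : A.colour ≠ B.colour := by
  rcases h with h | h
  · exact h.1
  · exact h.1.symm

end Arch

/-! ### Factors that are loops -/

theorem isQuarterPlaneLoop_factor_iff {p v q : List Step} : IsQuarterPlaneLoop v ↔
    ∀ c, (∀ m, p.length ≤ m → m ≤ p.length + v.length →
      stackHeight c p ≤ stackHeight c ((p ++ (v ++ q)).take m)) ∧
      stackHeight c ((p ++ (v ++ q)).take (p.length + v.length)) = stackHeight c p := by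
  have key : ∀ c n, n ≤ v.length → stackHeight c ((p ++ (v ++ q)).take (p.length + n)) =
      stackHeight c p + stackHeight c (v.take n) := by
    intro c n hn
    rw [List.take_length_add_append, stackHeight_append, List.take_append_of_le_length hn]
  rw [isQuarterPlaneLoop_iff]
  refine forall_congr' fun c => ?_
  rw [key c v.length le_rfl, List.take_length]
  refine and_congr ⟨fun h m h1 h2 => ?_, fun h r hr => ?_⟩ (by simp)
  · obtain ⟨n, rfl⟩ := Nat.exists_eq_add_of_le h1
    rw [key c n (by omega)]
    have := h _ (List.take_prefix n v)
    omega
  · have hlen := hr.length_le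
    have := h (p.length + r.length) (by omega) (by omega)
    rw [key c _ hlen, ← List.prefix_iff_eq_take.1 hr] at this
    omega

/-- The endpoints of the arches of a factor that is a loop are matched inside the factor. -/
theorem Arch.left_mem_iff_right_mem {p v q : List Step} (hv : IsQuarterPlaneLoop v)
    (A : Arch (p ++ (v ++ q))) : (p.length ≤ A.left ∧ A.left < p.length + v.length) ↔
      (p.length ≤ A.right ∧ A.right < p.length + v.length) := by
  obtain ⟨h1, h2⟩ := (isQuarterPlaneLoop_factor_iff (p := p) (q := q)).1 hv A.colour
  have hlt := A.lt
  have hp : stackHeight A.colour ((p ++ (v ++ q)).take p.length) = stackHeight A.colour p := by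
    simp
  constructor
  · rintro ⟨h3, h4⟩
    refine ⟨by omega, ?_⟩
    by_contra! h
    have h5 := A.stays _ h4 h
    have h6 := h1 _ h3 h4.le
    omega
  · rintro ⟨h3, h4⟩
    refine ⟨?_, by omega⟩
    by_contra! h
    have h5 := A.stays _ h h3
    have h6 := h1 (A.right + 1) (by omega) (by omega)
    have h7 := A.leaves
    omega

/-- Both ends of `A` lie in the factor. An arch that crosses `A` has an end between them, hence both
its ends lie in the factor: a loop factor is a union of components. -/
theorem Arch.left_mem_of_adj {p v q : List Step} (hv : IsQuarterPlaneLoop v)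
    {A B : Arch (p ++ (v ++ q))} (h : (archGraph (p ++ (v ++ q))).Adj A B)
    (hA : p.length ≤ A.left ∧ A.left < p.length + v.length) :
    p.length ≤ B.left ∧ B.left < p.length + v.length := by
  have hA' := (A.left_mem_iff_right_mem hv).1 hA
  rcases Arch.adj_iff.1 h with h | h
  · omega
  · exact (B.left_mem_iff_right_mem hv).2 (by omega)

/-- A factor inside which all endpoints of arches are matched is a loop. -/
theorem isQuarterPlaneLoop_of_matched {w p v q : List Step} (hw : IsQuarterPlaneLoop w)
    (e : w = p ++ (v ++ q))
    (h : ∀ A : Arch w, (p.length ≤ A.left ∧ A.left < p.length + v.length) ↔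
      (p.length ≤ A.right ∧ A.right < p.length + v.length)) : IsQuarterPlaneLoop v := by
  classical
  rw [isQuarterPlaneLoop_factor_iff (p := p) (q := q), ← e]
  intro c
  set i := p.length with hi
  set j := p.length + v.length with hj
  have hp : stackHeight c p = stackHeight c (w.take i) := by rw [e]; simp [hi]
  rw [hp]
  have hlow : ∀ m, i ≤ m → m ≤ j → stackHeight c (w.take i) ≤ stackHeight c (w.take m) := by
    by_contra! hex
    -- The first descent below the initial height is an output, whose arch opens inside the factor
    -- at a time when the height is just as low: a contradiction with the choice of the first such
    -- time.
    obtain ⟨h1, h2, h3⟩ := Nat.find_spec hex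
    have hmin := fun m (hm : m < Nat.find hex) => Nat.find_min hex hm
    set m := Nat.find hex
    obtain ⟨r, hr⟩ : ∃ r, m = r + 1 := by
      refine ⟨m - 1, ?_⟩
      rcases h1.lt_or_eq with h1 | h1
      · omega
      · rw [← h1] at h3; omega
    rw [hr] at h1 h2 h3 hmin
    have hir : i ≤ r := by
      by_contra! h4
      have : i = r + 1 := by omega
      rw [← this] at h3; omega
    have h4 : stackHeight c (w.take i) ≤ stackHeight c (w.take r) := by
      by_contra! h4
      exact hmin r (by omega) ⟨hir, by omega, h4⟩
    obtain ⟨h5, h6⟩ := getElem?_eq_outputLetter (h3.trans_le h4)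
    obtain ⟨A, rfl, rfl⟩ := exists_arch_of_output hw h5
    have h7 := (h A).2 ⟨hir, h2⟩
    have h8 := A.leaves
    exact hmin A.left (by have := A.lt; omega) ⟨h7.1, h7.2.le, by omega⟩
  refine ⟨hlow, le_antisymm ?_ (hlow j (by omega) le_rfl)⟩
  by_contra! hlt
  -- If the factor ended too high, the last time in it with height at most the initial one would be
  -- followed by an input; its arch closes inside the factor and restores that height at a later
  -- time.
  set P : ℕ → Prop := fun l => stackHeight c (w.take l) ≤ stackHeight c (w.take i) with hP
  have hij : i ≤ j := by omega
  have hi0 : P i := le_refl _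
  have hPl : P (Nat.findGreatest P j) := Nat.findGreatest_spec hij hi0
  have hlj : Nat.findGreatest P j ≤ j := Nat.findGreatest_le j
  have hil : i ≤ Nat.findGreatest P j := Nat.le_findGreatest hij hi0
  have hmax : ∀ m, Nat.findGreatest P j < m → m ≤ j → ¬ P m :=
    fun m h2 h3 => Nat.findGreatest_is_greatest h2 h3
  set l := Nat.findGreatest P j
  have hlt' : l < j := by
    rcases hlj.lt_or_eq with h1 | h1
    · exact h1
    · rw [h1] at hPl; simp only [hP] at hPl; omega
  have h2 := hmax (l + 1) (by omega) hlt'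
  simp only [hP, not_le] at h2 hPl
  obtain ⟨h3, h4⟩ := getElem?_eq_inputLetter (hPl.trans_lt h2)
  obtain ⟨A, hA, rfl⟩ := exists_arch_of_input hw h3
  have h5 := (h A).1 ⟨by omega, by omega⟩
  have h6 := A.leaves
  have h7 := A.lt
  refine hmax (A.right + 1) (by omega) (by omega) ?_
  simp only [hP]
  rw [h6, hA]; exact hPl

/-! ### Components and factors -/

section Component

variable {w : List Step}

/-- An arch `B` outside a component crosses none of its arches, so a path of crossings cannot enter
the region under `B`: an arch not under `B` cannot cross one under `B` without crossing `B` itself.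
-/
theorem not_inside_of_reachable {A D B : Arch w} (hD : (archGraph w).Reachable A D)
    (hB : ¬ (archGraph w).Reachable A B) (hA : ¬ (B.left < A.left ∧ A.right < B.right)) :
    ¬ (B.left < D.left ∧ D.right < B.right) := by
  obtain ⟨p⟩ := hD
  have aux : ∀ {D D'}, (archGraph w).Reachable A D → (archGraph w).Adj D D' →
      ¬ (B.left < D.left ∧ D.right < B.right) → ¬ (B.left < D'.left ∧ D'.right < B.right) := by
    intro D D' h1 h2 h3 h4
    have hB1 : ¬ (archGraph w).Adj D B := fun h => hB (h1.trans h.reachable)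
    have hne1 : D.left ≠ B.left := fun h => hB (Arch.eq_of_left h ▸ h1)
    have hne2 : D.right ≠ B.right := fun h => hB (Arch.eq_of_right h ▸ h1)
    rw [Arch.adj_iff] at h2 hB1
    have := D.lt
    have := B.lt
    have := D.left_ne_right B
    have := B.left_ne_right D
    omega
  induction p using SimpleGraph.Walk.concatRec with
  | Hnil => exact hA
  | Hconcat p hadj ih => exact aux ⟨p⟩ hadj (ih hB hA aux)

/-- An arch outside the connected component of the first arch lies in a factor that is a loop and
does not contain the first letter. -/
theorem exists_factor_of_not_reachable (hw : IsQuarterPlaneLoop w) {A₀ A : Arch w}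
    (h0 : A₀.left = 0) (hA : ¬ (archGraph w).Reachable A₀ A) :
    ∃ a g b, w = a ++ (g ++ b) ∧ a ≠ [] ∧ IsQuarterPlaneLoop g ∧ a.length ≤ A.left ∧
      A.left < a.length + g.length := by
  classical
  set P : ℕ → Prop := fun m =>
    ∃ D : Arch w, (archGraph w).Reachable A₀ D ∧ (m = D.left ∨ m = D.right) with hP
  -- The span of an arch outside the component contains no endpoint of the component: one endpoint
  -- alone would give a crossing, and no arch of the component lies under `B` because `A₀` starts at
  -- time 0.
  have hmid : ∀ B : Arch w, ¬ (archGraph w).Reachable A₀ B → ∀ m, B.left ≤ m → m ≤ B.right →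
      ¬ P m := by
    rintro B hB m h1 h2 ⟨D, hD, hm⟩
    have hadj : ¬ (archGraph w).Adj D B := fun h => hB (hD.trans h.reachable)
    have hne1 : D.left ≠ B.left := fun h => hB (Arch.eq_of_left h ▸ hD)
    have hne2 : D.right ≠ B.right := fun h => hB (Arch.eq_of_right h ▸ hD)
    have hin := not_inside_of_reachable hD hB (by omega)
    rw [Arch.adj_iff] at hadj
    have := D.lt
    have := B.lt
    have := D.left_ne_right B
    have := B.left_ne_right D
    omega
  have hP0 : P 0 := ⟨A₀, SimpleGraph.Reachable.refl _, .inl h0.symm⟩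
  have hPA : ¬ P A.left := hmid A hA _ le_rfl A.lt.le
  have hPlen : ¬ P w.length := by
    rintro ⟨D, _, h | h⟩
    · have := D.left_lt_length; omega
    · have := D.right_lt_length; omega
  -- The factor is the maximal gap around `A` between two consecutive endpoints `k < j` of the
  -- component, with `j` the end of the word if no endpoint follows.
  have hk1 : P (Nat.findGreatest P A.left) := Nat.findGreatest_spec (Nat.zero_le _) hP0
  have hk2 : Nat.findGreatest P A.left ≤ A.left := Nat.findGreatest_le _
  have hk3 : ∀ m, Nat.findGreatest P A.left < m → m ≤ A.left → ¬ P m :=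
    fun m h2 h3 => Nat.findGreatest_is_greatest h2 h3
  generalize Nat.findGreatest P A.left = k at hk1 hk2 hk3
  have hex : ∃ j, A.left ≤ j ∧ (P j ∨ j = w.length) := ⟨w.length, A.left_lt_length.le, .inr rfl⟩
  obtain ⟨hj1, hj2⟩ := Nat.find_spec hex
  have hj3 : ∀ m, A.left ≤ m → m < Nat.find hex → ¬ P m := fun m h1 h2 h3 =>
    Nat.find_min hex h2 ⟨h1, .inl h3⟩
  have hj4 : Nat.find hex ≤ w.length := Nat.find_min' hex ⟨A.left_lt_length.le, .inr rfl⟩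
  generalize Nat.find hex = j at hj1 hj2 hj3 hj4
  have hkA : k < A.left := by
    rcases hk2.lt_or_eq with h | h
    · exact h
    · rw [h] at hk1; exact absurd hk1 hPA
  have hAj : A.left < j := by
    rcases hj1.lt_or_eq with h | h
    · exact h
    · have := A.left_lt_length
      rw [← h] at hj2
      rcases hj2 with h | h
      · exact absurd h hPA
      · omega
  have hfree : ∀ m, k < m → m < j → ¬ P m := fun m h1 h2 => by
    rcases le_total m A.left with h | h
    · exact hk3 m h1 h
    · exact hj3 m h h2
  have hl1 : (w.take (k + 1)).length = k + 1 := by rw [List.length_take]; omega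
  have hl2 : ((w.drop (k + 1)).take (j - (k + 1))).length = j - (k + 1) := by
    rw [List.length_take, List.length_drop]; omega
  have e : w = w.take (k + 1) ++ ((w.drop (k + 1)).take (j - (k + 1)) ++
      (w.drop (k + 1)).drop (j - (k + 1))) := by
    rw [List.take_append_drop, List.take_append_drop]
  -- An arch with an end in the gap is outside the component. If its other end were outside the gap,
  -- its span would contain `k` or `j`, against `hmid`, or it would run past the end of the word.
  refine ⟨_, _, _, e, fun h => ?_, isQuarterPlaneLoop_of_matched hw e fun B => ?_, ?_, ?_⟩
  · rw [h] at hl1; simp at hl1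
  · rw [hl1, hl2]
    have hlt := B.lt
    constructor
    · rintro ⟨h1, h2⟩
      refine ⟨by omega, ?_⟩
      by_contra! h
      have hB : ¬ (archGraph w).Reachable A₀ B := fun hB =>
        hfree B.left (by omega) (by omega) ⟨B, hB, .inl rfl⟩
      rcases hj2 with h3 | h3
      · exact hmid B hB j (by omega) (by omega) h3
      · have := B.right_lt_length; omega
    · rintro ⟨h1, h2⟩
      refine ⟨?_, by omega⟩
      by_contra! h
      have hB : ¬ (archGraph w).Reachable A₀ B := fun hB =>
        hfree B.right (by omega) (by omega) ⟨B, hB, .inr rfl⟩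
      exact hmid B hB k (by omega) (by omega) hk1
  · omega
  · omega

theorem exists_first_arch (hw : IsQuarterPlaneLoop w) (hne : w ≠ []) :
    ∃ A : Arch w, A.left = 0 := by
  obtain ⟨A, h | h⟩ := exists_arch_at hw (List.length_pos_iff.2 hne)
  · exact ⟨A, h⟩
  · have := A.lt; omega

/-- A non-empty loop factor of the tail is closed under crossings, so its arches are not connected
to the first arch. Conversely, an arch that is not connected to the first one lies in such a factor,
by `exists_factor_of_not_reachable`. -/
theorem connected_iff_isSimple (hw : IsQuarterPlaneLoop w) :
    (archGraph w).Connected ↔ IsSimple w := by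
  constructor
  · intro h
    obtain ⟨A⟩ := h.nonempty
    have hne : w ≠ [] := by
      rintro rfl
      simpa using A.left_lt_length
    refine ⟨hne, hw, ?_⟩
    rintro v ⟨a, b, hab⟩ hv
    by_contra hv0
    obtain ⟨A₀, h0⟩ := exists_first_arch hw hne
    obtain ⟨s, t, rfl⟩ := List.exists_cons_of_ne_nil hne
    rw [List.tail_cons] at hab
    obtain ⟨p, hp, e⟩ : ∃ p, p ≠ [] ∧ s :: t = p ++ (v ++ b) := ⟨s :: a, by simp, by simp [← hab]⟩
    clear hab hne
    generalize s :: t = w at *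
    subst e
    have hp' := List.length_pos_iff.2 hp
    have hv' := List.length_pos_iff.2 hv0
    obtain ⟨A, hA⟩ := exists_arch_at hw (m := p.length) (by simp; omega)
    have hA' : p.length ≤ A.left ∧ A.left < p.length + v.length := by
      rcases hA with hA | hA
      · omega
      · exact (A.left_mem_iff_right_mem hv).2 (by omega)
    obtain ⟨q⟩ := h.preconnected A A₀
    have : p.length ≤ A₀.left := by
      clear hA h0
      induction q with
      | nil => exact hA'.1
      | cons hadj q ih => exact ih (Arch.left_mem_of_adj hv hadj hA')
    omega
  · rintro ⟨hne, -, hf⟩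
    obtain ⟨A₀, h0⟩ := exists_first_arch hw hne
    have key : ∀ A, (archGraph w).Reachable A₀ A := by
      intro A
      by_contra hA
      obtain ⟨a, g, b, e, ha, hg, h1, h2⟩ := exists_factor_of_not_reachable hw h0 hA
      obtain ⟨s, a, rfl⟩ := List.exists_cons_of_ne_nil ha
      have := hf g ⟨a, b, by simp [e]⟩ hg
      rw [this] at h2
      simp at h1 h2
      omega
    have : Nonempty (Arch w) := ⟨A₀⟩
    exact ⟨fun A B => (key A).symm.trans (key B)⟩

end Component

/-! ### Arches of a factor -/

section Shift

variable {p v q : List Step}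

theorem stackHeight_take_shift (c : Colour) {n : ℕ} (hn : n ≤ v.length) :
    stackHeight c ((p ++ (v ++ q)).take (p.length + n)) =
      stackHeight c p + stackHeight c (v.take n) := by
  rw [List.take_length_add_append, stackHeight_append, List.take_append_of_le_length hn]

theorem getElem?_shift {n : ℕ} (hn : n < v.length) :
    (p ++ (v ++ q))[p.length + n]? = v[n]? := by
  rw [List.getElem?_append_right (by omega), Nat.add_sub_cancel_left,
    List.getElem?_append_left hn]

/-- The arch of a word given by an arch of a factor. -/
def Arch.shift (p q : List Step) (A : Arch v) : Arch (p ++ (v ++ q)) where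
  left := p.length + A.left
  right := p.length + A.right
  colour := A.colour
  lt := by have := A.lt; omega
  getElem_left := by rw [getElem?_shift A.left_lt_length, A.getElem_left]
  getElem_right := by rw [getElem?_shift A.right_lt_length, A.getElem_right]
  stays m h1 h2 := by
    obtain ⟨n, rfl⟩ := Nat.exists_eq_add_of_le ((Nat.le_add_right _ _).trans h1.le)
    have hr := A.right_lt_length
    have hl := A.left_lt_length
    rw [stackHeight_take_shift _ hl.le, stackHeight_take_shift _ (by omega)]
    have := A.stays n (by omega) (by omega)
    omega
  leaves := by
    have hr := A.right_lt_length
    have hl := A.left_lt_length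
    rw [add_assoc, stackHeight_take_shift _ hr, stackHeight_take_shift _ hl.le, A.leaves]

theorem Arch.exists_shift_eq (A : Arch (p ++ (v ++ q))) (h1 : p.length ≤ A.left)
    (h2 : A.right < p.length + v.length) : ∃ B : Arch v, B.shift p q = A := by
  have hlt := A.lt
  obtain ⟨l, hl⟩ := Nat.exists_eq_add_of_le h1
  obtain ⟨r, hr⟩ := Nat.exists_eq_add_of_le (h1.trans hlt.le)
  refine ⟨⟨l, r, A.colour, by omega, ?_, ?_, fun m h3 h4 => ?_, ?_⟩,
    Arch.eq_of_left hl.symm⟩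
  · rw [← getElem?_shift (p := p) (q := q) (by omega), ← hl, A.getElem_left]
  · rw [← getElem?_shift (p := p) (q := q) (by omega), ← hr, A.getElem_right]
  · have := A.stays (p.length + m) (by omega) (by omega)
    rw [hl, stackHeight_take_shift _ (by omega), stackHeight_take_shift _ (by omega)] at this
    omega
  · have := A.leaves
    rw [hl, hr, add_assoc, stackHeight_take_shift _ (by omega),
      stackHeight_take_shift _ (by omega)] at this
    omega

theorem Arch.shift_adj {A B : Arch v} :
    (archGraph (p ++ (v ++ q))).Adj (A.shift p q) (B.shift p q) ↔ (archGraph v).Adj A B := by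
  rw [Arch.adj_iff, Arch.adj_iff]
  simp only [Arch.shift]
  omega

theorem Arch.shift_reachable {A B : Arch v} (h : (archGraph v).Reachable A B) :
    (archGraph (p ++ (v ++ q))).Reachable (A.shift p q) (B.shift p q) :=
  h.map ⟨Arch.shift p q, Arch.shift_adj.2⟩

/-- A path of crossings that starts in a loop factor never leaves it, so components of the factor
are components of the whole word. -/
theorem Arch.exists_of_shift_reachable (hv : IsQuarterPlaneLoop v) {A : Arch v}
    {B : Arch (p ++ (v ++ q))} (h : (archGraph (p ++ (v ++ q))).Reachable (A.shift p q) B) :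
    ∃ C : Arch v, C.shift p q = B ∧ (archGraph v).Reachable A C := by
  obtain ⟨W⟩ := h
  generalize hA' : A.shift p q = A' at W
  induction W generalizing A with
  | nil => exact ⟨A, hA', SimpleGraph.Reachable.refl _⟩
  | @cons A' B' C' hadj W ih =>
    subst hA'
    have h1 := Arch.left_mem_of_adj hv hadj
      ⟨Nat.le_add_right _ _, Nat.add_lt_add_left A.left_lt_length _⟩
    obtain ⟨B, rfl⟩ := B'.exists_shift_eq h1.1 ((B'.left_mem_iff_right_mem hv).1 h1).2
    obtain ⟨C, rfl, hC⟩ := ih rfl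
    exact ⟨C, rfl, (Arch.shift_adj.1 hadj).reachable.trans hC⟩

end Shift

/-! ### Standard arch systems -/

theorem isStandard_nil : IsStandard [] := fun A _ => by
  have := A.left_lt_length; simp at this

theorem colour_of_left_eq_zero {w : List Step} {A : Arch w} (h : A.left = 0) :
    w.head? = some E ↔ A.colour = Colour.red := by
  have h1 := A.getElem_left
  rw [h, ← List.head?_eq_getElem?] at h1
  rw [h1]
  cases A.colour <;> simp [inputLetter]

theorem isStandard_iff_of_isSimple {w : List Step} (hw : IsSimple w) :
    IsStandard w ↔ w.head? = some E := by
  obtain ⟨A₀, h0⟩ := exists_first_arch hw.2.1 hw.1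
  rw [colour_of_left_eq_zero h0]
  constructor
  · exact fun h => h A₀ fun B _ => by omega
  · intro h A hA
    have := hA A₀ (((connected_iff_isSimple hw.2.1).2 hw).preconnected _ _)
    rwa [Arch.eq_of_left (show A.left = A₀.left by omega)]

theorem colour_eq_red_of_factor {w p v q : List Step} (e : w = p ++ (v ++ q))
    (hv : IsQuarterPlaneLoop v) (hs : IsStandard v) {A : Arch w}
    (hA : ∀ B : Arch w, (archGraph w).Reachable A B → A.left ≤ B.left) (h1 : p.length ≤ A.left)
    (h2 : A.left < p.length + v.length) : A.colour = Colour.red := by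
  subst e
  obtain ⟨B, rfl⟩ := A.exists_shift_eq h1 ((A.left_mem_iff_right_mem hv).1 ⟨h1, h2⟩).2
  refine hs B fun C hC => ?_
  exact Nat.add_le_add_iff_left.1 (hA _ (Arch.shift_reachable hC))

/-- An arch is either in the component of the first arch, whose colour is given by the first letter,
or inside an inserted word by `exists_factor_of_not_reachable` and `interleave_factor_mem`. The
components of the inserted words are components of the whole. -/
theorem isStandard_interleave {l : List (Step × List Step)} (hs : IsSimple (l.map Prod.fst))
    (hl : LoopsInserted l) : IsStandard (interleave l) ↔
      (l.map Prod.fst).head? = some E ∧ ∀ p ∈ l, IsStandard p.2 := by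
  have hw := (isQuarterPlaneLoop_interleave hl).2 hs.2.1
  have hne : interleave l ≠ [] := by
    have h1 : l ≠ [] := by
      rintro rfl
      exact hs.1 rfl
    obtain ⟨⟨s, L⟩, l, rfl⟩ := List.exists_cons_of_ne_nil h1
    simp
  have hhead : (interleave l).head? = (l.map Prod.fst).head? := by
    cases l with
    | nil => rfl
    | cons p l => obtain ⟨s, L⟩ := p; simp
  obtain ⟨A₀, h0⟩ := exists_first_arch hw hne
  rw [← hhead, colour_of_left_eq_zero h0]
  constructor
  · intro h
    refine ⟨h A₀ fun B _ => by omega, ?_⟩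
    rintro ⟨s, L⟩ hp
    obtain ⟨l₁, l₂, rfl⟩ := List.append_of_mem hp
    have hL : IsQuarterPlaneLoop L := hl _ hp
    have e : interleave (l₁ ++ (s, L) :: l₂) = (interleave l₁ ++ [s]) ++ (L ++ interleave l₂) := by
      simp
    rw [e] at h
    intro A hA
    refine h (A.shift _ _) fun B hB => ?_
    obtain ⟨C, rfl, hC⟩ := Arch.exists_of_shift_reachable hL hB
    exact Nat.add_le_add_left (hA C hC) _
  · rintro ⟨h1, h2⟩ A hA
    by_cases hr : (archGraph (interleave l)).Reachable A₀ A
    · have := hA A₀ hr.symm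
      rwa [Arch.eq_of_left (show A.left = A₀.left by omega)]
    · obtain ⟨a, g, b, e, ha, hg, h3, h4⟩ := exists_factor_of_not_reachable hw h0 hr
      obtain ⟨l₁, s, L₁, L₂, l₂, rfl, rfl, rfl⟩ := interleave_factor_mem hl hs.2.2 ha hg e
      have hp : (s, L₁ ++ (g ++ L₂)) ∈ l₁ ++ (s, L₁ ++ (g ++ L₂)) :: l₂ := by simp
      have e : interleave (l₁ ++ (s, L₁ ++ (g ++ L₂)) :: l₂) =
        (interleave l₁ ++ [s]) ++ ((L₁ ++ (g ++ L₂)) ++ interleave l₂) := by simp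
      refine colour_eq_red_of_factor e (hl _ hp) (h2 _ hp) hA ?_ ?_ <;>
      simp only [List.length_append, List.length_cons, List.length_nil] at h3 h4 ⊢ <;> omega

/-! ### Generating functions of weighted types -/

section Weight

variable (K : Type*) [Field K] {α β : Type*}

/-- The generating function of a type whose elements are weighted by monomials. -/
noncomputable def weightSeries (wt : α → Fin 2 →₀ ℕ) : MvPowerSeries (Fin 2) K :=
  fun e => (Nat.card {a // wt a = e} : K)

/-- There are finitely many elements of each weight. -/
def FiniteFibers (wt : α → Fin 2 →₀ ℕ) : Prop := ∀ e, Finite {a // wt a = e}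

variable {K}

theorem coeff_weightSeries (wt : α → Fin 2 →₀ ℕ) (e : Fin 2 →₀ ℕ) :
    MvPowerSeries.coeff e (weightSeries K wt) = (Nat.card {a // wt a = e} : K) := rfl

theorem weightSeries_congr {wt : α → Fin 2 →₀ ℕ} {wt' : β → Fin 2 →₀ ℕ} (f : α ≃ β)
    (h : ∀ a, wt' (f a) = wt a) : weightSeries K wt = weightSeries K wt' := by
  ext e
  rw [coeff_weightSeries, coeff_weightSeries]
  exact congrArg _ (Nat.card_congr (f.subtypeEquiv fun a => by rw [h]))

theorem FiniteFibers.congr {wt : α → Fin 2 →₀ ℕ} {wt' : β → Fin 2 →₀ ℕ} (f : α ≃ β)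
    (h : ∀ a, wt' (f a) = wt a) (hf : FiniteFibers wt') : FiniteFibers wt := fun e =>
  have := hf e
  Finite.of_equiv _ (f.subtypeEquiv (p := fun a => wt a = e) (q := fun b => wt' b = e)
    fun a => by rw [h]).symm

theorem FiniteFibers.comp_injective {wt : α → Fin 2 →₀ ℕ} {f : β → α}
    (h : FiniteFibers wt) (hf : Function.Injective f) : FiniteFibers fun b => wt (f b) := fun e =>
  have := h e
  Finite.of_injective (fun b : {b // wt (f b) = e} => (⟨f b.1, b.2⟩ : {a // wt a = e}))
    fun _ _ hbc => Subtype.ext (hf (Subtype.ext_iff.1 hbc))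

theorem weightSeries_unique [Unique α] (wt : α → Fin 2 →₀ ℕ) :
    weightSeries K wt = MvPowerSeries.monomial (wt default) 1 := by
  classical
  ext e
  rw [coeff_weightSeries, MvPowerSeries.coeff_monomial]
  split_ifs with h
  · have : Unique {a // wt a = e} := ⟨⟨⟨default, h.symm⟩⟩, fun a => Subtype.ext (Unique.eq_default _)⟩
    simp
  · have : IsEmpty {a // wt a = e} := ⟨fun a => h (by rw [← a.2, Unique.eq_default a.1])⟩
    simp

theorem weightSeries_sum {wt : α ⊕ β → Fin 2 →₀ ℕ} (ha : FiniteFibers (wt ∘ Sum.inl))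
    (hb : FiniteFibers (wt ∘ Sum.inr)) :
    weightSeries K wt = weightSeries K (wt ∘ Sum.inl) + weightSeries K (wt ∘ Sum.inr) := by
  ext e
  have : Finite {a // wt (Sum.inl a) = e} := ha e
  have : Finite {b // wt (Sum.inr b) = e} := hb e
  rw [map_add, coeff_weightSeries, coeff_weightSeries, coeff_weightSeries,
    Nat.card_congr Equiv.subtypeSum, Nat.card_sum, Nat.cast_add]
  rfl

theorem weightSeries_ne {wt : α → Fin 2 →₀ ℕ} (h : FiniteFibers wt) (a₀ : α) :
    weightSeries K wt = MvPowerSeries.monomial (wt a₀) 1 +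
      weightSeries K fun a : {a // a ≠ a₀} => wt a := by
  classical
  have h1 := weightSeries_congr (K := K) (Equiv.sumCompl fun a => a = a₀)
    (wt := wt ∘ Equiv.sumCompl fun a => a = a₀) (wt' := wt) fun a => rfl
  rw [← h1, weightSeries_sum, weightSeries_unique]
  · rfl
  · exact h.comp_injective Subtype.val_injective
  · exact h.comp_injective Subtype.val_injective

/-- Pairs of elements whose weights sum up to `e`. -/
def pairFiberEquiv (wa : α → Fin 2 →₀ ℕ) (wb : β → Fin 2 →₀ ℕ) (e : Fin 2 →₀ ℕ) :
    {p : α × β // wa p.1 + wb p.2 = e} ≃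
      Σ x : Finset.HasAntidiagonal.antidiagonal e, {a // wa a = x.1.1} × {b // wb b = x.1.2} where
  toFun p := ⟨⟨(wa p.1.1, wb p.1.2), Finset.HasAntidiagonal.mem_antidiagonal.2 p.2⟩, ⟨p.1.1, rfl⟩, ⟨p.1.2, rfl⟩⟩
  invFun x := ⟨(x.2.1.1, x.2.2.1), by
    rw [x.2.1.2, x.2.2.2]; exact Finset.HasAntidiagonal.mem_antidiagonal.1 x.1.2⟩
  left_inv p := rfl
  right_inv x := by
    obtain ⟨⟨⟨d, d'⟩, hx⟩, ⟨a, ha⟩, ⟨b, hb⟩⟩ := x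
    dsimp only at ha hb
    subst ha hb
    rfl

theorem FiniteFibers.prod {wa : α → Fin 2 →₀ ℕ} {wb : β → Fin 2 →₀ ℕ} (ha : FiniteFibers wa)
    (hb : FiniteFibers wb) : FiniteFibers fun p : α × β => wa p.1 + wb p.2 := fun e =>
  have := fun e => ha e
  have := fun e => hb e
  Finite.of_equiv _ (pairFiberEquiv wa wb e).symm

theorem weightSeries_prod {wa : α → Fin 2 →₀ ℕ} {wb : β → Fin 2 →₀ ℕ} (ha : FiniteFibers wa)
    (hb : FiniteFibers wb) : weightSeries K (fun p : α × β => wa p.1 + wb p.2) =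
      weightSeries K wa * weightSeries K wb := by
  classical
  ext e
  have := fun e => ha e
  have := fun e => hb e
  rw [MvPowerSeries.coeff_mul, coeff_weightSeries, Nat.card_congr (pairFiberEquiv wa wb e),
    Nat.card_sigma, Nat.cast_sum]
  simp only [Nat.card_prod, Nat.cast_mul]
  exact Finset.sum_coe_sort (Finset.HasAntidiagonal.antidiagonal e) fun x =>
    (Nat.card {a // wa a = x.1} : K) * (Nat.card {b // wb b = x.2} : K)

theorem weightSeries_shift {wt : α → Fin 2 →₀ ℕ} (h : FiniteFibers wt) (n : ℕ) :
    weightSeries K (fun a => Finsupp.single 1 n + wt a) =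
      MvPowerSeries.X 1 ^ n * weightSeries K wt := by
  have hu : FiniteFibers fun _ : Unit => (Finsupp.single 1 n : Fin 2 →₀ ℕ) := fun e => inferInstance
  have h1 := weightSeries_prod (K := K) hu h
  rw [weightSeries_unique (α := Unit), ← MvPowerSeries.X_pow_eq] at h1
  rw [← h1]
  exact weightSeries_congr (Equiv.punitProd α).symm fun a => rfl

/-- The substitution into the generating function of a weighted type is a sum over the type. -/
theorem finsum_card_mul (wt : α → Fin 2 →₀ ℕ) (N : ℕ) [Fintype {a // wt a 1 ≤ N}]
    (f : (Fin 2 →₀ ℕ) → K) (hf : ∀ d, N < d 1 → f d = 0) :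
    ∑ᶠ d, (Nat.card {a // wt a = d} : K) * f d = ∑ a : {a // wt a 1 ≤ N}, f (wt a) := by
  classical
  rw [finsum_eq_sum_of_support_subset (s := Finset.univ.image
    fun a : {a // wt a 1 ≤ N} => wt a), Finset.sum_comp f fun a : {a // wt a 1 ≤ N} => wt a]
  · refine Finset.sum_congr rfl fun d hd => ?_
    obtain ⟨⟨a, ha⟩, -, rfl⟩ := Finset.mem_image.1 hd
    rw [nsmul_eq_mul, ← Fintype.card_subtype, ← Nat.card_eq_fintype_card]
    congr 2
    exact Nat.card_congr ⟨fun b => ⟨⟨b.1, by rw [b.2]; exact ha⟩, b.2⟩, fun b => ⟨b.1.1, b.2⟩,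
      fun b => rfl, fun b => rfl⟩
  · intro d hd
    rw [Function.mem_support] at hd
    have h1 : d 1 ≤ N := by
      by_contra! h
      exact hd (by rw [hf d h, mul_zero])
    have h2 : Nat.card {a // wt a = d} ≠ 0 := by
      intro h
      exact hd (by rw [h, Nat.cast_zero, zero_mul])
    obtain ⟨⟨a, rfl⟩⟩ := (Nat.card_ne_zero.1 h2).1
    simpa using ⟨a, h1, rfl⟩

end Weight

/-! ### The decomposition of loops into simple loops -/

/-- The weight of a word: corners and half-length. -/
noncomputable def wordWeight (w : List Step) : Fin 2 →₀ ℕ :=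
  Finsupp.single 0 (corners w) + Finsupp.single 1 (w.length / 2)

theorem wordWeight_zero (w : List Step) : wordWeight w 0 = corners w := by simp [wordWeight]

theorem wordWeight_one (w : List Step) : wordWeight w 1 = w.length / 2 := by simp [wordWeight]

theorem finsupp_fin_two_ext {d e : Fin 2 →₀ ℕ} (h0 : d 0 = e 0) (h1 : d 1 = e 1) : d = e := by
  ext i; fin_cases i
  exacts [h0, h1]

theorem finite_half_length_le (s : Set (List Step)) (n : ℕ) :
    Finite {w : s // (w : List Step).length / 2 ≤ n} := by
  have h : Finite {w : List Step | w.length ≤ 2 * n + 1} :=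
    (List.finite_length_le Step (2 * n + 1)).to_subtype
  exact Finite.of_injective (fun w : {w : s // (w : List Step).length / 2 ≤ n} =>
    (⟨w.1.1, by have := w.2; simp only [Set.mem_ofPred_eq]; omega⟩ :
      {w : List Step | w.length ≤ 2 * n + 1})) fun v w hvw =>
    Subtype.ext (Subtype.ext (by simpa using hvw))

theorem finiteFibers_of_one_eq {s : Set (List Step)} {wt : s → Fin 2 →₀ ℕ}
    (h : ∀ w, wt w 1 = (w : List Step).length / 2) : FiniteFibers wt := fun e =>
  have := finite_half_length_le s (e 1)
  Finite.of_injective (fun w : {w : s // wt w = e} =>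
    (⟨w.1, by rw [← h, w.2]⟩ : {w : s // (w : List Step).length / 2 ≤ e 1})) fun v w hvw =>
    Subtype.ext (by simpa using hvw)

theorem length_eq_sum_count (w : List Step) :
    w.length = w.count E + w.count N + w.count W + w.count S := by
  induction w with
  | nil => rfl
  | cons s w ih => cases s <;> simp <;> omega

theorem IsQuarterPlaneLoop.length_eq {w : List Step} (h : IsQuarterPlaneLoop w) :
    w.length = 2 * (w.count E + w.count N) := by
  have h1 := h.2.1
  have h2 := h.2.2
  simp only [xCoord, yCoord] at h1 h2
  have := length_eq_sum_count w
  omega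

theorem IsQuarterPlaneLoop.two_mul_half {w : List Step} (h : IsQuarterPlaneLoop w) :
    2 * (w.length / 2) = w.length := by
  have := h.length_eq; omega

/-- The simple loops whose first letter belongs to `H`. -/
def simpleLoops (H : Set Step) : Set (List Step) := {c | IsSimple c ∧ ∃ s ∈ H, c.head? = some s}

/-- `T` is a class of loops that is determined by the decomposition of loops into simple ones. -/
structure Hereditary (T : Set (List Step)) (H : Set Step) : Prop where
  loop : ∀ {w}, w ∈ T → IsQuarterPlaneLoop w
  nil_mem : [] ∈ T
  interleave_mem : ∀ {l : List (Step × List Step)}, IsSimple (l.map Prod.fst) → LoopsInserted l →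
    (interleave l ∈ T ↔ (∃ s ∈ H, (l.map Prod.fst).head? = some s) ∧ ∀ p ∈ l, p.2 ∈ T)

/-- The ways to insert elements of `T` after the letters of `c`. -/
def Insertions (T : Set (List Step)) (c : List Step) : Type :=
  {l : List (Step × List Step) // l.map Prod.fst = c ∧ ∀ p ∈ l, p.2 ∈ T}

/-- Corners, and half-length of the inserted words. -/
noncomputable def insertionWeight (l : List (Step × List Step)) : Fin 2 →₀ ℕ :=
  Finsupp.single 0 (corners (interleave l)) +
    Finsupp.single 1 (l.map fun p => p.2.length / 2).sum

section Decomposition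

variable {K : Type*} [Field K] {T : Set (List Step)} {H : Set Step}

variable (K) in
/-- The generating function of a set of words, by corners and half-length. -/
noncomputable def wordSeries (T : Set (List Step)) : MvPowerSeries (Fin 2) K :=
  weightSeries K fun w : T => wordWeight w

/-- The series `1 - (1 - a) / Q`. -/
noncomputable def cornerSubst (Q : MvPowerSeries (Fin 2) K) : MvPowerSeries (Fin 2) K :=
  1 - (1 - MvPowerSeries.X 0) * Q⁻¹

theorem monomial_zero_one : MvPowerSeries.monomial (0 : Fin 2 →₀ ℕ) (1 : K) = 1 := rfl

theorem wordSeries_eq_one_add (h0 : [] ∈ T) : wordSeries K T =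
    1 + weightSeries K fun w : {w : T // w ≠ ⟨[], h0⟩} => wordWeight w := by
  rw [wordSeries, weightSeries_ne (finiteFibers_of_one_eq fun w => wordWeight_one _) ⟨[], h0⟩]
  simp [wordWeight, corners, monomial_zero_one]

theorem constantCoeff_wordSeries (hT : ∀ w ∈ T, IsQuarterPlaneLoop w) (h0 : [] ∈ T) :
    MvPowerSeries.constantCoeff (wordSeries K T) = 1 := by
  rw [wordSeries_eq_one_add h0, map_add, map_one, add_eq_left,
    ← MvPowerSeries.coeff_zero_eq_constantCoeff_apply, coeff_weightSeries]
  have : IsEmpty {w : {w : T // w ≠ ⟨[], h0⟩} // wordWeight w.1 = 0} := by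
    refine ⟨fun w => w.1.2 (Subtype.ext ?_)⟩
    have h1 := wordWeight_one w.1.1
    rw [w.2, Finsupp.zero_apply] at h1
    have h2 := (hT _ w.1.1.2).two_mul_half
    exact List.eq_nil_of_length_eq_zero (by omega)
  simp

theorem mul_cornerSubst {Q : MvPowerSeries (Fin 2) K} (h : MvPowerSeries.constantCoeff Q = 1) :
    Q * cornerSubst Q = Q - 1 + MvPowerSeries.X 0 := by
  have := MvPowerSeries.mul_inv_cancel Q (by rw [h]; exact one_ne_zero)
  rw [cornerSubst]
  linear_combination (-1 + MvPowerSeries.X 0) * this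

/-- At a corner (`δ = 1`) the empty word keeps the corner and has weight `a` instead of 1, which
gives `Q - 1 + a`. Writing this as `Q` times `cornerSubst Q` gives all gaps the common factor `Q`.
-/
theorem weightSeries_first_gap (h0 : [] ∈ T) (hQ : MvPowerSeries.constantCoeff (wordSeries K T) = 1)
    {δ : ℕ} (hδ : δ ≤ 1) :
    weightSeries K (fun L : T => (Finsupp.single 0 (corners L + if (L : List Step) = [] then δ else 0) +
      Finsupp.single 1 ((L : List Step).length / 2) : Fin 2 →₀ ℕ)) =
      wordSeries K T * cornerSubst (wordSeries K T) ^ δ := by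
  interval_cases δ
  · simp [wordSeries, wordWeight]
  · rw [pow_one, mul_cornerSubst hQ, wordSeries_eq_one_add h0,
      weightSeries_ne (finiteFibers_of_one_eq fun w => by simp) ⟨[], h0⟩, add_sub_cancel_left,
      add_comm]
    congr 1
    · congr 1
      funext w
      have : (w.1 : List Step) ≠ [] := fun h => w.2 (Subtype.ext h)
      simp [wordWeight, this]
    · simp [corners, MvPowerSeries.X]

/-- Separating the word inserted after the first letter. -/
def insertionsConsEquiv (T : Set (List Step)) (s : Step) (c : List Step) :
    T × Insertions T c ≃ Insertions T (s :: c) where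
  toFun x := ⟨(s, x.1.1) :: x.2.1, by simp [x.2.2.1], fun p hp => by
    rcases List.mem_cons.1 hp with rfl | hp
    exacts [x.1.2, x.2.2.2 p hp]⟩
  invFun
    | ⟨[], h⟩ => absurd h.1 (by simp)
    | ⟨p :: l, h⟩ => (⟨p.2, h.2 p List.mem_cons_self⟩, ⟨l, (List.cons.inj h.1).2, fun q hq =>
        h.2 q (List.mem_cons_of_mem _ hq)⟩)
  left_inv x := rfl
  right_inv
    | ⟨[], h⟩ => absurd h.1 (by simp)
    | ⟨(t, L) :: l, h⟩ => by
      obtain rfl : t = s := (List.cons.inj h.1).1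
      rfl

instance (T : Set (List Step)) : Unique (Insertions T []) where
  default := ⟨[], rfl, by simp⟩
  uniq l := Subtype.ext (List.map_eq_nil_iff.1 l.2.1)

/-- The gaps are filled independently, one after each letter, including the last letter, at which
there is no corner. Finiteness is carried through the induction because the product rule needs it.
-/
theorem finiteFibers_and_weightSeries_insertions (hT : ∀ w ∈ T, IsQuarterPlaneLoop w)
    (h0 : [] ∈ T) (hQ : MvPowerSeries.constantCoeff (wordSeries K T) = 1) (c : List Step) :
    (FiniteFibers fun l : Insertions T c => insertionWeight l.1) ∧
      weightSeries K (fun l : Insertions T c => insertionWeight l.1) =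
        wordSeries K T ^ c.length * cornerSubst (wordSeries K T) ^ corners c := by
  induction c with
  | nil =>
    refine ⟨fun e => inferInstance, ?_⟩
    rw [weightSeries_unique]
    simp [insertionWeight, corners, monomial_zero_one, default]
  | cons s c ih =>
    obtain ⟨ih1, ih2⟩ := ih
    have hw : ∀ x : T × Insertions T c, insertionWeight ((insertionsConsEquiv T s c) x).1 =
        (Finsupp.single 0 (corners x.1 + if (x.1 : List Step) = [] then cornerHead s c else 0) +
          Finsupp.single 1 ((x.1 : List Step).length / 2) : Fin 2 →₀ ℕ) +
          insertionWeight x.2.1 := by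
      intro x
      have h1 : corners (interleave ((s, x.1.1) :: x.2.1)) = _ :=
        corners_interleave_cons (hT _ x.1.2)
      rw [x.2.2.1] at h1
      change insertionWeight ((s, x.1.1) :: x.2.1) = _
      refine finsupp_fin_two_ext ?_ ?_
      · simpa [insertionWeight] using h1
      · simp [insertionWeight]
    have hf : FiniteFibers fun L : T => (Finsupp.single 0 (corners L +
        if (L : List Step) = [] then cornerHead s c else 0) +
          Finsupp.single 1 ((L : List Step).length / 2) : Fin 2 →₀ ℕ) :=
      finiteFibers_of_one_eq fun w => by simp
    refine ⟨FiniteFibers.congr (insertionsConsEquiv T s c).symm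
      (fun a => ?_) (hf.prod ih1), ?_⟩
    · rw [← hw, Equiv.apply_symm_apply]
    · rw [← weightSeries_congr (insertionsConsEquiv T s c) hw, weightSeries_prod hf ih1, ih2,
        weightSeries_first_gap h0 hQ (cornerHead_le_one s c), corners_cons, List.length_cons]
      ring

/-- The decomposition of non-empty loops into a simple loop and inserted loops. -/
noncomputable def simpleDecomposition (h : Hereditary T H) :
    (Σ c : simpleLoops H, Insertions T c) ≃ {w : T // w ≠ ⟨[], h.nil_mem⟩} :=
  Equiv.ofBijective (fun x => ⟨⟨interleave x.2.1,
      (h.interleave_mem (by rw [x.2.2.1]; exact x.1.2.1) fun p hp => h.loop (x.2.2.2 p hp)).2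
        ⟨by rw [x.2.2.1]; exact x.1.2.2, x.2.2.2⟩⟩, fun h0 => by
      have h1 : interleave x.2.1 = [] := Subtype.ext_iff.1 h0
      have h2 := length_interleave_le x.2.1
      rw [h1] at h2
      have h3 : x.2.1 = [] := List.eq_nil_of_length_eq_zero (Nat.le_zero.1 h2)
      have h4 := x.2.2.1
      rw [h3] at h4
      exact x.1.2.1.1 h4.symm⟩) <| by
    constructor
    · rintro ⟨⟨c, hc⟩, l, hlc, hl⟩ ⟨⟨d, hd⟩, m, hmd, hm⟩ he
      change l.map Prod.fst = c at hlc
      change m.map Prod.fst = d at hmd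
      subst hlc hmd
      obtain rfl : l = m := interleave_injective (fun p hp => h.loop (hl p hp))
        (fun p hp => h.loop (hm p hp)) hc.1.2.2 hd.1.2.2
        (Subtype.ext_iff.1 (Subtype.ext_iff.1 he))
      rfl
    · rintro ⟨⟨w, hw⟩, hne⟩
      obtain ⟨l, h1, h2, rfl⟩ := exists_interleave_simple (h.loop hw)
        fun h0 => hne (Subtype.ext h0)
      obtain ⟨h3, h4⟩ := (h.interleave_mem h1 h2).1 hw
      exact ⟨⟨⟨_, h1, h3⟩, l, rfl, h4⟩, rfl⟩

theorem wordWeight_interleave {l : List (Step × List Step)} (hl : LoopsInserted l)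
    (hs : IsQuarterPlaneLoop (l.map Prod.fst)) : wordWeight (interleave l) =
      Finsupp.single 1 ((l.map Prod.fst).length / 2) + insertionWeight l := by
  have key : ∀ l : List (Step × List Step), LoopsInserted l → (interleave l).length =
      l.length + 2 * (l.map fun p => p.2.length / 2).sum := by
    intro l hl
    induction l with
    | nil => rfl
    | cons p l ih =>
      obtain ⟨s, L⟩ := p
      have := hl.head.two_mul_half
      simp only [interleave_cons, List.length_cons, List.length_append, ih hl.tail, List.map_cons,
        List.sum_cons] at this ⊢
      omega
  have h1 := key l hl
  have h2 := hs.two_mul_half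
  rw [List.length_map] at h2 ⊢
  refine finsupp_fin_two_ext ?_ ?_
  · simp [wordWeight, insertionWeight]
  · simp [wordWeight, insertionWeight]
    omega

theorem constantCoeff_cornerSubst {Q : MvPowerSeries (Fin 2) K}
    (h : MvPowerSeries.constantCoeff Q = 1) :
    MvPowerSeries.constantCoeff (cornerSubst Q) = 0 := by
  simp [cornerSubst, MvPowerSeries.constantCoeff_inv, h]

theorem coeff_X_pow_mul_eq_zero {f : MvPowerSeries (Fin 2) K} {n : ℕ} {e : Fin 2 →₀ ℕ}
    (h : e 1 < n) : MvPowerSeries.coeff e (MvPowerSeries.X 1 ^ n * f) = 0 :=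
  MvPowerSeries.X_pow_dvd_iff.1 (Dvd.intro _ rfl) e h

/-- The generating function of a hereditary class in terms of the one of its simple loops. -/
theorem wordSeries_eq_one_add_comp (h : Hereditary T H) : wordSeries K T =
    1 + comp (wordSeries K (simpleLoops H)) (cornerSubst (wordSeries K T))
      (MvPowerSeries.X 1 * wordSeries K T ^ 2) := by
  classical
  have hT : ∀ w ∈ T, IsQuarterPlaneLoop w := fun w => h.loop
  have hQ := constantCoeff_wordSeries (K := K) hT h.nil_mem
  have hD := finiteFibers_and_weightSeries_insertions hT h.nil_mem hQ
  conv_lhs => rw [wordSeries_eq_one_add h.nil_mem]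
  congr 1
  set Q := wordSeries K T with hQdef
  set B := cornerSubst Q
  have hw : ∀ x : Σ c : simpleLoops H, Insertions T c, wordWeight (simpleDecomposition h x).1 =
      Finsupp.single 1 ((x.1 : List Step).length / 2) + insertionWeight x.2.1 := by
    intro x
    have := wordWeight_interleave (fun p hp => h.loop (x.2.2.2 p hp))
      (by rw [x.2.2.1]; exact x.1.2.1.2.1)
    rw [x.2.2.1] at this
    exact this
  rw [← weightSeries_congr (simpleDecomposition h) hw]
  ext e
  -- A simple loop of half-length `n` contributes a multiple of `u ^ n`, so only finitely many
  -- matter for the coefficient at `e`.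
  have hfin : Finite {c : simpleLoops H // wordWeight c 1 ≤ e 1} := by
    simp only [wordWeight_one]
    exact finite_half_length_le _ _
  have := Fintype.ofFinite {c : simpleLoops H // wordWeight c 1 ≤ e 1}
  have hcomp : MvPowerSeries.coeff e (comp (wordSeries K (simpleLoops H)) B
      (MvPowerSeries.X 1 * Q ^ 2)) = ∑ᶠ d, (Nat.card {c : simpleLoops H // wordWeight c = d} : K) *
        MvPowerSeries.coeff e (B ^ d 0 * (MvPowerSeries.X 1 * Q ^ 2) ^ d 1) := rfl
  have hrw : ∀ k n : ℕ, B ^ k * (MvPowerSeries.X 1 * Q ^ 2) ^ n =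
      MvPowerSeries.X 1 ^ n * (Q ^ (2 * n) * B ^ k) := fun k n => by
    rw [mul_pow, ← pow_mul]; ring
  rw [hcomp, finsum_card_mul (fun c : simpleLoops H => wordWeight c) (e 1)
    (fun d => MvPowerSeries.coeff e (B ^ d 0 * (MvPowerSeries.X 1 * Q ^ 2) ^ d 1)) fun d hd => by
      rw [hrw]; exact coeff_X_pow_mul_eq_zero hd]
  have hcard : ∀ c : simpleLoops H, (Nat.card {l : Insertions T c //
      Finsupp.single 1 ((c : List Step).length / 2) + insertionWeight l.1 = e} : K) =
        MvPowerSeries.coeff e (B ^ (wordWeight c) 0 *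
          (MvPowerSeries.X 1 * Q ^ 2) ^ (wordWeight c) 1) := by
    intro c
    rw [← coeff_weightSeries (K := K) (fun l : Insertions T c =>
      Finsupp.single 1 ((c : List Step).length / 2) + insertionWeight l.1),
      weightSeries_shift (hD c).1, (hD c).2, hrw, wordWeight_one, wordWeight_zero,
      c.2.1.2.1.two_mul_half]
  simp only [← hcard]
  rw [coeff_weightSeries, ← Nat.cast_sum]
  congr 1
  have hfin' : ∀ c : {c : simpleLoops H // wordWeight c 1 ≤ e 1}, Finite {l : Insertions T c.1 //
      Finsupp.single 1 ((c.1 : List Step).length / 2) + insertionWeight l.1 = e} := fun c => by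
    have hu : FiniteFibers fun _ : Unit =>
      (Finsupp.single 1 ((c.1 : List Step).length / 2) : Fin 2 →₀ ℕ) := fun e => inferInstance
    exact (hu.prod (hD c.1).1).congr (Equiv.punitProd _).symm (fun a => rfl) e
  rw [← Nat.card_sigma]
  refine Nat.card_congr ⟨fun x => ⟨⟨x.1.1, ?_⟩, ⟨x.1.2, x.2⟩⟩, fun x => ⟨⟨x.1.1, x.2.1⟩, x.2.2⟩,
    fun x => rfl, fun x => rfl⟩
  have := DFunLike.congr_fun x.2 1
  rw [Finsupp.add_apply, Finsupp.single_eq_same] at this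
  rw [wordWeight_one]
  omega

end Decomposition

/-! ### The classes of all loops and of standard loops -/

theorem hereditary_loops : Hereditary {w | IsQuarterPlaneLoop w} Set.univ where
  loop h := h
  nil_mem := isQuarterPlaneLoop_nil
  interleave_mem {l} hs hl := by
    refine ⟨fun _ => ⟨?_, hl⟩, fun _ => (isQuarterPlaneLoop_interleave hl).2 hs.2.1⟩
    obtain ⟨s, c, hc⟩ := List.exists_cons_of_ne_nil hs.1
    exact ⟨s, trivial, by rw [hc]; rfl⟩

theorem hereditary_standard : Hereditary {w | IsQuarterPlaneLoop w ∧ IsStandard w} {E} where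
  loop h := h.1
  nil_mem := ⟨isQuarterPlaneLoop_nil, isStandard_nil⟩
  interleave_mem {l} hs hl := by
    have h1 := (isQuarterPlaneLoop_interleave hl).2 hs.2.1
    simp only [Set.mem_ofPred_eq, h1, true_and, isStandard_interleave hs hl, Set.mem_singleton_iff,
      exists_eq_left]
    exact and_congr_right fun _ => ⟨fun h p hp => ⟨hl p hp, h p hp⟩, fun h p hp => (h p hp).2⟩

/-- Exchanging the two stacks. -/
def Step.swap : Step → Step
  | E => N
  | N => E
  | W => S
  | S => W

theorem Step.swap_swap (s : Step) : s.swap.swap = s := by cases s <;> rfl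

theorem map_swap_map_swap (w : List Step) : (w.map Step.swap).map Step.swap = w := by
  simp [Step.swap_swap, Function.comp_def]

/-- The other colour. -/
def Colour.other : Colour → Colour
  | .red => .blue
  | .blue => .red

theorem stackHeight_map_swap (c : Colour) (w : List Step) :
    stackHeight c (w.map Step.swap) = stackHeight c.other w := by
  induction w with
  | nil => simp
  | cons s w ih =>
    rw [List.map_cons, stackHeight_cons, ih, stackHeight_cons _ s, stackHeight_singleton,
      stackHeight_singleton]
    cases c <;> cases s <;> simp [inputLetter, outputLetter, Step.swap, Colour.other]

theorem IsQuarterPlaneLoop.map_swap {w : List Step} (h : IsQuarterPlaneLoop w) :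
    IsQuarterPlaneLoop (w.map Step.swap) := by
  rw [isQuarterPlaneLoop_iff]
  refine fun c => ⟨fun p hp => ?_, by rw [stackHeight_map_swap, h.height]⟩
  rw [List.prefix_iff_eq_take.1 hp, ← List.map_take, stackHeight_map_swap]
  exact h.height_take _ _

theorem LoopFree.map_swap {w : List Step} (h : LoopFree w) : LoopFree (w.map Step.swap) := by
  intro v hv hloop
  have h1 : v.map Step.swap <:+: w := by
    rw [← map_swap_map_swap w]
    exact hv.map _
  exact List.map_eq_nil_iff.1 (h _ h1 hloop.map_swap)

theorem IsSimple.map_swap {w : List Step} (h : IsSimple w) : IsSimple (w.map Step.swap) :=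
  ⟨by simpa using h.1, h.2.1.map_swap, by rw [← List.map_tail]; exact h.2.2.map_swap⟩

theorem corners_map_swap (w : List Step) : corners (w.map Step.swap) = corners w := by
  induction w with
  | nil => rfl
  | cons s w ih =>
    rw [List.map_cons, corners_cons, corners_cons, ih]
    cases w with
    | nil => rfl
    | cons t w => cases s <;> cases t <;> rfl

/-- Half of the simple loops begin with `E`. -/
def simpleLoopsEquiv : simpleLoops {E} ⊕ simpleLoops {E} ≃ simpleLoops Set.univ where
  toFun
    | .inl w => ⟨w, w.2.1, E, trivial, by obtain ⟨s, rfl, h⟩ := w.2.2; exact h⟩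
    | .inr w => ⟨w.1.map Step.swap, w.2.1.map_swap, N, trivial, by
        obtain ⟨s, rfl, h⟩ := w.2.2
        rw [List.head?_map, h]; rfl⟩
  invFun w := if h : w.1.head? = some E then .inl ⟨w, w.2.1, E, rfl, h⟩ else
    .inr ⟨w.1.map Step.swap, w.2.1.map_swap, E, rfl, by
      obtain ⟨_ | ⟨s, w⟩, h1, h2⟩ := w
      · exact absurd rfl h1.1
      · have := h1.2.1.head_isInput
        cases s <;> simp_all [IsInput, Step.swap]⟩
  left_inv
    | .inl ⟨w, hw⟩ => by
      have : w.head? = some E := by obtain ⟨s, rfl, h⟩ := hw.2; exact h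
      simp [this]
    | .inr ⟨w, hw⟩ => by
      have : w.head? = some E := by obtain ⟨s, rfl, h⟩ := hw.2; exact h
      simp only [List.head?_map, this, map_swap_map_swap]
      simp [Step.swap]
  right_inv w := by
    obtain ⟨w, hw⟩ := w
    by_cases h : w.head? = some E
    · simp [h]
    · simp only [h, map_swap_map_swap, dite_false]

/-! ### The counting series as series of word classes -/

section

variable (K : Type*) [Field K]

/-- Exchanging the stacks exchanges the corners `NW` and `ES` and the first letters `E` and `N`;
this is the factor 2 in the equation for `Q`. -/
theorem wordSeries_simpleLoops_univ :
    wordSeries K (simpleLoops Set.univ) = 2 * wordSeries K (simpleLoops {E}) := by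
  rw [wordSeries, ← weightSeries_congr simpleLoopsEquiv (wt := Sum.elim
    (fun w : simpleLoops {E} => wordWeight w) fun w : simpleLoops {E} => wordWeight w),
    weightSeries_sum, two_mul]
  · rfl
  · exact finiteFibers_of_one_eq fun w => wordWeight_one _
  · exact finiteFibers_of_one_eq fun w => wordWeight_one _
  · rintro (w | w)
    · rfl
    · simp [simpleLoopsEquiv, wordWeight, corners_map_swap]

theorem loopSeries_eq : loopSeries K = wordSeries K {w | IsQuarterPlaneLoop w} := by
  ext e
  rw [wordSeries, coeff_weightSeries]
  change ((Set.ncard _ : ℕ) : K) = _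
  congr 1
  refine Nat.card_congr ⟨fun w => ⟨⟨w.1, w.2.2.1⟩, ?_⟩, fun w => ⟨w.1.1, ?_, w.1.2, ?_⟩,
    fun w => rfl, fun w => rfl⟩
  · obtain ⟨w, h1, h2, h3⟩ := w
    exact finsupp_fin_two_ext (by rw [wordWeight_zero, h3]) (by rw [wordWeight_one, h1]; omega)
  · obtain ⟨⟨w, hw⟩, rfl⟩ := w
    rw [wordWeight_one, IsQuarterPlaneLoop.two_mul_half hw]
  · obtain ⟨⟨w, hw⟩, rfl⟩ := w
    rw [wordWeight_zero]

theorem connectedSeries_eq : connectedSeries K = wordSeries K (simpleLoops {E}) := by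
  ext e
  rw [wordSeries, coeff_weightSeries]
  change ((Set.ncard _ : ℕ) : K) = _
  congr 1
  refine Nat.card_congr ⟨fun w => ⟨⟨w.1, ?_, E, rfl, ?_⟩, ?_⟩, fun w => ⟨w.1.1, ?_, w.1.2.1.2.1, ?_,
    ?_, ?_⟩, fun w => rfl, fun w => rfl⟩
  · exact (connected_iff_isSimple w.2.2.1).1 w.2.2.2.2.1
  · exact (isStandard_iff_of_isSimple ((connected_iff_isSimple w.2.2.1).1 w.2.2.2.2.1)).1
      w.2.2.2.2.2
  · obtain ⟨w, h1, h2, h3, h4⟩ := w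
    exact finsupp_fin_two_ext (by rw [wordWeight_zero, h3]) (by rw [wordWeight_one, h1]; omega)
  · obtain ⟨⟨w, hw⟩, rfl⟩ := w
    rw [wordWeight_one, hw.1.2.1.two_mul_half]
  · obtain ⟨⟨w, hw⟩, rfl⟩ := w
    rw [wordWeight_zero]
  · exact (connected_iff_isSimple w.1.2.1.2.1).2 w.1.2.1
  · obtain ⟨s, rfl, h⟩ := w.1.2.2
    exact (isStandard_iff_of_isSimple w.1.2.1).2 h

end

/-! ### Runs of the machine -/

section Machine

variable {α : Type}

/-- The stack of the given colour. -/
def MachineState.stack (σ : MachineState α) : Colour → List α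
  | .red => σ.stack₁
  | .blue => σ.stack₂

/-- The items of a state. -/
def MachineState.contents (σ : MachineState α) : Multiset α :=
  σ.input + σ.stack₁ + σ.stack₂ + σ.outputRev

/-- The number of inputs. -/
def inputs (w : List Step) : ℕ := w.count E + w.count N

/-- The number of outputs. -/
def outputs (w : List Step) : ℕ := w.count W + w.count S

@[simp] theorem inputs_append (v w : List Step) : inputs (v ++ w) = inputs v + inputs w := by
  simp [inputs]; omega

@[simp] theorem outputs_append (v w : List Step) : outputs (v ++ w) = outputs v + outputs w := by
  simp [outputs]; omega

theorem inputs_cons (s : Step) (w : List Step) : inputs (s :: w) = inputs [s] + inputs w :=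
  inputs_append [s] w

theorem outputs_cons (s : Step) (w : List Step) : outputs (s :: w) = outputs [s] + outputs w :=
  outputs_append [s] w

@[simp] theorem inputs_inputLetter (c : Colour) : inputs [inputLetter c] = 1 := by cases c <;> rfl

@[simp] theorem inputs_outputLetter (c : Colour) : inputs [outputLetter c] = 0 := by
  cases c <;> rfl

@[simp] theorem outputs_inputLetter (c : Colour) : outputs [inputLetter c] = 0 := by
  cases c <;> rfl

@[simp] theorem outputs_outputLetter (c : Colour) : outputs [outputLetter c] = 1 := by
  cases c <;> rfl

theorem isInput_inputLetter (c : Colour) : IsInput (inputLetter c) := by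
  cases c <;> simp [IsInput, inputLetter]

theorem not_isInput_outputLetter (c : Colour) : ¬ IsInput (outputLetter c) := by
  cases c <;> simp [IsInput, outputLetter]

theorem exists_letter (s : Step) : ∃ c, s = inputLetter c ∨ s = outputLetter c := by
  cases s
  exacts [⟨.red, .inl rfl⟩, ⟨.blue, .inl rfl⟩, ⟨.red, .inr rfl⟩, ⟨.blue, .inr rfl⟩]

theorem operate_inputLetter {c : Colour} {σ τ : MachineState α}
    (h : operate (inputLetter c) σ = some τ) : ∃ i, σ.input = i :: τ.input ∧
      τ.stack c = i :: σ.stack c ∧ (∀ d, d ≠ c → τ.stack d = σ.stack d) ∧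
      τ.outputRev = σ.outputRev := by
  obtain ⟨_ | ⟨i, inp⟩, s₁, s₂, out⟩ := σ
  · cases c <;> simp [inputLetter, operate] at h
  · refine ⟨i, ?_⟩
    cases c <;> simp [inputLetter, operate] at h <;> subst h <;>
      refine ⟨rfl, rfl, fun d hd => ?_, rfl⟩ <;> cases d <;> first | rfl | exact absurd rfl hd

theorem operate_outputLetter {c : Colour} {σ τ : MachineState α}
    (h : operate (outputLetter c) σ = some τ) : ∃ i, σ.input = τ.input ∧
      σ.stack c = i :: τ.stack c ∧ (∀ d, d ≠ c → τ.stack d = σ.stack d) ∧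
      τ.outputRev = i :: σ.outputRev := by
  obtain ⟨inp, s₁, s₂, out⟩ := σ
  cases c
  · obtain _ | ⟨i, s₁⟩ := s₁ <;> simp [outputLetter, operate] at h
    subst h
    refine ⟨i, rfl, rfl, fun d hd => ?_, rfl⟩
    cases d <;> first | rfl | exact absurd rfl hd
  · obtain _ | ⟨i, s₂⟩ := s₂ <;> simp [outputLetter, operate] at h
    subst h
    refine ⟨i, rfl, rfl, fun d hd => ?_, rfl⟩
    cases d <;> first | rfl | exact absurd rfl hd

theorem exists_operate_inputLetter {c : Colour} {σ : MachineState α} (h : σ.input ≠ []) :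
    ∃ τ, operate (inputLetter c) σ = some τ := by
  obtain ⟨_ | ⟨i, inp⟩, s₁, s₂, out⟩ := σ
  · exact absurd rfl h
  · cases c <;> exact ⟨_, rfl⟩

theorem exists_operate_outputLetter {c : Colour} {σ : MachineState α} (h : σ.stack c ≠ []) :
    ∃ τ, operate (outputLetter c) σ = some τ := by
  obtain ⟨inp, s₁, s₂, out⟩ := σ
  cases c
  · obtain _ | ⟨i, s₁⟩ := s₁
    · exact absurd rfl h
    · exact ⟨_, rfl⟩
  · obtain _ | ⟨i, s₂⟩ := s₂
    · exact absurd rfl h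
    · exact ⟨_, rfl⟩

theorem run_cons {s : Step} {w : List Step} {σ τ : MachineState α} :
    run (s :: w) σ = some τ ↔ ∃ ρ, operate s σ = some ρ ∧ run w ρ = some τ := by
  simp [run, Option.bind_eq_some_iff]

theorem run_append (v w : List Step) (σ : MachineState α) :
    run (v ++ w) σ = (run v σ).bind (run w) := by
  induction v generalizing σ with
  | nil => rfl
  | cons s v ih =>
    simp only [List.cons_append, run, Option.bind_assoc]
    congr 1
    funext ρ
    exact ih ρ

theorem run_append_eq_some {v w : List Step} {σ τ : MachineState α} :
    run (v ++ w) σ = some τ ↔ ∃ ρ, run v σ = some ρ ∧ run w ρ = some τ := by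
  rw [run_append, Option.bind_eq_some_iff]

theorem contents_operate {s : Step} {σ τ : MachineState α} (h : operate s σ = some τ) :
    τ.contents = σ.contents := by
  have key : ∀ (i : α) (l : List α), ((i :: l : List α) : Multiset α) = {i} + (l : Multiset α) :=
    fun i l => rfl
  obtain ⟨inp, s₁, s₂, out⟩ := σ
  cases s <;> simp only [operate] at h <;> split at h <;>
    simp_all only [Option.some.injEq, reduceCtorEq, MachineState.mk.injEq] <;>
    subst h <;> simp only [MachineState.contents, key] <;> abel

theorem contents_run {w : List Step} {σ τ : MachineState α} (h : run w σ = some τ) :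
    τ.contents = σ.contents := by
  induction w generalizing σ with
  | nil => simp only [run, Option.some.injEq] at h; rw [h]
  | cons s w ih =>
    obtain ⟨ρ, h1, h2⟩ := run_cons.1 h
    rw [ih h2, contents_operate h1]

theorem length_stack_operate {s : Step} {σ τ : MachineState α} (h : operate s σ = some τ)
    (c : Colour) : ((τ.stack c).length : ℤ) = (σ.stack c).length + stackHeight c [s] := by
  obtain ⟨d, rfl | rfl⟩ := exists_letter s
  · obtain ⟨i, h1, h2, h3, h4⟩ := operate_inputLetter h
    by_cases hd : c = d
    · subst hd
      rw [h2, stackHeight_inputLetter]; simp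
    · rw [h3 c hd, stackHeight_singleton, if_neg, if_neg (inputLetter_ne_outputLetter _ _), add_zero]
      exact fun h => hd (inputLetter_injective h).symm
  · obtain ⟨i, h1, h2, h3, h4⟩ := operate_outputLetter h
    by_cases hd : c = d
    · subst hd
      rw [h2, stackHeight_outputLetter]; simp
    · rw [h3 c hd, stackHeight_singleton, if_neg (inputLetter_ne_outputLetter _ _).symm, if_neg,
        add_zero]
      exact fun h => hd (outputLetter_injective h).symm

theorem length_stack_run {w : List Step} {σ τ : MachineState α} (h : run w σ = some τ)
    (c : Colour) : ((τ.stack c).length : ℤ) = (σ.stack c).length + stackHeight c w := by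
  induction w generalizing σ with
  | nil => simp only [run, Option.some.injEq] at h; simp [h]
  | cons s w ih =>
    obtain ⟨ρ, h1, h2⟩ := run_cons.1 h
    rw [ih h2, length_stack_operate h1, stackHeight_cons c s w]; ring

theorem input_run {w : List Step} {σ τ : MachineState α} (h : run w σ = some τ) :
    ∃ x, σ.input = x ++ τ.input ∧ x.length = inputs w := by
  induction w generalizing σ with
  | nil => simp only [run, Option.some.injEq] at h; exact ⟨[], by simp [h], rfl⟩
  | cons s w ih =>
    obtain ⟨ρ, h1, h2⟩ := run_cons.1 h
    obtain ⟨x, hx, hlen⟩ := ih h2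
    rw [inputs_cons]
    obtain ⟨d, rfl | rfl⟩ := exists_letter s
    · obtain ⟨i, h3, -⟩ := operate_inputLetter h1
      exact ⟨i :: x, by rw [h3, hx]; rfl, by simp [hlen, add_comm]⟩
    · obtain ⟨i, h3, -⟩ := operate_outputLetter h1
      exact ⟨x, by rw [h3, hx], by simp [hlen]⟩

theorem outputRev_run {w : List Step} {σ τ : MachineState α} (h : run w σ = some τ) :
    ∃ x, τ.outputRev = x ++ σ.outputRev ∧ x.length = outputs w := by
  induction w generalizing σ with
  | nil => simp only [run, Option.some.injEq] at h; exact ⟨[], by simp [h], rfl⟩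
  | cons s w ih =>
    obtain ⟨ρ, h1, h2⟩ := run_cons.1 h
    obtain ⟨x, hx, hlen⟩ := ih h2
    rw [outputs_cons]
    obtain ⟨d, rfl | rfl⟩ := exists_letter s
    · obtain ⟨i, -, -, -, h3⟩ := operate_inputLetter h1
      exact ⟨x, by rw [← h3, hx], by simp [hlen]⟩
    · obtain ⟨i, -, -, -, h3⟩ := operate_outputLetter h1
      exact ⟨x ++ [i], by rw [hx, h3]; simp, by simp [hlen, add_comm]⟩

theorem exists_run {w : List Step} {σ : MachineState α}
    (h : ∀ c, StaysAbove (-(σ.stack c).length) c w) (hin : inputs w ≤ σ.input.length) :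
    ∃ τ, run w σ = some τ := by
  induction w generalizing σ with
  | nil => exact ⟨σ, rfl⟩
  | cons s w ih =>
    obtain ⟨ρ, hρ⟩ : ∃ ρ, operate s σ = some ρ := by
      obtain ⟨d, rfl | rfl⟩ := exists_letter s
      · refine exists_operate_inputLetter fun h0 => ?_
        rw [h0, inputs_cons] at hin
        simp at hin
      · refine exists_operate_outputLetter fun h0 => ?_
        have h1 := (staysAbove_cons.1 (h d)).2 [] List.nil_prefix
        rw [h0, stackHeight_outputLetter] at h1
        simp at h1
    obtain ⟨τ, hτ⟩ := ih (σ := ρ) (fun c => by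
      rw [length_stack_operate hρ]
      convert (staysAbove_cons.1 (h c)).2 using 1
      ring) (by
      obtain ⟨x, h1, h2⟩ := input_run (w := [s]) (run_cons.2 ⟨ρ, hρ, rfl⟩)
      rw [h1, List.length_append, h2, inputs_cons] at hin
      omega)
    exact ⟨τ, run_cons.2 ⟨ρ, hρ, hτ⟩⟩

/-- The machine with the given input, before any operation. -/
def initialState (l : List α) : MachineState α := ⟨l, [], [], []⟩

/-- The machine at the end, with the given reversed output. -/
def finalState (l : List α) : MachineState α := ⟨[], [], [], l⟩

@[simp] theorem stack_initialState (l : List α) (c : Colour) : (initialState l).stack c = [] := by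
  cases c <;> rfl

@[simp] theorem stack_finalState (l : List α) (c : Colour) : (finalState l).stack c = [] := by
  cases c <;> rfl

theorem isQuarterPlaneLoop_of_run {w : List Step} {l m : List α}
    (h : run w (initialState l) = some (finalState m)) :
    IsQuarterPlaneLoop w ∧ w.length = 2 * l.length := by
  have hloop : IsQuarterPlaneLoop w := by
    rw [isQuarterPlaneLoop_iff]
    refine fun c => ⟨?_, ?_⟩
    · rintro p ⟨q, rfl⟩
      obtain ⟨ρ, h1, -⟩ := run_append_eq_some.1 h
      have := length_stack_run h1 c
      simp at this
      omega
    · have := length_stack_run h c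
      simp at this
      omega
  refine ⟨hloop, ?_⟩
  obtain ⟨x, h1, h2⟩ := input_run h
  rw [show (initialState l).input = l from rfl, show (finalState m).input = [] from rfl,
    List.append_nil] at h1
  rw [h1, h2, hloop.length_eq]; rfl

theorem MachineState.ext_stack {σ τ : MachineState α} (h1 : σ.input = τ.input)
    (h2 : ∀ c, σ.stack c = τ.stack c) (h3 : σ.outputRev = τ.outputRev) : σ = τ := by
  have := h2 .red
  have := h2 .blue
  cases σ; cases τ
  simp_all [MachineState.stack]

theorem exists_run_of_isQuarterPlaneLoop {w : List Step} (hw : IsQuarterPlaneLoop w) {l : List α}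
    (hl : w.length = 2 * l.length) :
    ∃ m, run w (initialState l) = some (finalState m) ∧ m.Perm l := by
  have h1 := hw.length_eq
  have hin : inputs w = l.length := by unfold inputs; omega
  obtain ⟨τ, hτ⟩ := exists_run (w := w) (σ := initialState l)
    (fun c => by simpa using hw.staysAbove c) hin.le
  have h2 : τ = finalState τ.outputRev := by
    refine MachineState.ext_stack ?_ (fun c => ?_) rfl
    · obtain ⟨x, h3, h4⟩ := input_run hτ
      have := congrArg List.length h3
      rw [List.length_append, h4, hin] at this
      refine List.eq_nil_of_length_eq_zero ?_
      change l.length = _ at this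
      omega
    · have := length_stack_run hτ c
      rw [hw.height] at this
      simpa using this
  refine ⟨τ.outputRev, by rw [hτ, ← h2], ?_⟩
  have h3 := contents_run hτ
  rw [h2] at h3
  simpa [MachineState.contents, initialState, finalState] using h3

/-! ### The item carried by an arch -/

theorem run_take_succ {w : List Step} {m : ℕ} {s : Step} (hs : w[m]? = some s)
    {σ τ : MachineState α} (h : run (w.take (m + 1)) σ = some τ) :
    ∃ ρ, run (w.take m) σ = some ρ ∧ operate s ρ = some τ := by
  rw [List.take_add_one, hs] at h
  obtain ⟨ρ, h1, h2⟩ := run_append_eq_some.1 h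
  obtain ⟨τ', h3, h4⟩ := run_cons.1 h2
  simp only [run, Option.some.injEq] at h4
  exact ⟨ρ, h1, h4 ▸ h3⟩

theorem exists_run_take {w : List Step} {σ τ : MachineState α} (h : run w σ = some τ) (m : ℕ) :
    ∃ ρ, run (w.take m) σ = some ρ ∧ run (w.drop m) ρ = some τ := by
  rw [← List.take_append_drop m w] at h
  exact run_append_eq_some.1 h

/-- Removing `i` would bring the stack down to the height of `b`, which the height hypothesis
forbids. -/
theorem stack_persists {w : List Step} {l : List α} {c : Colour} {i : α} {b : List α} {m₀ : ℕ}
    {σ₀ : MachineState α} (h0 : run (w.take m₀) (initialState l) = some σ₀)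
    (hσ₀ : σ₀.stack c = i :: b) {m : ℕ} (hm : m₀ ≤ m)
    (hh : ∀ k, m₀ ≤ k → k ≤ m → (b.length : ℤ) < stackHeight c (w.take k)) {σ : MachineState α}
    (h : run (w.take m) (initialState l) = some σ) : ∃ t, σ.stack c = t ++ i :: b := by
  induction m, hm using Nat.le_induction generalizing σ with
  | base =>
    rw [h0, Option.some_inj] at h
    exact ⟨[], by rw [← h, hσ₀]; rfl⟩
  | succ m hm ih =>
    cases hs : w[m]? with
    | none =>
      rw [List.take_add_one, hs] at h
      exact ih (fun k h1 h2 => hh k h1 (by omega)) (by simpa using h)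
    | some s =>
      obtain ⟨ρ, h1, h2⟩ := run_take_succ hs h
      obtain ⟨t, ht⟩ := ih (fun k h1 h2 => hh k h1 (by omega)) h1
      have h3 := length_stack_run h c
      have h4 := hh (m + 1) (by omega) le_rfl
      rw [stack_initialState, List.length_nil, Nat.cast_zero, zero_add] at h3
      rw [← h3] at h4
      obtain ⟨d, rfl | rfl⟩ := exists_letter s
      · obtain ⟨j, -, h5, h6, -⟩ := operate_inputLetter h2
        by_cases hd : c = d
        · subst hd
          exact ⟨j :: t, by rw [h5, ht]; rfl⟩
        · exact ⟨t, by rw [h6 c hd, ht]⟩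
      · obtain ⟨j, -, h5, h6, -⟩ := operate_outputLetter h2
        by_cases hd : c = d
        · subst hd
          rw [ht] at h5
          cases t with
          | nil =>
            rw [List.nil_append, List.cons.injEq] at h5
            rw [← h5.2] at h4
            exact absurd h4 (lt_irrefl _)
          | cons k t =>
            rw [List.cons_append, List.cons.injEq] at h5
            exact ⟨t, h5.2.symm⟩
        · exact ⟨t, by rw [h6 c hd, ht]⟩

/-- The item read at the left endpoint of an arch is written at its right endpoint. -/
theorem Arch.item {w : List Step} {l m : List α}
    (h : run w (initialState l) = some (finalState m)) (A : Arch w) :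
    ∃ i, l[inputs (w.take A.left)]? = some i ∧
      m.reverse[outputs (w.take A.right)]? = some i := by
  obtain ⟨σ₁, h1, -⟩ := exists_run_take h (A.left + 1)
  obtain ⟨σ₀, h0, h01⟩ := run_take_succ A.getElem_left h1
  obtain ⟨σ₃, h3, h3'⟩ := exists_run_take h (A.right + 1)
  obtain ⟨σ₂, h2, h23⟩ := run_take_succ A.getElem_right h3
  obtain ⟨i, hi1, hi2, -⟩ := operate_inputLetter h01
  have l0 := length_stack_run h0 A.colour
  have l2 := length_stack_run h2 A.colour
  have l3 := length_stack_run h3 A.colour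
  simp only [stack_initialState, List.length_nil, Nat.cast_zero, zero_add] at l0 l2 l3
  obtain ⟨t, ht⟩ := stack_persists h1 hi2 A.lt (fun k h4 h5 => by
    rw [l0]; exact A.stays k h4 h5) h2
  obtain ⟨j, -, hj2, -, hj4⟩ := operate_outputLetter h23
  have hlv := A.leaves
  -- If anything lay above `i`, the output would leave the stack higher than it was before `i`
  -- entered, against `A.leaves`.
  have hi : i = j := by
    rw [ht] at hj2
    cases t with
    | nil => exact (List.cons.inj hj2).1
    | cons k t =>
      rw [List.cons_append, List.cons.injEq] at hj2
      rw [← hj2.2, List.length_append, List.length_cons] at l3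
      omega
  subst hi
  refine ⟨i, ?_, ?_⟩
  · obtain ⟨x, hx1, hx2⟩ := input_run h0
    rw [hi1] at hx1
    change l = _ at hx1
    rw [hx1, ← hx2, List.getElem?_append_right le_rfl]
    simp
  · obtain ⟨x, hx1, hx2⟩ := outputRev_run h2
    obtain ⟨y, hy1, hy2⟩ := outputRev_run h3'
    change m = _ at hy1
    change _ = x ++ [] at hx1
    rw [List.append_nil] at hx1
    rw [hy1, hj4, hx1, ← hx2]
    simp

/-! ### The order of inputs and outputs -/

/-- Without corners, the first output after a run of inputs is from the stack that received the last
of them, so it releases the item just read. Some output occurs because the stacks are empty at the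
end. -/
theorem exists_first_output {s : Step} {w : List Step} (hs : IsInput s)
    (hc : corners (s :: w) = 0) {σ τ : MachineState α} (h : run (s :: w) σ = some τ)
    (hτ : ∀ c, τ.stack c = []) : ∃ x ∈ σ.input, ∃ y, τ.outputRev = y ++ x :: σ.outputRev := by
  induction w generalizing s σ with
  | nil =>
    obtain ⟨ρ, h1, h2⟩ := run_cons.1 h
    simp only [run, Option.some.injEq] at h2
    subst h2
    obtain ⟨c, rfl | rfl⟩ := exists_letter s
    · obtain ⟨i, -, h3, -⟩ := operate_inputLetter h1
      rw [hτ] at h3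
      simp at h3
    · exact absurd hs (not_isInput_outputLetter c)
  | cons t w ih =>
    obtain ⟨ρ, h1, h2⟩ := run_cons.1 h
    obtain ⟨c, rfl | rfl⟩ := exists_letter s
    · obtain ⟨i, h3, h4, -, h5⟩ := operate_inputLetter h1
      rw [corners_cons, Nat.add_eq_zero_iff] at hc
      by_cases ht : IsInput t
      · obtain ⟨x, hx, y, hy⟩ := ih ht hc.2 h2
        exact ⟨x, by rw [h3]; exact List.mem_cons_of_mem _ hx, y, by rw [hy, h5]⟩
      · obtain rfl : t = outputLetter c := by
          have := hc.1
          cases c <;> cases t <;> simp_all [cornerHead, inputLetter, outputLetter, IsInput]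
        obtain ⟨ρ', h6, h7⟩ := run_cons.1 h2
        obtain ⟨j, -, h8, -, h9⟩ := operate_outputLetter h6
        rw [h4, List.cons.injEq] at h8
        obtain ⟨y, hy, -⟩ := outputRev_run h7
        exact ⟨i, by rw [h3]; exact List.mem_cons_self, y, by rw [hy, h9, h5, h8.1]⟩
    · exact absurd hs (not_isInput_outputLetter c)

theorem eq_nil_of_run {w : List Step} {σ τ : MachineState α} (h : run w σ = some τ)
    (hin : σ.input = []) (hout : τ.outputRev = σ.outputRev) : w = [] := by
  obtain ⟨x, h1, h2⟩ := input_run h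
  obtain ⟨y, h3, h4⟩ := outputRev_run h
  rw [hin] at h1
  rw [(List.append_eq_nil_iff.1 h1.symm).1] at h2
  rw [hout] at h3
  rw [List.self_eq_append_left.1 h3] at h4
  have := length_eq_sum_count w
  refine List.eq_nil_of_length_eq_zero ?_
  simp only [List.length_nil, inputs, outputs] at h2 h4
  omega

/-- The next item output is still unread for the first word, by `exists_first_output`, but already
in a stack for the second; no item can be in both places. -/
theorem false_of_input_output {s t : Step} {v w : List Step} (hs : IsInput s) (ht : ¬ IsInput t)
    (hc : corners (s :: v) = 0) {σ σ' τ τ' : MachineState α} (h : run (s :: v) σ = some τ)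
    (h' : run (t :: w) σ' = some τ') (hτ : ∀ c, τ.stack c = []) (hin : σ.input = σ'.input)
    (hout : σ.outputRev = σ'.outputRev) (hfin : τ.outputRev = τ'.outputRev)
    (hd : σ'.contents.Nodup) : False := by
  obtain ⟨x, hx, y, hy⟩ := exists_first_output hs hc h hτ
  obtain ⟨ρ, h1, h2⟩ := run_cons.1 h'
  obtain ⟨c, rfl | rfl⟩ := exists_letter t
  · exact ht (isInput_inputLetter c)
  · obtain ⟨i, -, h3, -, h4⟩ := operate_outputLetter h1
    obtain ⟨z, hz, -⟩ := outputRev_run h2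
    rw [hy, hz, h4, hout] at hfin
    have h5 := (List.append_inj' hfin (by simp)).2
    rw [List.cons.injEq] at h5
    have h6 := h5.1
    subst h6
    rw [hin] at hx
    have h7 : x ∈ σ'.stack c := by rw [h3]; exact List.mem_cons_self
    obtain ⟨inp, s₁, s₂, out⟩ := σ'
    simp only [MachineState.contents, Multiset.coe_add, Multiset.coe_nodup] at hd
    cases c
    · have := (List.nodup_append.1 (List.nodup_append.1 (List.nodup_append.1 hd).1).1).2.2
      exact this x hx x h7 rfl
    · have := (List.nodup_append.1 (List.nodup_append.1 hd).1).2.2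
      exact this x (List.mem_append_left _ hx) x h7 rfl

/-- Corner-free words with the same output have the same inputs and outputs. -/
theorem map_isInput_eq {v w : List Step} (hv : corners v = 0) (hw : corners w = 0)
    {σ σ' τ τ' : MachineState α} (h : run v σ = some τ) (h' : run w σ' = some τ')
    (hτ : ∀ c, τ.stack c = []) (hτ' : ∀ c, τ'.stack c = []) (hτi : τ.input = [])
    (hτi' : τ'.input = []) (hin : σ.input = σ'.input) (hout : σ.outputRev = σ'.outputRev)
    (hfin : τ.outputRev = τ'.outputRev) (hd : σ.contents.Nodup) (hd' : σ'.contents.Nodup) :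
    v.map (fun s => decide (IsInput s)) = w.map (fun s => decide (IsInput s)) := by
  induction v generalizing w σ σ' with
  | nil =>
    simp only [run, Option.some.injEq] at h
    subst h
    rw [eq_nil_of_run h' (by rw [← hin, hτi]) (by rw [← hfin, hout])]
  | cons s v ih =>
    cases w with
    | nil =>
      simp only [run, Option.some.injEq] at h'
      subst h'
      exact absurd (eq_nil_of_run h (by rw [hin, hτi']) (by rw [hfin, hout])) (by simp)
    | cons t w =>
      by_cases hs : IsInput s <;> by_cases ht : IsInput t
      · obtain ⟨ρ, h1, h2⟩ := run_cons.1 h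
        obtain ⟨ρ', h1', h2'⟩ := run_cons.1 h'
        rw [corners_cons, Nat.add_eq_zero_iff] at hv hw
        obtain ⟨c, rfl | rfl⟩ := exists_letter s
        swap
        · exact absurd hs (not_isInput_outputLetter c)
        obtain ⟨d, rfl | rfl⟩ := exists_letter t
        swap
        · exact absurd ht (not_isInput_outputLetter d)
        obtain ⟨i, h3, -, -, h4⟩ := operate_inputLetter h1
        obtain ⟨j, h3', -, -, h4'⟩ := operate_inputLetter h1'
        rw [h3, h3', List.cons.injEq] at hin
        have := ih hv.2 hw.2 h2 h2' hin.2 (by rw [h4, h4', hout])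
          (by rwa [contents_operate h1]) (by rwa [contents_operate h1'])
        simp [hs, ht, this]
      · exact (false_of_input_output hs ht hv h h' hτ hin hout hfin hd').elim
      · exact (false_of_input_output ht hs hw h' h hτ' hin.symm hout.symm hfin.symm hd).elim
      · obtain ⟨ρ, h1, h2⟩ := run_cons.1 h
        obtain ⟨ρ', h1', h2'⟩ := run_cons.1 h'
        rw [corners_cons, Nat.add_eq_zero_iff] at hv hw
        obtain ⟨c, rfl | rfl⟩ := exists_letter s
        · exact absurd (isInput_inputLetter c) hs
        obtain ⟨d, rfl | rfl⟩ := exists_letter t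
        · exact absurd (isInput_inputLetter d) ht
        obtain ⟨i, h3, -, -, h4⟩ := operate_outputLetter h1
        obtain ⟨j, h3', -, -, h4'⟩ := operate_outputLetter h1'
        obtain ⟨y, hy, -⟩ := outputRev_run h2
        obtain ⟨z, hz, -⟩ := outputRev_run h2'
        -- Both words have output equally many items so far, so equal final outputs force equal
        -- current outputs.
        have h5 := hfin
        rw [hy, hz] at h5
        have := ih hv.2 hw.2 h2 h2' (by rw [← h3, ← h3', hin])
          (List.append_inj' h5 (by rw [h4, h4', hout]; simp)).2
          (by rwa [contents_operate h1]) (by rwa [contents_operate h1'])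
        simp [hs, ht, this]

end Machine

/-! ### Removing corners -/

section Machine

variable {α : Type}

/-- The two letters of a corner use different stacks, one of them reading and the other writing, so
they commute. -/
theorem run_swap_corner {s t : Step} (hst : (s = N ∧ t = W) ∨ (s = E ∧ t = S)) {p q : List Step}
    {σ τ : MachineState α} (h : run (p ++ s :: t :: q) σ = some τ) :
    run (p ++ t :: s :: q) σ = some τ := by
  rw [run_append_eq_some] at h ⊢
  obtain ⟨ρ, h1, h2⟩ := h
  refine ⟨ρ, h1, ?_⟩
  rw [← h2]
  obtain ⟨inp, s₁, s₂, out⟩ := ρ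
  rcases hst with ⟨rfl, rfl⟩ | ⟨rfl, rfl⟩
  · cases inp <;> cases s₁ <;> simp_all [run, operate]
  · cases inp <;> cases s₂ <;> simp_all [run, operate]

theorem exists_corner {w : List Step} (h : corners w ≠ 0) :
    ∃ p s t q, w = p ++ s :: t :: q ∧ ((s = N ∧ t = W) ∨ (s = E ∧ t = S)) := by
  induction w with
  | nil => exact absurd rfl h
  | cons s w ih =>
    rw [corners_cons] at h
    by_cases h0 : corners w = 0
    · cases w with
      | nil => exact absurd rfl h
      | cons t w =>
        refine ⟨[], s, t, w, rfl, ?_⟩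
        by_contra hst
        exact h (by rw [h0]; simp [cornerHead, hst])
    · obtain ⟨p, a, b, q, rfl, hab⟩ := ih h0
      exact ⟨s :: p, a, b, q, rfl, hab⟩

/-- The number of pairs formed by an input and a later output. -/
def inputOutputPairs : List Step → ℕ
  | [] => 0
  | s :: w => inputs [s] * outputs w + inputOutputPairs w

theorem inputOutputPairs_swap_lt {s t : Step} (hst : (s = N ∧ t = W) ∨ (s = E ∧ t = S))
    (p q : List Step) :
    inputOutputPairs (p ++ t :: s :: q) < inputOutputPairs (p ++ s :: t :: q) := by
  induction p with
  | nil =>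
    rcases hst with ⟨rfl, rfl⟩ | ⟨rfl, rfl⟩ <;> simp [inputOutputPairs, inputs, outputs]
  | cons r p ih =>
    have : outputs (p ++ t :: s :: q) = outputs (p ++ s :: t :: q) := by
      rw [outputs_append, outputs_append, outputs_cons t, outputs_cons s q, outputs_cons s (t :: q),
        outputs_cons t q]
      omega
    simp only [List.cons_append, inputOutputPairs, this]
    omega

/-- Corners are swapped away one by one. The number of corners need not drop (`NNW` becomes `NWN`),
but the number of inputs that precede an output does. -/
theorem exists_corner_free {w : List Step} {σ τ : MachineState α} (h : run w σ = some τ) :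
    ∃ v, run v σ = some τ ∧ corners v = 0 := by
  induction hn : inputOutputPairs w using Nat.strong_induction_on generalizing w with
  | _ n ih =>
    by_cases h0 : corners w = 0
    · exact ⟨w, h, h0⟩
    · obtain ⟨p, s, t, q, rfl, hst⟩ := exists_corner h0
      exact ih _ (hn ▸ inputOutputPairs_swap_lt hst p q) (run_swap_corner hst h) rfl

/-! ### Exchanging the stacks -/

/-- The state with its stacks exchanged. -/
def MachineState.swap (σ : MachineState α) : MachineState α :=
  ⟨σ.input, σ.stack₂, σ.stack₁, σ.outputRev⟩

theorem operate_swap (s : Step) (σ : MachineState α) :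
    operate s.swap σ = (operate s σ.swap).map MachineState.swap := by
  obtain ⟨_ | ⟨i, inp⟩, _ | ⟨j, s₁⟩, _ | ⟨k, s₂⟩, out⟩ := σ <;> cases s <;> rfl

theorem run_map_swap (w : List Step) (σ : MachineState α) :
    run (w.map Step.swap) σ = (run w σ.swap).map MachineState.swap := by
  induction w generalizing σ with
  | nil => rfl
  | cons s w ih =>
    rw [List.map_cons, run, run, operate_swap]
    cases operate s σ.swap with
    | none => rfl
    | some ρ => exact ih _

/-- Adding items at the bottom of the stacks. -/
def MachineState.addBelow (b₁ b₂ : List α) (σ : MachineState α) : MachineState α :=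
  ⟨σ.input, σ.stack₁ ++ b₁, σ.stack₂ ++ b₂, σ.outputRev⟩

theorem operate_addBelow {s : Step} {σ : MachineState α} (b₁ b₂ : List α)
    (h : ∀ c, -((σ.stack c).length : ℤ) ≤ stackHeight c [s]) :
    operate s (σ.addBelow b₁ b₂) = (operate s σ).map (MachineState.addBelow b₁ b₂) := by
  have h1 := h .red
  have h2 := h .blue
  rw [stackHeight_singleton] at h1 h2
  obtain ⟨_ | ⟨i, inp⟩, _ | ⟨j, s₁⟩, _ | ⟨k, s₂⟩, out⟩ := σ <;> cases s <;>
    first | rfl | (simp [MachineState.stack, inputLetter, outputLetter] at h1 h2)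

theorem run_addBelow {w : List Step} {σ : MachineState α} (b₁ b₂ : List α)
    (h : ∀ c, StaysAbove (-((σ.stack c).length : ℤ)) c w) :
    run w (σ.addBelow b₁ b₂) = (run w σ).map (MachineState.addBelow b₁ b₂) := by
  induction w generalizing σ with
  | nil => rfl
  | cons s w ih =>
    have h1 := fun c => (staysAbove_cons.1 (h c)).2
    rw [run, run, operate_addBelow b₁ b₂ fun c => by
      have := h1 c [] List.nil_prefix
      rw [stackHeight_nil] at this
      linarith]
    cases hρ : operate s σ with
    | none => rfl
    | some ρ =>
      refine ih fun c => ?_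
      rw [length_stack_operate hρ]
      convert h1 c using 1
      ring

/-- A loop removes only items that it has itself put on the stacks, so it acts as if the stacks were
empty. This is what makes its action insensitive to exchanging the stacks. -/
theorem run_loop {w : List Step} (hw : IsQuarterPlaneLoop w) (σ : MachineState α) :
    run w σ = (run w ⟨σ.input, [], [], σ.outputRev⟩).map
      fun τ => ⟨τ.input, σ.stack₁, σ.stack₂, τ.outputRev⟩ := by
  have h1 := run_addBelow (w := w) (σ := ⟨σ.input, [], [], σ.outputRev⟩) σ.stack₁ σ.stack₂
    (fun c => by cases c <;> simpa [MachineState.stack] using hw.staysAbove _)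
  change run w σ = _ at h1
  rw [h1]
  cases hρ : run w ⟨σ.input, [], [], σ.outputRev⟩ with
  | none => rfl
  | some ρ =>
    have h2 := length_stack_run hρ .red
    have h3 := length_stack_run hρ .blue
    rw [hw.height] at h2 h3
    simp [MachineState.stack] at h2 h3
    simp [MachineState.addBelow, h2, h3]

/-- A loop and the loop obtained by exchanging the stacks act in the same way. -/
theorem run_map_swap_loop {w : List Step} (hw : IsQuarterPlaneLoop w) (σ : MachineState α) :
    run (w.map Step.swap) σ = run w σ := by
  rw [run_loop hw.map_swap σ, run_loop hw σ, run_map_swap, Option.map_map]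
  rfl

/-- Two words that act in the same way on all states, and agree in length and corners. -/
structure RunEquiv (α : Type) (v w : List Step) : Prop where
  run_eq : ∀ σ : MachineState α, run v σ = run w σ
  length_eq : v.length = w.length
  corners_eq : corners v = corners w

theorem RunEquiv.trans {u v w : List Step} (h : RunEquiv α u v) (h' : RunEquiv α v w) :
    RunEquiv α u w :=
  ⟨fun σ => (h.run_eq σ).trans (h'.run_eq σ), h.length_eq.trans h'.length_eq,
    h.corners_eq.trans h'.corners_eq⟩

/-- Inserted words are replaced one at a time. Whether a corner of the underlying word survives
depends only on whether its gap is empty, which equality of lengths preserves. -/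
theorem exists_interleave_standard {l : List (Step × List Step)} (hl : LoopsInserted l)
    (h : ∀ p ∈ l, ∃ L, RunEquiv α p.2 L ∧ IsQuarterPlaneLoop L ∧ IsStandard L) :
    ∃ m, m.map Prod.fst = l.map Prod.fst ∧ LoopsInserted m ∧ (∀ p ∈ m, IsStandard p.2) ∧
      RunEquiv α (interleave l) (interleave m) := by
  induction l with
  | nil => exact ⟨[], rfl, hl, by simp, ⟨fun _ => rfl, rfl, rfl⟩⟩
  | cons p l ih =>
    obtain ⟨s, L⟩ := p
    obtain ⟨m, h1, h2, h3, h4⟩ := ih hl.tail fun p hp => h p (List.mem_cons_of_mem _ hp)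
    obtain ⟨M, h5, h6, h7⟩ := h (s, L) List.mem_cons_self
    refine ⟨(s, M) :: m, by simp [h1], ?_, ?_, ⟨fun σ => ?_, ?_, ?_⟩⟩
    · rintro p hp
      rcases List.mem_cons.1 hp with rfl | hp
      exacts [h6, h2 p hp]
    · rintro p hp
      rcases List.mem_cons.1 hp with rfl | hp
      exacts [h7, h3 p hp]
    · simp only [interleave_cons, run, run_append]
      refine congrArg _ (funext fun ρ => ?_)
      rw [h5.run_eq]
      exact congrArg _ (funext fun ρ' => h4.run_eq ρ')
    · simp [h5.length_eq, h4.length_eq]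
    · have h8 : L = [] ↔ M = [] := by
        rw [← List.length_eq_zero_iff, ← List.length_eq_zero_iff, h5.length_eq]
      rw [corners_interleave_cons h6, corners_interleave_cons hl.head, h4.corners_eq, h1,
        h5.corners_eq]
      simp only [h8]

/-- Every loop acts as a standard one. -/
theorem exists_standard {w : List Step} (hw : IsQuarterPlaneLoop w) :
    ∃ v, RunEquiv α w v ∧ IsQuarterPlaneLoop v ∧ IsStandard v := by
  induction hn : w.length using Nat.strong_induction_on generalizing w with
  | _ n ih =>
    rcases eq_or_ne w [] with rfl | hne
    · exact ⟨[], ⟨fun _ => rfl, rfl, rfl⟩, isQuarterPlaneLoop_nil, isStandard_nil⟩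
    -- Exchanging the stacks in the whole loop makes the first component standard; the inserted
    -- loops, which are shorter, are handled by induction.
    obtain ⟨w', h1, h2, h3⟩ : ∃ w', RunEquiv α w w' ∧ IsQuarterPlaneLoop w' ∧ w'.head? = some E := by
      obtain ⟨s, w, rfl⟩ := List.exists_cons_of_ne_nil hne
      rcases hw.head_isInput with rfl | rfl
      · exact ⟨_, ⟨fun _ => rfl, rfl, rfl⟩, hw, rfl⟩
      · exact ⟨_, ⟨fun σ => (run_map_swap_loop hw σ).symm, by simp, (corners_map_swap _).symm⟩,
          hw.map_swap, rfl⟩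
    obtain ⟨l, h4, h5, rfl⟩ := exists_interleave_simple h2 (by rintro rfl; simp at h3)
    obtain ⟨m, h6, h7, h8, h9⟩ := exists_interleave_standard (α := α) h5 fun p hp => by
      refine ih p.2.length ?_ (h5 p hp) rfl
      obtain ⟨l₁, l₂, rfl⟩ := List.append_of_mem hp
      obtain ⟨s, L⟩ := p
      rw [← hn, h1.length_eq]
      simp
      omega
    refine ⟨interleave m, h1.trans h9, ?_, ?_⟩
    · rw [isQuarterPlaneLoop_interleave h7, h6]; exact h4.2.1
    · rw [isStandard_interleave (h6 ▸ h4) h7, h6]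
      refine ⟨?_, h8⟩
      cases l with
      | nil => simp at h3
      | cons p l => obtain ⟨s, L⟩ := p; simpa using h3

end Machine

/-! ### Canonical words of permutations -/

section Uniqueness

variable {v w : List Step}

theorem inputs_eq_count (w : List Step) :
    inputs w = (w.map fun s => decide (IsInput s)).count true := by
  induction w with
  | nil => rfl
  | cons s w ih => rw [inputs_cons, List.map_cons, List.count_cons, ← ih]; cases s <;>
      simp [inputs, IsInput, add_comm]

theorem outputs_eq_count (w : List Step) :
    outputs w = (w.map fun s => decide (IsInput s)).count false := by
  induction w with
  | nil => rfl
  | cons s w ih => rw [outputs_cons, List.map_cons, List.count_cons, ← ih]; cases s <;>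
      simp [outputs, IsInput, add_comm]

theorem isInput_getElem?_iff
    (h : v.map (fun s => decide (IsInput s)) = w.map (fun s => decide (IsInput s))) {m : ℕ}
    {s t : Step} (hs : v[m]? = some s) (ht : w[m]? = some t) : IsInput s ↔ IsInput t := by
  have := congrArg (fun l => l[m]?) h
  simpa [hs, ht] using this

theorem outputs_take_lt {m m' : ℕ} {c : Colour} (h : w[m]? = some (outputLetter c)) (hm : m < m') :
    outputs (w.take m) < outputs (w.take m') := by
  have h1 : outputs (w.take (m + 1)) = outputs (w.take m) + 1 := by
    rw [List.take_add_one, h, outputs_append]; simp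
  obtain ⟨k, rfl⟩ := Nat.exists_eq_add_of_le (show m + 1 ≤ m' from hm)
  rw [List.take_add, outputs_append]
  omega

/-- Words with the same inputs and outputs that produce the same permutation have the same
arches. -/
theorem Arch.exists_same_ends {α : Type} {l m : List α} (hm : m.Nodup)
    (hw : IsQuarterPlaneLoop w)
    (h : run v (initialState l) = some (finalState m))
    (h' : run w (initialState l) = some (finalState m))
    (e : v.map (fun s => decide (IsInput s)) = w.map (fun s => decide (IsInput s))) (A : Arch v) :
    ∃ B : Arch w, B.left = A.left ∧ B.right = A.right := by
  have hlen : v.length = w.length := by simpa using congrArg List.length e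
  have hin : ∀ k, inputs (v.take k) = inputs (w.take k) := fun k => by
    rw [inputs_eq_count, inputs_eq_count, List.map_take, List.map_take, e]
  have hout : ∀ k, outputs (v.take k) = outputs (w.take k) := fun k => by
    rw [outputs_eq_count, outputs_eq_count, List.map_take, List.map_take, e]
  obtain ⟨B, hB⟩ : ∃ B : Arch w, B.left = A.left := by
    have hlt : A.left < w.length := hlen ▸ A.left_lt_length
    have h1 : w[A.left]? = some w[A.left] := List.getElem?_eq_getElem hlt
    have h2 := (isInput_getElem?_iff e A.getElem_left h1).1 (isInput_inputLetter _)
    obtain ⟨c, hc | hc⟩ := exists_letter w[A.left]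
    · obtain ⟨B, hB, -⟩ := exists_arch_of_input hw (h1.trans (congrArg some hc))
      exact ⟨B, hB⟩
    · rw [hc] at h2; exact absurd h2 (not_isInput_outputLetter c)
  refine ⟨B, hB, ?_⟩
  -- Both arches carry the same item, since equally many inputs precede them. An item occurs only
  -- once in the output, so the arches close at outputs of the same rank, hence at the same time.
  obtain ⟨i, h1, h2⟩ := A.item h
  obtain ⟨j, h3, h4⟩ := B.item h'
  rw [hB, ← hin, h1, Option.some_inj] at h3
  subst h3
  obtain ⟨h5, h6⟩ := List.getElem?_eq_some_iff.1 h2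
  obtain ⟨h7, h8⟩ := List.getElem?_eq_some_iff.1 h4
  have h9 := (List.Nodup.getElem_inj_iff (List.nodup_reverse.2 hm)).1 (h6.trans h8.symm)
  rw [← hout] at h9
  obtain ⟨s, hs⟩ : ∃ s, v[B.right]? = some s :=
    ⟨v[B.right]'(hlen ▸ B.right_lt_length), List.getElem?_eq_getElem _⟩
  have h10 := isInput_getElem?_iff e hs B.getElem_right
  obtain ⟨c, rfl | rfl⟩ := exists_letter s
  · exact absurd (h10.1 (isInput_inputLetter c)) (not_isInput_outputLetter _)
  rcases lt_trichotomy A.right B.right with hlt | heq | hlt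
  · exact absurd h9 (outputs_take_lt A.getElem_right hlt).ne
  · exact heq.symm
  · exact absurd h9.symm (outputs_take_lt hs hlt).ne

theorem exists_first_in_component {w : List Step} (A : Arch w) :
    ∃ F : Arch w, (archGraph w).Reachable F A ∧
      ∀ B, (archGraph w).Reachable F B → F.left ≤ B.left := by
  classical
  have hex : ∃ k, ∃ F : Arch w, (archGraph w).Reachable F A ∧ F.left = k :=
    ⟨_, A, SimpleGraph.Reachable.refl _, rfl⟩
  obtain ⟨F, h1, h2⟩ := Nat.find_spec hex
  refine ⟨F, h1, fun B hB => ?_⟩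
  rw [h2]
  exact Nat.find_min' hex ⟨B, hB.symm.trans h1, rfl⟩

theorem Colour.eq_of_ne_of_ne {a b c : Colour} (h : c ≠ a) (h' : c ≠ b) : a = b := by
  cases a <;> cases b <;> cases c <;> first | rfl | exact absurd rfl h | exact absurd rfl h'

/-- Standard arch systems with the same arches are equal. -/
theorem eq_of_same_arches (hv : IsQuarterPlaneLoop v) (hlen : v.length = w.length)
    (hsv : IsStandard v) (hsw : IsStandard w)
    (h : ∀ A : Arch v, ∃ B : Arch w, B.left = A.left ∧ B.right = A.right)
    (h' : ∀ A : Arch w, ∃ B : Arch v, B.left = A.left ∧ B.right = A.right) : v = w := by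
  choose f hfl hfr using h
  choose g hgl hgr using h'
  have hadj : ∀ {A B}, (archGraph v).Adj A B → (archGraph w).Adj (f A) (f B) := by
    intro A B hAB
    rw [Arch.adj_iff] at hAB ⊢
    rwa [hfl, hfl, hfr, hfr]
  have hadj' : ∀ {A B}, (archGraph w).Adj A B → (archGraph v).Adj (g A) (g B) := by
    intro A B hAB
    rw [Arch.adj_iff] at hAB ⊢
    rwa [hgl, hgl, hgr, hgr]
  -- The two words have the same crossing graph. In each component the first arch is red for both,
  -- and colours alternate along crossings.
  have hcol : ∀ A, A.colour = (f A).colour := by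
    intro A
    obtain ⟨F, ⟨p⟩, hF⟩ := exists_first_in_component A
    have h1 := hsv F hF
    have h2 : (f F).colour = Colour.red := by
      refine hsw _ fun B hB => ?_
      have h3 : (archGraph v).Reachable (g (f F)) (g B) := hB.map ⟨g, hadj'⟩
      rw [Arch.eq_of_left (show (g (f F)).left = F.left by rw [hgl, hfl])] at h3
      rw [hfl, ← hgl]
      exact hF _ h3
    have h3 : F.colour = (f F).colour := h1.trans h2.symm
    clear h1 h2 hF
    induction p with
    | nil => exact h3
    | cons hAB p ih =>
      refine ih ?_
      have h4 := Arch.colour_ne_of_adj hAB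
      have h5 := Arch.colour_ne_of_adj (hadj hAB)
      rw [← h3] at h5
      exact Colour.eq_of_ne_of_ne h4 h5
  refine List.ext_getElem? fun m => ?_
  by_cases hm : m < v.length
  · obtain ⟨A, rfl | rfl⟩ := exists_arch_at hv hm
    · rw [A.getElem_left, ← hfl, (f A).getElem_left, hcol]
    · rw [A.getElem_right, ← hfr, (f A).getElem_right, hcol]
  · rw [List.getElem?_eq_none (by omega), List.getElem?_eq_none (by omega)]

theorem eq_of_run_eq {α : Type} {l m : List α} (hl : l.Nodup) (hm : m.Nodup)
    (h : run v (initialState l) = some (finalState m))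
    (h' : run w (initialState l) = some (finalState m)) (hcv : corners v = 0) (hcw : corners w = 0)
    (hsv : IsStandard v) (hsw : IsStandard w) : v = w := by
  have hv := isQuarterPlaneLoop_of_run h
  have hw := isQuarterPlaneLoop_of_run h'
  have hd : (initialState l).contents.Nodup := by
    simpa [MachineState.contents, initialState] using hl
  have e := map_isInput_eq hcv hcw h h' (stack_finalState m) (stack_finalState m) rfl rfl rfl rfl
    rfl hd hd
  exact eq_of_same_arches hv.1 (hv.2.trans hw.2.symm) hsv hsw
    (Arch.exists_same_ends hm hw.1 h h' e) (Arch.exists_same_ends hm hv.1 h' h e.symm)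

end Uniqueness

/-- The order matters: corners are removed first, because the passage to a standard word keeps the
number of corners. -/
theorem exists_canonical_word {n : ℕ} {π : Equiv.Perm (Fin n)} (h : IsAchievable π) :
    ∃ w, run w (initialState (List.finRange n)) = some (finalState (List.ofFn π).reverse) ∧
      corners w = 0 ∧ IsStandard w := by
  obtain ⟨w, hw⟩ := h
  obtain ⟨v, hv, hc⟩ := exists_corner_free hw
  obtain ⟨u, h1, h2, h3⟩ := exists_standard (α := Fin n) (isQuarterPlaneLoop_of_run hv).1
  exact ⟨u, by rw [← h1.run_eq]; exact hv, by rw [← h1.corners_eq, hc], h3⟩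

theorem exists_perm_of_loop {n : ℕ} {w : List Step} (hw : IsQuarterPlaneLoop w)
    (hl : w.length = 2 * n) : ∃ π : Equiv.Perm (Fin n),
      run w (initialState (List.finRange n)) = some (finalState (List.ofFn π).reverse) := by
  obtain ⟨m, h1, h2⟩ := exists_run_of_isQuarterPlaneLoop hw (l := List.finRange n) (by simpa using hl)
  have h3 : m.reverse.length = n := by rw [List.length_reverse, h2.length_eq, List.length_finRange]
  have h4 : m.reverse.Nodup := by
    rw [List.nodup_reverse, h2.nodup_iff]; exact List.nodup_finRange n
  have h5 : Function.Injective fun i : Fin n => m.reverse.get (i.cast h3.symm) := fun i j hij => by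
    simpa using (List.nodup_iff_injective_get.1 h4) hij
  refine ⟨Equiv.ofBijective _ (Finite.injective_iff_bijective.1 h5), ?_⟩
  rw [h1]
  congr 2
  rw [← List.reverse_eq_iff]
  refine List.ext_getElem (by simpa using h3) fun i hi hi' => ?_
  simp

/-- The permutations produced by two parallel stacks correspond to the standard arch systems
without left-right pairs. -/
theorem card_achievable (n : ℕ) : {π : Equiv.Perm (Fin n) | IsAchievable π}.ncard =
    Nat.card {w : {w : List Step | IsQuarterPlaneLoop w ∧ IsStandard w} //
      wordWeight w = Finsupp.single 1 n} := by
  choose f hf1 hf2 hf3 using @exists_canonical_word n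
  refine Nat.card_eq_of_bijective (fun π => ⟨⟨f π.2, (isQuarterPlaneLoop_of_run (hf1 π.2)).1,
    hf3 π.2⟩, ?_⟩) ⟨?_, ?_⟩
  · have := (isQuarterPlaneLoop_of_run (hf1 π.2)).2
    rw [List.length_finRange] at this
    refine finsupp_fin_two_ext ?_ ?_
    · rw [wordWeight_zero, hf2]; simp
    · rw [wordWeight_one, this]; simp
  · intro π ρ h
    have h1 : f π.2 = f ρ.2 := Subtype.ext_iff.1 (Subtype.ext_iff.1 h)
    have h2 := hf1 π.2
    rw [h1, hf1 ρ.2] at h2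
    simp only [finalState, Option.some_inj, MachineState.mk.injEq, true_and,
      List.reverse_inj] at h2
    exact Subtype.ext (DFunLike.coe_injective (List.ofFn_injective h2)).symm
  -- Surjectivity: `w` produces some permutation, whose chosen word must be `w` by uniqueness of
  -- canonical words.
  · rintro ⟨⟨w, hw, hs⟩, hwt⟩
    have h0 := DFunLike.congr_fun hwt 0
    have h1 := DFunLike.congr_fun hwt 1
    rw [wordWeight_zero] at h0
    rw [wordWeight_one, Finsupp.single_eq_same] at h1
    have h2 := hw.two_mul_half
    simp only at h0 h1
    obtain ⟨π, hπ⟩ := exists_perm_of_loop (n := n) hw (by omega)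
    have hach : IsAchievable π := ⟨w, hπ⟩
    refine ⟨⟨π, hach⟩, Subtype.ext (Subtype.ext ?_)⟩
    refine eq_of_run_eq (List.nodup_finRange n) ?_ (hf1 hach) hπ (hf2 hach) (by simpa using h0)
      (hf3 hach) hs
    rw [List.nodup_reverse]
    exact List.nodup_ofFn.2 π.injective

/-! ### The kernel equation -/

section Kernel

variable {K : Type*} [Field K]

/-- The weight of a quarter plane walk, and `0` for other words. -/
noncomputable def walkWeight (K : Type*) [Field K] (w : List Step) : MvPolynomial (Fin 3) K :=
  open scoped Classical in
  if IsQuarterPlane w then MvPolynomial.X 0 ^ corners w * MvPolynomial.X 1 ^ (xCoord w).toNat *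
    MvPolynomial.X 2 ^ (yCoord w).toNat else 0

theorem coeff_walkSeries (n : ℕ) :
    PowerSeries.coeff n (walkSeries K) = ∑ w : List.Vector Step n, walkWeight K w.toList := by
  classical
  rw [walkSeries, PowerSeries.coeff_mk, quarterPlaneWalks, Finset.sum_filter]
  refine Finset.sum_congr rfl fun w _ => ?_
  rw [walkWeight]

/-- Appending a letter. -/
def vectorSnoc {n : ℕ} (p : List.Vector Step n × Step) : List.Vector Step (n + 1) :=
  ⟨p.1.toList ++ [p.2], by simp⟩

theorem vectorSnoc_bijective (n : ℕ) :
    Function.Bijective (vectorSnoc : List.Vector Step n × Step → _) := by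
  refine (Fintype.bijective_iff_injective_and_card _).2 ⟨?_, ?_⟩
  · rintro ⟨v, s⟩ ⟨w, t⟩ h
    have h1 : v.toList ++ [s] = w.toList ++ [t] := congrArg List.Vector.toList h
    obtain ⟨h2, h3⟩ := List.append_inj' h1 rfl
    exact Prod.ext (List.Vector.eq _ _ h2) (List.cons.inj h3).1
  · simp [pow_succ]

theorem sum_vector_succ {M : Type*} [AddCommMonoid M] {n : ℕ} (f : List Step → M) :
    ∑ w : List.Vector Step (n + 1), f w.toList = ∑ w : List.Vector Step n,
      (f (w.toList ++ [E]) + f (w.toList ++ [N]) + f (w.toList ++ [W]) + f (w.toList ++ [S])) := by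
  rw [← (vectorSnoc_bijective n).sum_comp fun w => f w.toList, Fintype.sum_prod_type]
  refine Finset.sum_congr rfl fun w _ => ?_
  have : (Finset.univ : Finset Step) = {E, N, W, S} := rfl
  rw [this, Finset.sum_insert (by simp), Finset.sum_insert (by simp), Finset.sum_insert (by simp),
    Finset.sum_singleton]
  simp only [vectorSnoc, List.Vector.toList_mk, add_assoc]

theorem sum_vector_zero {M : Type*} [AddCommMonoid M] (f : List Step → M) :
    ∑ w : List.Vector Step 0, f w.toList = f [] := by
  have : (Finset.univ : Finset (List.Vector Step 0)) = {List.Vector.nil} := by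
    ext w; simp [List.Vector.eq_nil]
  rw [this, Finset.sum_singleton]; rfl

/-! ### Appending one step to a walk -/

theorem staysAbove_snoc {k : ℤ} {c : Colour} {w : List Step} {s : Step} :
    StaysAbove k c (w ++ [s]) ↔ StaysAbove k c w ∧ k ≤ stackHeight c (w ++ [s]) := by
  refine ⟨fun h => ⟨(staysAbove_append.1 h).1, h.le⟩, fun h p hp => ?_⟩
  rcases List.prefix_concat_iff.1 hp with rfl | hp
  exacts [h.2, h.1 p hp]

theorem isQuarterPlane_snoc {w : List Step} {s : Step} : IsQuarterPlane (w ++ [s]) ↔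
    IsQuarterPlane w ∧ 0 ≤ xCoord (w ++ [s]) ∧ 0 ≤ yCoord (w ++ [s]) := by
  rw [isQuarterPlane_iff, isQuarterPlane_iff]
  simp only [staysAbove_snoc, forall_and]
  refine and_congr_right fun _ => ⟨fun h => ⟨h .red, h .blue⟩, fun h => ?_⟩
  rintro (_ | _)
  exacts [h.1, h.2]

theorem corners_snoc_of_isInput {s : Step} (hs : IsInput s) (w : List Step) :
    corners (w ++ [s]) = corners w := by
  induction w with
  | nil => rfl
  | cons t w ih =>
    rw [List.cons_append, corners_cons, corners_cons, ih]
    cases w with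
    | nil => simp [cornerHead_eq_zero_of_isInput hs]; simp [cornerHead]
    | cons r w => rfl

theorem corners_snoc_W (w : List Step) :
    corners (w ++ [W]) = corners w + if w.getLast? = some N then 1 else 0 := by
  induction w with
  | nil => rfl
  | cons t w ih =>
    rw [List.cons_append, corners_cons, corners_cons, ih]
    cases w with
    | nil => cases t <;> simp [cornerHead, corners]
    | cons r w => simp [cornerHead, add_assoc]

theorem corners_snoc_S (w : List Step) :
    corners (w ++ [S]) = corners w + if w.getLast? = some E then 1 else 0 := by
  induction w with
  | nil => rfl
  | cons t w ih =>
    rw [List.cons_append, corners_cons, corners_cons, ih]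
    cases w with
    | nil => cases t <;> simp [cornerHead, corners]
    | cons r w => simp [cornerHead, add_assoc]

theorem walkWeight_nil : walkWeight K [] = 1 := by
  have : IsQuarterPlane [] := isQuarterPlaneLoop_nil.1
  simp [walkWeight, this, corners, xCoord, yCoord]

theorem walkWeight_snoc_E (w : List Step) :
    walkWeight K (w ++ [E]) = MvPolynomial.X 1 * walkWeight K w := by
  unfold walkWeight
  by_cases h : IsQuarterPlane w
  · have h1 := h w (List.prefix_refl w)
    have hx : xCoord (w ++ [E]) = xCoord w + 1 := by simp [xCoord]; ring
    have hy : yCoord (w ++ [E]) = yCoord w := by simp [yCoord]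
    rw [if_pos h, if_pos (isQuarterPlane_snoc.2 ⟨h, by omega, by omega⟩),
      corners_snoc_of_isInput (.inl rfl), hx, hy, Int.toNat_add h1.1 zero_le_one]
    simp only [Int.toNat_one]
    ring
  · rw [if_neg h, if_neg fun h' => h (isQuarterPlane_snoc.1 h').1, mul_zero]

theorem walkWeight_snoc_N (w : List Step) :
    walkWeight K (w ++ [N]) = MvPolynomial.X 2 * walkWeight K w := by
  unfold walkWeight
  by_cases h : IsQuarterPlane w
  · have h1 := h w (List.prefix_refl w)
    have hx : xCoord (w ++ [N]) = xCoord w := by simp [xCoord]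
    have hy : yCoord (w ++ [N]) = yCoord w + 1 := by simp [yCoord]; ring
    rw [if_pos h, if_pos (isQuarterPlane_snoc.2 ⟨h, by omega, by omega⟩),
      corners_snoc_of_isInput (.inr rfl), hx, hy, Int.toNat_add h1.2 zero_le_one]
    simp only [Int.toNat_one]
    ring
  · rw [if_neg h, if_neg fun h' => h (isQuarterPlane_snoc.1 h').1, mul_zero]

/-- The weight of a quarter plane walk that does not end on the ordinate axis. -/
noncomputable def walkWeightX (K : Type*) [Field K] (w : List Step) : MvPolynomial (Fin 3) K :=
  if xCoord w = 0 then 0 else walkWeight K w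

/-- The weight of a quarter plane walk that does not end on the abscissa axis. -/
noncomputable def walkWeightY (K : Type*) [Field K] (w : List Step) : MvPolynomial (Fin 3) K :=
  if yCoord w = 0 then 0 else walkWeight K w

/-- Multiplying by `x` avoids the division by `x`. The step is allowed only off the ordinate axis,
and it creates a corner, a factor `a = 1 + (a - 1)`, when the last step was `N`. -/
theorem walkWeight_snoc_W (w : List Step) :
    MvPolynomial.X 1 * walkWeight K (w ++ [W]) = walkWeightX K w +
      (MvPolynomial.X 0 - 1) * if w.getLast? = some N then walkWeightX K w else 0 := by
  unfold walkWeightX walkWeight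
  by_cases h : IsQuarterPlane w
  · have h1 := h w (List.prefix_refl w)
    have hx : xCoord (w ++ [W]) = xCoord w - 1 := by simp [xCoord]; ring
    have hy : yCoord (w ++ [W]) = yCoord w := by simp [yCoord]
    by_cases h0 : xCoord w = 0
    · rw [if_neg fun h' => by have := (isQuarterPlane_snoc.1 h').2.1; omega]
      simp [h0]
    · obtain ⟨k, hk⟩ : ∃ k : ℕ, xCoord w = k + 1 := ⟨(xCoord w - 1).toNat, by omega⟩
      rw [if_pos h, if_pos (isQuarterPlane_snoc.2 ⟨h, by omega, by omega⟩), if_neg h0, hx, hy, hk,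
        corners_snoc_W, show ((k : ℤ) + 1 - 1).toNat = k by omega,
        show ((k : ℤ) + 1).toNat = k + 1 by omega]
      split_ifs <;> ring
  · rw [if_neg h, if_neg fun h' => h (isQuarterPlane_snoc.1 h').1]
    simp

theorem walkWeight_snoc_S (w : List Step) :
    MvPolynomial.X 2 * walkWeight K (w ++ [S]) = walkWeightY K w +
      (MvPolynomial.X 0 - 1) * if w.getLast? = some E then walkWeightY K w else 0 := by
  unfold walkWeightY walkWeight
  by_cases h : IsQuarterPlane w
  · have h1 := h w (List.prefix_refl w)
    have hx : xCoord (w ++ [S]) = xCoord w := by simp [xCoord]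
    have hy : yCoord (w ++ [S]) = yCoord w - 1 := by simp [yCoord]; ring
    by_cases h0 : yCoord w = 0
    · rw [if_neg fun h' => by have := (isQuarterPlane_snoc.1 h').2.2; omega]
      simp [h0]
    · obtain ⟨k, hk⟩ : ∃ k : ℕ, yCoord w = k + 1 := ⟨(yCoord w - 1).toNat, by omega⟩
      rw [if_pos h, if_pos (isQuarterPlane_snoc.2 ⟨h, by omega, by omega⟩), if_neg h0, hx, hy, hk,
        corners_snoc_S, show ((k : ℤ) + 1 - 1).toNat = k by omega,
        show ((k : ℤ) + 1).toNat = k + 1 by omega]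
      split_ifs <;> ring
  · rw [if_neg h, if_neg fun h' => h (isQuarterPlane_snoc.1 h').1]
    simp

variable (K) in
/-- The specialisation `x = 0`. -/
noncomputable def setXZero : MvPolynomial (Fin 3) K →+* MvPolynomial (Fin 3) K :=
  (MvPolynomial.aeval ![MvPolynomial.X 0, 0, MvPolynomial.X 2]).toRingHom

variable (K) in
/-- The specialisation `y = 0`. -/
noncomputable def setYZero : MvPolynomial (Fin 3) K →+* MvPolynomial (Fin 3) K :=
  (MvPolynomial.aeval ![MvPolynomial.X 0, MvPolynomial.X 1, 0]).toRingHom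

/-- Setting `x = 0` keeps the weight of a walk that ends on the ordinate axis and kills all others.
-/
theorem walkWeightX_eq (w : List Step) :
    walkWeightX K w = walkWeight K w - setXZero K (walkWeight K w) := by
  unfold walkWeightX walkWeight setXZero
  by_cases h : IsQuarterPlane w
  · have h1 := h w (List.prefix_refl w)
    by_cases h0 : xCoord w = 0
    · simp [h, h0]
    · have : (xCoord w).toNat ≠ 0 := by omega
      simp [h, h0, this]
  · simp [h]

theorem walkWeightY_eq (w : List Step) :
    walkWeightY K w = walkWeight K w - setYZero K (walkWeight K w) := by
  unfold walkWeightY walkWeight setYZero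
  by_cases h : IsQuarterPlane w
  · have h1 := h w (List.prefix_refl w)
    by_cases h0 : yCoord w = 0
    · simp [h, h0]
    · have : (yCoord w).toNat ≠ 0 := by omega
      simp [h, h0, this]
  · simp [h]

/-- A step `N` does not change the abscissa. So the correction for walks that end with `N` is
expressed by walks one step shorter, which is why the recursion has order two. -/
theorem walkWeightX_snoc_N (w : List Step) :
    walkWeightX K (w ++ [N]) = MvPolynomial.X 2 * walkWeightX K w := by
  have hx : xCoord (w ++ [N]) = xCoord w := by simp [xCoord]
  simp only [walkWeightX, hx, walkWeight_snoc_N, mul_ite, mul_zero]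

theorem walkWeightY_snoc_E (w : List Step) :
    walkWeightY K (w ++ [E]) = MvPolynomial.X 1 * walkWeightY K w := by
  have hy : yCoord (w ++ [E]) = yCoord w := by simp [yCoord]
  simp only [walkWeightY, hy, walkWeight_snoc_E, mul_ite, mul_zero]

/-- The part of a coefficient of `F` that vanishes under the specialisation `φ`. -/
noncomputable def stepPart (φ : MvPolynomial (Fin 3) K →+* MvPolynomial (Fin 3) K)
    (F : PowerSeries (MvPolynomial (Fin 3) K)) (n : ℕ) : MvPolynomial (Fin 3) K :=
  PowerSeries.coeff n F - φ (PowerSeries.coeff n F)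

/-- The recursion obtained by removing the last step of a walk. -/
structure WalkRecursion (F : PowerSeries (MvPolynomial (Fin 3) K)) : Prop where
  zero : PowerSeries.coeff 0 F = 1
  one : MvPolynomial.X 1 * MvPolynomial.X 2 * PowerSeries.coeff 1 F =
    MvPolynomial.X 1 * MvPolynomial.X 2 * (MvPolynomial.X 1 + MvPolynomial.X 2) *
      PowerSeries.coeff 0 F + MvPolynomial.X 2 * stepPart (setXZero K) F 0 +
      MvPolynomial.X 1 * stepPart (setYZero K) F 0
  add_two : ∀ n, MvPolynomial.X 1 * MvPolynomial.X 2 * PowerSeries.coeff (n + 2) F =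
    MvPolynomial.X 1 * MvPolynomial.X 2 * (MvPolynomial.X 1 + MvPolynomial.X 2) *
      PowerSeries.coeff (n + 1) F + MvPolynomial.X 2 * stepPart (setXZero K) F (n + 1) +
      MvPolynomial.X 1 * stepPart (setYZero K) F (n + 1) +
      (MvPolynomial.X 0 - 1) * (MvPolynomial.X 2 ^ 2 * stepPart (setXZero K) F n +
        MvPolynomial.X 1 ^ 2 * stepPart (setYZero K) F n)

theorem stepPart_walkSeries_setXZero (n : ℕ) : stepPart (setXZero K) (walkSeries K) n =
    ∑ w : List.Vector Step n, walkWeightX K w.toList := by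
  simp only [stepPart, coeff_walkSeries, map_sum, ← Finset.sum_sub_distrib, walkWeightX_eq]

theorem stepPart_walkSeries_setYZero (n : ℕ) : stepPart (setYZero K) (walkSeries K) n =
    ∑ w : List.Vector Step n, walkWeightY K w.toList := by
  simp only [stepPart, coeff_walkSeries, map_sum, ← Finset.sum_sub_distrib, walkWeightY_eq]

theorem coeff_walkSeries_succ (n : ℕ) :
    MvPolynomial.X 1 * MvPolynomial.X 2 * PowerSeries.coeff (n + 1) (walkSeries K) =
      MvPolynomial.X 1 * MvPolynomial.X 2 * (MvPolynomial.X 1 + MvPolynomial.X 2) *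
      PowerSeries.coeff n (walkSeries K) + MvPolynomial.X 2 * stepPart (setXZero K) (walkSeries K) n +
      MvPolynomial.X 1 * stepPart (setYZero K) (walkSeries K) n + (MvPolynomial.X 0 - 1) *
        (MvPolynomial.X 2 * (∑ w : List.Vector Step n,
            if w.toList.getLast? = some N then walkWeightX K w.toList else 0) +
          MvPolynomial.X 1 * ∑ w : List.Vector Step n,
            if w.toList.getLast? = some E then walkWeightY K w.toList else 0) := by
  rw [coeff_walkSeries, coeff_walkSeries, sum_vector_succ, stepPart_walkSeries_setXZero,
    stepPart_walkSeries_setYZero]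
  simp only [Finset.mul_sum, ← Finset.sum_add_distrib]
  refine Finset.sum_congr rfl fun w _ => ?_
  rw [walkWeight_snoc_E, walkWeight_snoc_N]
  linear_combination MvPolynomial.X 2 * walkWeight_snoc_W (K := K) w.toList +
    MvPolynomial.X 1 * walkWeight_snoc_S (K := K) w.toList

theorem walkRecursion_walkSeries : WalkRecursion (walkSeries K) where
  zero := by rw [coeff_walkSeries, sum_vector_zero, walkWeight_nil]
  one := by
    rw [coeff_walkSeries_succ,
      sum_vector_zero fun w => if w.getLast? = some N then walkWeightX K w else 0,
      sum_vector_zero fun w => if w.getLast? = some E then walkWeightY K w else 0]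
    simp
  add_two n := by
    have hlast : ∀ (w : List Step) (s : Step), (w ++ [s]).getLast? = some s := by simp
    rw [coeff_walkSeries_succ, stepPart_walkSeries_setXZero, stepPart_walkSeries_setYZero,
      stepPart_walkSeries_setXZero n, stepPart_walkSeries_setYZero n,
      sum_vector_succ fun w => if w.getLast? = some N then walkWeightX K w else 0,
      sum_vector_succ fun w => if w.getLast? = some E then walkWeightY K w else 0]
    simp only [hlast, Option.some.injEq, reduceCtorEq, if_true, if_false, add_zero, zero_add,
      walkWeightX_snoc_N, walkWeightY_snoc_E, ← Finset.mul_sum]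
    ring

theorem WalkRecursion.unique {F G : PowerSeries (MvPolynomial (Fin 3) K)} (hF : WalkRecursion F)
    (hG : WalkRecursion G) : F = G := by
  have hne : (MvPolynomial.X 1 * MvPolynomial.X 2 : MvPolynomial (Fin 3) K) ≠ 0 :=
    mul_ne_zero (MvPolynomial.X_ne_zero _) (MvPolynomial.X_ne_zero _)
  have key : ∀ n, PowerSeries.coeff n F = PowerSeries.coeff n G ∧
      PowerSeries.coeff (n + 1) F = PowerSeries.coeff (n + 1) G := by
    intro n
    induction n with
    | zero =>
      have h0 : PowerSeries.coeff 0 F = PowerSeries.coeff 0 G := hF.zero.trans hG.zero.symm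
      refine ⟨h0, mul_left_cancel₀ hne ?_⟩
      rw [hF.one, hG.one]
      simp only [stepPart, h0]
    | succ n ih =>
      refine ⟨ih.2, mul_left_cancel₀ hne ?_⟩
      rw [hF.add_two, hG.add_two]
      simp only [stepPart, ih.1, ih.2]
  ext1 n
  exact (key n).1

/-! ### From the recursion to the kernel equation -/

theorem eq_one_add_X_mul_iff {R : Type*} [CommRing R] (F G H : PowerSeries R) :
    F = 1 + PowerSeries.X * G + PowerSeries.X * (PowerSeries.X * H) ↔
      PowerSeries.coeff 0 F = 1 ∧ PowerSeries.coeff 1 F = PowerSeries.coeff 0 G ∧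
        ∀ n, PowerSeries.coeff (n + 2) F = PowerSeries.coeff (n + 1) G + PowerSeries.coeff n H := by
  have h0 : PowerSeries.coeff 0 (1 + PowerSeries.X * G + PowerSeries.X * (PowerSeries.X * H)) =
      1 := by simp
  have h1 : PowerSeries.coeff 1 (1 + PowerSeries.X * G + PowerSeries.X * (PowerSeries.X * H)) =
      PowerSeries.coeff 0 G := by
    rw [map_add, map_add, PowerSeries.coeff_succ_X_mul, PowerSeries.coeff_succ_X_mul,
      PowerSeries.coeff_zero_X_mul]
    simp [PowerSeries.coeff_one]
  have h2 : ∀ n, PowerSeries.coeff (n + 2)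
      (1 + PowerSeries.X * G + PowerSeries.X * (PowerSeries.X * H)) =
        PowerSeries.coeff (n + 1) G + PowerSeries.coeff n H := fun n => by
    rw [map_add, map_add, PowerSeries.coeff_succ_X_mul, PowerSeries.coeff_succ_X_mul,
      PowerSeries.coeff_succ_X_mul]
    simp [PowerSeries.coeff_one]
  constructor
  · intro h
    rw [h]
    exact ⟨h0, h1, h2⟩
  · rintro ⟨k0, k1, k2⟩
    ext n
    match n with
    | 0 => rw [k0, h0]
    | 1 => rw [k1, h1]
    | n + 2 => rw [k2, h2]

/-- The recursion is the kernel equation read coefficient by coefficient in `u`, multiplied by `xy`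
so that it lives in the polynomial ring, which embeds in its fraction field. -/
theorem kernelEquation_iff (F : PowerSeries (MvPolynomial (Fin 3) K)) :
    KernelEquation F ↔ WalkRecursion F := by
  set ι : MvPolynomial (Fin 3) K →+* FractionRing (MvPolynomial (Fin 3) K) := algebraMap _ _
  have hinj : Function.Injective ι := IsFractionRing.injective (MvPolynomial (Fin 3) K) _
  set a := ι (MvPolynomial.X 0) with ha
  set x := ι (MvPolynomial.X 1) with hx
  set y := ι (MvPolynomial.X 2) with hy
  have hx0 : x ≠ 0 := (map_ne_zero_iff ι hinj).2 (MvPolynomial.X_ne_zero _)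
  have hy0 : y ≠ 0 := (map_ne_zero_iff ι hinj).2 (MvPolynomial.X_ne_zero _)
  have key : KernelEquation F ↔ F.map ι = 1 + PowerSeries.X *
      (PowerSeries.C (x + x⁻¹ + y + y⁻¹) * F.map ι -
        PowerSeries.C y⁻¹ * (F.map (setYZero K)).map ι -
        PowerSeries.C x⁻¹ * (F.map (setXZero K)).map ι) + PowerSeries.X * (PowerSeries.X *
      (PowerSeries.C ((a - 1) * (x * y⁻¹ + y * x⁻¹)) * F.map ι -
        PowerSeries.C ((a - 1) * (x * y⁻¹)) * (F.map (setYZero K)).map ι -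
        PowerSeries.C ((a - 1) * (y * x⁻¹)) * (F.map (setXZero K)).map ι)) := by
    have e : KernelEquation F ↔ (1 - PowerSeries.X * (PowerSeries.C x + PowerSeries.C x⁻¹ +
        PowerSeries.C y + PowerSeries.C y⁻¹) - PowerSeries.X ^ 2 * (PowerSeries.C a - 1) *
        (PowerSeries.C x * PowerSeries.C y⁻¹ + PowerSeries.C y * PowerSeries.C x⁻¹)) * F.map ι =
        1 - PowerSeries.X * PowerSeries.C y⁻¹ * (1 + PowerSeries.X * PowerSeries.C x *
        (PowerSeries.C a - 1)) * (F.map (setYZero K)).map ι - PowerSeries.X * PowerSeries.C x⁻¹ *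
        (1 + PowerSeries.X * PowerSeries.C y * (PowerSeries.C a - 1)) *
        (F.map (setXZero K)).map ι := Iff.rfl
    rw [e]
    simp only [map_add, map_mul, map_sub, map_one]
    constructor <;> intro h <;> linear_combination h
  rw [key, eq_one_add_X_mul_iff]
  simp only [map_sub, PowerSeries.coeff_C_mul, PowerSeries.coeff_map]
  have h0 : ι (PowerSeries.coeff 0 F) = 1 ↔ PowerSeries.coeff 0 F = 1 := by
    rw [← map_one ι, hinj.eq_iff]
  have hxy : x * y ≠ 0 := mul_ne_zero hx0 hy0
  constructor
  · rintro ⟨k0, k1, k2⟩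
    refine ⟨h0.1 k0, hinj ?_, fun n => hinj ?_⟩
    · simp only [stepPart, map_mul, map_add, map_sub, ← hx, ← hy]
      rw [k1]
      field_simp
      ring
    · simp only [stepPart, map_mul, map_add, map_sub, map_pow, map_one, ← ha, ← hx, ← hy]
      rw [k2]
      field_simp
      ring
  · rintro ⟨k0, k1, k2⟩
    refine ⟨h0.2 k0, mul_left_cancel₀ hxy ?_, fun n => mul_left_cancel₀ hxy ?_⟩
    · have := congrArg ι k1
      simp only [stepPart, map_mul, map_add, map_sub, ← hx, ← hy] at this
      rw [this]
      field_simp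
      ring
    · have := congrArg ι (k2 n)
      simp only [stepPart, map_mul, map_add, map_sub, map_pow, map_one, ← ha, ← hx, ← hy] at this
      rw [this]
      field_simp
      ring

theorem kernelEquation_iff_eq (F : PowerSeries (MvPolynomial (Fin 3) K)) :
    KernelEquation F ↔ F = walkSeries K := by
  rw [kernelEquation_iff]
  exact ⟨fun h => h.unique walkRecursion_walkSeries, fun h => h ▸ walkRecursion_walkSeries⟩

/-! ### Walks that end at the origin -/

theorem composable_of_constantCoeff {τ : Type*} (F : MvPowerSeries (Fin 2) K)
    {B V : MvPowerSeries τ K} (hB : MvPowerSeries.constantCoeff B = 0)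
    (hV : MvPowerSeries.constantCoeff V = 0) : Composable F B V := by
  have h : MvPowerSeries.HasSubst ![B, V] :=
    MvPowerSeries.hasSubst_of_constantCoeff_zero (by simp [Fin.forall_fin_two, hB, hV])
  intro e
  have := MvPowerSeries.coeff_subst_finite h F e
  refine Set.Finite.subset this fun d hd => ?_
  rw [Function.mem_support] at hd ⊢
  rwa [Finsupp.prod_fintype _ _ (by simp), smul_eq_mul, Fin.prod_univ_two]

theorem coeff_atOrigin (e : Fin 2 →₀ ℕ) : MvPowerSeries.coeff e (atOrigin (walkSeries K)) =
    (({w : List Step | w.length = e 1 ∧ IsQuarterPlaneLoop w ∧ corners w = e 0}.ncard : ℕ) : K) := by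
  classical
  change (MvPolynomial.aeval ![(Polynomial.X : Polynomial K), 0, 0]
    (PowerSeries.coeff (e 1) (walkSeries K))).coeff (e 0) = _
  rw [coeff_walkSeries, map_sum, Polynomial.finsetSum_coeff]
  have h1 : ∀ w : List.Vector Step (e 1), (MvPolynomial.aeval ![(Polynomial.X : Polynomial K), 0, 0]
      (walkWeight K w.toList)).coeff (e 0) =
        if IsQuarterPlaneLoop w.toList ∧ corners w.toList = e 0 then 1 else 0 := by
    intro w
    unfold walkWeight
    by_cases h : IsQuarterPlane w.toList
    · have h2 := h _ (List.prefix_refl _)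
      have h3 : IsQuarterPlaneLoop w.toList ↔
          (xCoord w.toList).toNat = 0 ∧ (yCoord w.toList).toNat = 0 := by
        unfold IsQuarterPlaneLoop
        simp only [h, true_and]
        omega
      rw [if_pos h, h3]
      by_cases hx : (xCoord w.toList).toNat = 0 <;> by_cases hy : (yCoord w.toList).toNat = 0 <;>
        simp [hx, hy, Polynomial.coeff_X_pow, eq_comm]
    · rw [if_neg h, if_neg fun h' => h h'.1.1]
      simp
  simp only [h1]
  rw [Finset.sum_boole]
  congr 1
  rw [← Fintype.card_subtype, ← Nat.card_eq_fintype_card]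
  exact Nat.card_congr ⟨fun w => ⟨w.1.toList, w.1.2, w.2⟩, fun w => ⟨⟨w.1, w.2.1⟩, w.2.2⟩,
    fun w => rfl, fun w => rfl⟩

/-- Loops have even length, so nothing is lost at odd powers of `u`; at an even power exactly one
monomial of `Q(a,u)` contributes. -/
theorem comp_loopSeries_eq_atOrigin :
    comp (loopSeries K) (MvPowerSeries.X 0 : MvPowerSeries (Fin 2) K) (MvPowerSeries.X 1 ^ 2) =
      atOrigin (walkSeries K) := by
  classical
  ext e
  rw [coeff_atOrigin]
  change ∑ᶠ d : Fin 2 →₀ ℕ, MvPowerSeries.coeff d (loopSeries K) * MvPowerSeries.coeff e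
    (MvPowerSeries.X 0 ^ d 0 * (MvPowerSeries.X 1 ^ 2) ^ d 1) = _
  have h1 : ∀ d : Fin 2 →₀ ℕ, MvPowerSeries.coeff e
      (MvPowerSeries.X 0 ^ d 0 * (MvPowerSeries.X 1 ^ 2) ^ d 1 : MvPowerSeries (Fin 2) K) =
        if e 0 = d 0 ∧ e 1 = 2 * d 1 then 1 else 0 := by
    intro d
    rw [← pow_mul, MvPowerSeries.X_pow_eq, MvPowerSeries.X_pow_eq,
      MvPowerSeries.monomial_mul_monomial, MvPowerSeries.coeff_monomial, mul_one]
    congr 1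
    refine propext ⟨?_, fun h => finsupp_fin_two_ext ?_ ?_⟩
    · rintro rfl
      simp
    · simpa using h.1
    · simpa using h.2
  simp only [h1]
  by_cases hpar : ∃ m, e 1 = 2 * m
  · obtain ⟨m, hm⟩ := hpar
    rw [finsum_eq_single _ (Finsupp.single 0 (e 0) + Finsupp.single 1 m : Fin 2 →₀ ℕ)]
    · rw [if_pos (by simp [hm]), mul_one]
      change (({w : List Step | _}.ncard : ℕ) : K) = _
      simp [hm]
    · intro d hd
      rw [if_neg fun h => hd (finsupp_fin_two_ext ?_ ?_), mul_zero]
      · simp [h.1]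
      · have := h.2
        simp; omega
  · have h2 : {w : List Step | w.length = e 1 ∧ IsQuarterPlaneLoop w ∧ corners w = e 0} = ∅ := by
      refine Set.eq_empty_of_forall_notMem fun w hw => hpar ⟨_, hw.1.symm.trans hw.2.1.length_eq⟩
    rw [h2, Set.ncard_empty, Nat.cast_zero]
    refine (finsum_congr fun d => ?_).trans finsum_zero
    rw [if_neg fun h => hpar ⟨_, h.2⟩, mul_zero]

end Kernel

/-! ### Uniqueness of the series of connected arch systems -/

section Connected

variable {K : Type*} [Field K]

theorem hasSubst_pair {τ : Type*} {B V : MvPowerSeries τ K}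
    (hB : MvPowerSeries.constantCoeff B = 0) (hV : MvPowerSeries.constantCoeff V = 0) :
    MvPowerSeries.HasSubst ![B, V] :=
  MvPowerSeries.hasSubst_of_constantCoeff_zero (by simp [Fin.forall_fin_two, hB, hV])

theorem X_dvd_wordSeries_sub_one {T : Set (List Step)} (hT : ∀ w ∈ T, IsQuarterPlaneLoop w)
    (h0 : [] ∈ T) : MvPowerSeries.X 1 ∣ wordSeries K T - 1 := by
  rw [wordSeries_eq_one_add h0, add_sub_cancel_left, MvPowerSeries.X_dvd_iff]
  intro e he
  rw [coeff_weightSeries]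
  have : IsEmpty {w : {w : T // w ≠ ⟨[], h0⟩} // wordWeight w.1 = e} := by
    refine ⟨fun w => w.1.2 (Subtype.ext ?_)⟩
    have h1 := wordWeight_one w.1.1
    rw [w.2, he] at h1
    have h2 := (hT _ w.1.1.2).two_mul_half
    exact List.eq_nil_of_length_eq_zero (by omega)
  simp

/-- Triangular substitutions are injective. -/
theorem comp_injective {B Q : MvPowerSeries (Fin 2) K}
    (hB : MvPowerSeries.X 1 ∣ B - MvPowerSeries.X 0) (hQ : MvPowerSeries.X 1 ∣ Q - 1)
    {F G : MvPowerSeries (Fin 2) K} (h : comp F B (MvPowerSeries.X 1 * Q) =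
      comp G B (MvPowerSeries.X 1 * Q)) : F = G := by
  have hB0 : MvPowerSeries.constantCoeff B = 0 := by
    obtain ⟨D, hD⟩ := hB
    rw [sub_eq_iff_eq_add.1 hD]; simp
  have hsub := hasSubst_pair (B := B) (V := MvPowerSeries.X 1 * Q) hB0 (by simp)
  rw [comp_eq_subst _ _ _ hsub, comp_eq_subst _ _ _ hsub, ← sub_eq_zero,
    ← MvPowerSeries.subst_sub hsub, ← comp_eq_subst _ _ _ hsub] at h
  rw [← sub_eq_zero]
  generalize F - G = H at h
  -- Triangularity: the image of the monomial with exponents `k`, `n` is that monomial itself modulo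
  -- a power of the second variable higher than `n`.
  have hcoeff : ∀ k n (d : Fin 2 →₀ ℕ), d 1 = n →
      MvPowerSeries.coeff d (B ^ k * (MvPowerSeries.X 1 * Q) ^ n) = if d 0 = k then 1 else 0 := by
    classical
    intro k n d hd
    have h1 : MvPowerSeries.X 1 ∣ B ^ k * Q ^ n - MvPowerSeries.X 0 ^ k := by
      have h2 := hB.trans (sub_dvd_pow_sub_pow B (MvPowerSeries.X 0) k)
      have h3 := hQ.trans (sub_dvd_pow_sub_pow Q 1 n)
      rw [one_pow] at h3
      have : B ^ k * Q ^ n - MvPowerSeries.X 0 ^ k =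
        (B ^ k - MvPowerSeries.X 0 ^ k) + B ^ k * (Q ^ n - 1) := by ring
      rw [this]
      exact dvd_add h2 (h3.mul_left _)
    obtain ⟨D, hD⟩ := h1
    have h4 : B ^ k * (MvPowerSeries.X 1 * Q) ^ n =
        MvPowerSeries.X 0 ^ k * MvPowerSeries.X 1 ^ n + MvPowerSeries.X 1 ^ (n + 1) * D := by
      rw [mul_pow]
      linear_combination MvPowerSeries.X 1 ^ n * hD
    rw [h4, map_add, coeff_X_pow_mul_eq_zero (by omega), add_zero, MvPowerSeries.X_pow_eq,
      MvPowerSeries.X_pow_eq, MvPowerSeries.monomial_mul_monomial, MvPowerSeries.coeff_monomial,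
      mul_one]
    congr 1
    refine propext ⟨?_, fun h => finsupp_fin_two_ext ?_ ?_⟩
    · rintro rfl; simp
    · simpa using h
    · simpa using hd
  -- In the coefficient at `d`, terms of lower degree in the second variable vanish by induction,
  -- terms of higher degree do not reach `d`, and in equal degree only `d` itself survives.
  have key : ∀ n (d : Fin 2 →₀ ℕ), d 1 = n → MvPowerSeries.coeff d H = 0 := by
    intro n
    induction n using Nat.strong_induction_on with
    | _ n ih =>
      intro d hd
      have h1 : ∑ᶠ d' : Fin 2 →₀ ℕ, MvPowerSeries.coeff d' H *
          MvPowerSeries.coeff d (B ^ d' 0 * (MvPowerSeries.X 1 * Q) ^ d' 1) = 0 := by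
        have := congrArg (MvPowerSeries.coeff d) h
        rwa [map_zero] at this
      rw [finsum_eq_single _ d, hcoeff _ _ _ rfl, if_pos rfl, mul_one] at h1
      · exact h1
      · intro d' hd'
        rcases lt_trichotomy (d' 1) n with hlt | heq | hlt
        · rw [ih _ hlt d' rfl, zero_mul]
        · rw [hcoeff _ _ _ (hd.trans heq.symm), if_neg, mul_zero]
          exact fun h0 => hd' (finsupp_fin_two_ext h0.symm (heq.trans hd.symm))
        · rw [mul_pow, mul_left_comm, coeff_X_pow_mul_eq_zero (by omega), mul_zero]
  ext d
  rw [key _ d rfl, map_zero]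

theorem constantCoeff_loopSeries : MvPowerSeries.constantCoeff (loopSeries K) = 1 := by
  rw [loopSeries_eq]
  exact constantCoeff_wordSeries (fun w h => h) isQuarterPlaneLoop_nil

theorem constantCoeff_one_sub_mul_inv {Q : MvPowerSeries (Fin 2) K}
    (h : MvPowerSeries.constantCoeff Q = 1) :
    MvPowerSeries.constantCoeff (1 - (1 - MvPowerSeries.X 0) * Q⁻¹) = 0 :=
  constantCoeff_cornerSubst h

theorem loopSeries_eq_one_add_two_mul_comp : loopSeries K = 1 + 2 * comp (connectedSeries K)
    (1 - (1 - MvPowerSeries.X 0) * (loopSeries K)⁻¹) (MvPowerSeries.X 1 * loopSeries K ^ 2) := by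
  have h := wordSeries_eq_one_add_comp (K := K) hereditary_loops
  rw [← loopSeries_eq, wordSeries_simpleLoops_univ, ← connectedSeries_eq, cornerSubst] at h
  have hsub := hasSubst_pair (V := MvPowerSeries.X 1 * loopSeries K ^ 2)
    (constantCoeff_one_sub_mul_inv (constantCoeff_loopSeries (K := K))) (by simp)
  rw [comp_eq_subst _ _ _ hsub] at h ⊢
  rw [two_mul, MvPowerSeries.subst_add hsub, ← two_mul] at h
  exact h

theorem loopSeries_eq_iff [CharZero K] (F : MvPowerSeries (Fin 2) K) :
    loopSeries K = 1 + 2 * comp F (1 - (1 - MvPowerSeries.X 0) * (loopSeries K)⁻¹)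
      (MvPowerSeries.X 1 * loopSeries K ^ 2) ↔ F = connectedSeries K := by
  refine ⟨fun h => ?_, fun h => h ▸ loopSeries_eq_one_add_two_mul_comp⟩
  have h1 := h.symm.trans loopSeries_eq_one_add_two_mul_comp
  -- Characteristic zero is used to cancel the factor 2.
  have h2 : (2 : MvPowerSeries (Fin 2) K) ≠ 0 := fun h0 => by
    have := congrArg MvPowerSeries.constantCoeff h0
    rw [map_ofNat, map_zero] at this
    exact two_ne_zero this
  have hQ : MvPowerSeries.X 1 ∣ loopSeries K - 1 := by
    rw [loopSeries_eq]
    exact X_dvd_wordSeries_sub_one (fun w h => h) isQuarterPlaneLoop_nil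
  refine comp_injective ?_ ?_ (mul_left_cancel₀ h2 (add_left_cancel h1))
  · have h3 := MvPowerSeries.inv_mul_cancel (loopSeries K)
      (by rw [constantCoeff_loopSeries]; exact one_ne_zero)
    have h4 : 1 - (1 - MvPowerSeries.X 0) * (loopSeries K)⁻¹ - MvPowerSeries.X 0 =
        (1 - MvPowerSeries.X 0) * (loopSeries K)⁻¹ * (loopSeries K - 1) := by
      linear_combination (-1 + MvPowerSeries.X 0) * h3
    rw [h4]
    exact hQ.mul_left _
  · simpa using hQ.trans (sub_dvd_pow_sub_pow (loopSeries K) 1 2)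

/-! ### The series of achievable permutations -/

theorem hasSubst_zero_X : MvPowerSeries.HasSubst ![(0 : MvPowerSeries Unit K), PowerSeries.X] :=
  hasSubst_pair (map_zero _) PowerSeries.constantCoeff_X

theorem coeff_subst_zero_X (F : MvPowerSeries (Fin 2) K) (n : ℕ) :
    PowerSeries.coeff n (MvPowerSeries.subst ![(0 : MvPowerSeries Unit K), PowerSeries.X] F) =
      MvPowerSeries.coeff (Finsupp.single 1 n) F := by
  classical
  rw [PowerSeries.coeff, MvPowerSeries.coeff_subst hasSubst_zero_X,
    finsum_eq_single _ (Finsupp.single 1 n : Fin 2 →₀ ℕ)]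
  · rw [Finsupp.prod_fintype _ _ (by simp), Fin.prod_univ_two]
    have := PowerSeries.coeff_X_pow_self (R := K) n
    rw [PowerSeries.coeff] at this
    simp [this]
  · intro d hd
    rw [Finsupp.prod_fintype _ _ (by simp), Fin.prod_univ_two]
    by_cases h0 : d 0 = 0
    · have h1 : n ≠ d 1 := fun h => hd (finsupp_fin_two_ext (by simp [h0]) (by simp [h]))
      have := PowerSeries.coeff_X_pow (R := K) n (d 1)
      rw [PowerSeries.coeff, if_neg h1] at this
      simp [h0, this]
    · simp [h0]

/-- Permutations correspond to standard loops without corners, so their series is the one of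
standard loops at `a = 0`, `u = t`. -/
theorem achievableSeries_eq : achievableSeries K =
    MvPowerSeries.subst ![(0 : MvPowerSeries Unit K), PowerSeries.X]
      (wordSeries K {w | IsQuarterPlaneLoop w ∧ IsStandard w}) := by
  refine PowerSeries.ext fun n => ?_
  rw [coeff_subst_zero_X, achievableSeries, PowerSeries.coeff_mk, card_achievable]
  rfl

theorem constantCoeff_achievableSeries :
    PowerSeries.constantCoeff (achievableSeries K) = 1 := by
  rw [← PowerSeries.coeff_zero_eq_constantCoeff_apply, achievableSeries_eq, coeff_subst_zero_X,
    Finsupp.single_zero, MvPowerSeries.coeff_zero_eq_constantCoeff_apply]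
  exact constantCoeff_wordSeries (fun w h => h.1) hereditary_standard.nil_mem

/-- This is the decomposition equation of the standard loops, specialised at `a = 0`. There both
series of loops and inverses specialise well because the constant term is 1. -/
theorem achievableSeries_eq_one_add_comp : achievableSeries K =
    1 + comp (connectedSeries K) (1 - (achievableSeries K)⁻¹)
      (PowerSeries.X * achievableSeries K ^ 2) := by
  have hQ : MvPowerSeries.constantCoeff
      (wordSeries K {w | IsQuarterPlaneLoop w ∧ IsStandard w}) = 1 :=
    constantCoeff_wordSeries (fun w h => h.1) hereditary_standard.nil_mem
  have h := wordSeries_eq_one_add_comp (K := K) hereditary_standard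
  have hS := achievableSeries_eq (K := K)
  have hS1 := constantCoeff_achievableSeries (K := K)
  rw [← connectedSeries_eq] at h
  set Q := wordSeries K {w | IsQuarterPlaneLoop w ∧ IsStandard w}
  set S := achievableSeries K
  have hz := hasSubst_zero_X (K := K)
  have hinv : MvPowerSeries.subst ![(0 : MvPowerSeries Unit K), PowerSeries.X] Q⁻¹ = S⁻¹ := by
    refine (PowerSeries.eq_inv_iff_mul_eq_one (by rw [hS1]; exact one_ne_zero)).2 ?_
    have h1 := MvPowerSeries.inv_mul_cancel Q (by rw [hQ]; exact one_ne_zero)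
    rw [hS]
    refine (MvPowerSeries.subst_mul hz _ _).symm.trans ?_
    rw [h1, ← MvPowerSeries.coe_substAlgHom hz, map_one]
  have hB : MvPowerSeries.subst ![(0 : MvPowerSeries Unit K), PowerSeries.X] (cornerSubst Q) =
      1 - S⁻¹ := by
    have h1 : MvPowerSeries.subst ![(0 : MvPowerSeries Unit K), PowerSeries.X]
      (1 : MvPowerSeries (Fin 2) K) = 1 := by rw [← MvPowerSeries.coe_substAlgHom hz, map_one]
    rw [cornerSubst, MvPowerSeries.subst_sub hz, MvPowerSeries.subst_mul hz,
      MvPowerSeries.subst_sub hz, MvPowerSeries.subst_X hz, hinv, h1]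
    simp
  have hV : MvPowerSeries.subst ![(0 : MvPowerSeries Unit K), PowerSeries.X]
      (MvPowerSeries.X 1 * Q ^ 2) = PowerSeries.X * S ^ 2 := by
    rw [MvPowerSeries.subst_mul hz, MvPowerSeries.subst_pow hz, MvPowerSeries.subst_X hz, hS]
    rfl
  have hsub := hasSubst_pair (V := MvPowerSeries.X 1 * Q ^ 2) (constantCoeff_cornerSubst hQ)
    (by simp)
  have hsub' : MvPowerSeries.HasSubst ![1 - S⁻¹, PowerSeries.X * S ^ 2] := by
    refine hasSubst_pair ?_ ?_
    · change PowerSeries.constantCoeff _ = 0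
      rw [map_sub, map_one, PowerSeries.constantCoeff_inv, hS1, inv_one, sub_self]
    · change PowerSeries.constantCoeff _ = 0
      simp
  rw [comp_eq_subst _ _ _ hsub] at h
  rw [comp_eq_subst _ _ _ hsub']
  conv_lhs => rw [hS, h]
  rw [MvPowerSeries.subst_add hz, MvPowerSeries.subst_comp_subst_apply hsub hz]
  congr 1
  · rw [← MvPowerSeries.coe_substAlgHom hz, map_one]
  · congr 1
    funext i
    fin_cases i
    · exact hB
    · exact hV

/-! ### Uniqueness of the series of permutations -/

theorem corners_le_length (w : List Step) : corners w ≤ w.length := by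
  induction w with
  | nil => exact le_rfl
  | cons s w ih =>
    rw [corners_cons, List.length_cons]
    have := cornerHead_le_one s w
    omega

theorem coeff_connectedSeries_eq_zero {d : Fin 2 →₀ ℕ} (h : d 1 = 0 ∨ 2 * d 1 < d 0) :
    MvPowerSeries.coeff d (connectedSeries K) = 0 := by
  have : connectedStandard (d 0) (d 1) = ∅ := by
    refine Set.eq_empty_of_forall_notMem fun w hw => ?_
    obtain ⟨h1, -, h2, h3, -⟩ := hw
    obtain ⟨A⟩ := h3.nonempty
    have h4 := A.left_lt_length
    have h5 := corners_le_length w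
    omega
  change (((connectedStandard (d 0) (d 1)).ncard : ℕ) : K) = 0
  rw [this, Set.ncard_empty, Nat.cast_zero]

/-- `B` may have a non-zero constant term, so its powers give no control on the exponent of `b`.
Finiteness comes from `C` itself: the number of corners is at most twice the number of arches, which
the factor `t` bounds. -/
theorem composable_connectedSeries (B F : PowerSeries K) :
    Composable (connectedSeries K) B (PowerSeries.X * F) := by
  intro e
  refine (Set.finite_Iic (Finsupp.single 0 (2 * e ()) + Finsupp.single 1 (e ()) :
    Fin 2 →₀ ℕ)).subset fun d hd => ?_
  rw [Function.mem_support] at hd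
  have h1 : d 0 ≤ 2 * d 1 := by
    by_contra! h
    exact hd (by rw [coeff_connectedSeries_eq_zero (.inr h), zero_mul])
  have h2 : d 1 ≤ e () := by
    by_contra! h
    refine hd ?_
    have h3 : PowerSeries.coeff (e ()) (B ^ d 0 * (PowerSeries.X * F) ^ d 1) = 0 := by
      rw [mul_pow, mul_left_comm]
      exact PowerSeries.X_pow_dvd_iff.1 (Dvd.intro _ rfl) _ h
    rw [PowerSeries.coeff, ← Finsupp.unique_single e] at h3
    rw [h3, mul_zero]
  intro i
  fin_cases i
  · simp; omega
  · simpa using h2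

/-- The right-hand side of the equation for `S` is a contraction: a connected arch system has at
least one arch, so every term carries a factor `t`, and agreement modulo `t ^ n` improves to
agreement modulo `t ^ (n + 1)`. -/
theorem X_pow_dvd_comp_sub {F G : PowerSeries K} (hF : PowerSeries.constantCoeff F ≠ 0)
    (hG : PowerSeries.constantCoeff G ≠ 0) {n : ℕ} (h : PowerSeries.X ^ n ∣ F - G) {m : ℕ}
    (hm : m < n + 1) :
    PowerSeries.coeff m (comp (connectedSeries K) (1 - F⁻¹) (PowerSeries.X * F ^ 2)) =
      PowerSeries.coeff m (comp (connectedSeries K) (1 - G⁻¹) (PowerSeries.X * G ^ 2)) := by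
  have hinv : PowerSeries.X ^ n ∣ (1 - F⁻¹) - (1 - G⁻¹) := by
    have h1 := PowerSeries.inv_mul_cancel F hF
    have h2 := PowerSeries.inv_mul_cancel G hG
    have : (1 - F⁻¹) - (1 - G⁻¹) = F⁻¹ * G⁻¹ * (F - G) := by
      linear_combination F⁻¹ * h2 - G⁻¹ * h1
    rw [this]
    exact h.mul_left _
  refine finsum_congr fun d => ?_
  by_cases h0 : d 1 = 0
  · rw [coeff_connectedSeries_eq_zero (.inl h0), zero_mul, zero_mul]
  congr 1
  -- One factor `t` is split off `t ^ (d 1)`, with `d 1 = j + 1`, to gain the extra order.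
  obtain ⟨j, hj⟩ := Nat.exists_eq_succ_of_ne_zero h0
  have hd : PowerSeries.X ^ (n + 1) ∣ (1 - F⁻¹) ^ d 0 * (PowerSeries.X * F ^ 2) ^ d 1 -
      (1 - G⁻¹) ^ d 0 * (PowerSeries.X * G ^ 2) ^ d 1 := by
    have h1 := hinv.trans (sub_dvd_pow_sub_pow (1 - F⁻¹) (1 - G⁻¹) (d 0))
    have h2 := h.trans (sub_dvd_pow_sub_pow F G (2 * d 1))
    have h3 : (1 - F⁻¹) ^ d 0 * (PowerSeries.X * F ^ 2) ^ d 1 -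
        (1 - G⁻¹) ^ d 0 * (PowerSeries.X * G ^ 2) ^ d 1 = PowerSeries.X * (PowerSeries.X ^ j *
        (((1 - F⁻¹) ^ d 0 - (1 - G⁻¹) ^ d 0) * F ^ (2 * d 1) +
          (1 - G⁻¹) ^ d 0 * (F ^ (2 * d 1) - G ^ (2 * d 1)))) := by
      rw [mul_pow, mul_pow, ← pow_mul, ← pow_mul, hj, pow_succ PowerSeries.X]
      ring
    rw [h3, pow_succ']
    exact mul_dvd_mul_left _ ((dvd_add (h1.mul_right _) (h2.mul_left _)).mul_left _)
  have := PowerSeries.X_pow_dvd_iff.1 hd m hm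
  rw [map_sub, sub_eq_zero] at this
  exact this

theorem eq_of_eq_one_add_comp {F G : PowerSeries K} (hF : PowerSeries.constantCoeff F ≠ 0)
    (hG : PowerSeries.constantCoeff G ≠ 0)
    (h : F = 1 + comp (connectedSeries K) (1 - F⁻¹) (PowerSeries.X * F ^ 2))
    (h' : G = 1 + comp (connectedSeries K) (1 - G⁻¹) (PowerSeries.X * G ^ 2)) : F = G := by
  have key : ∀ n, PowerSeries.X ^ n ∣ F - G := by
    intro n
    induction n with
    | zero => simp
    | succ n ih =>
      rw [PowerSeries.X_pow_dvd_iff]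
      intro m hm
      have h1 := X_pow_dvd_comp_sub hF hG ih hm
      have h2 : F - G = (comp (connectedSeries K) (1 - F⁻¹) (PowerSeries.X * F ^ 2) : PowerSeries K) -
          (comp (connectedSeries K) (1 - G⁻¹) (PowerSeries.X * G ^ 2) : PowerSeries K) := by
        conv_lhs => rw [h, h']
        exact add_sub_add_left_eq_sub _ _ _
      rw [h2, map_sub, h1, sub_self]
  refine PowerSeries.ext fun n => ?_
  have := PowerSeries.X_pow_dvd_iff.1 (key (n + 1)) n (Nat.lt_succ_self n)
  rwa [map_sub, sub_eq_zero] at this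

end Connected

end ParallelStacks

theorem theorem1 (K : Type*) [Field K] [CharZero K] :
    -- the series of quarter plane walks is the unique solution of the kernel equation
    (∀ F : PowerSeries (MvPolynomial (Fin 3) K), KernelEquation F ↔ F = walkSeries K) ∧
    -- the series of loops: `Q(a,u²) = 𝒬(a,u;0,0)`
    (Composable (loopSeries K) (MvPowerSeries.X 0 : MvPowerSeries (Fin 2) K)
        (MvPowerSeries.X 1 ^ 2) ∧
      comp (loopSeries K) (MvPowerSeries.X 0 : MvPowerSeries (Fin 2) K) (MvPowerSeries.X 1 ^ 2) =
        atOrigin (walkSeries K)) ∧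
    -- `C` is the unique solution of `Q = 1 + 2 C(1 - (1-a)/Q, u Q²)`
    (MvPowerSeries.constantCoeff (loopSeries K) = 1 ∧
      ∀ F : MvPowerSeries (Fin 2) K,
        Composable F (1 - (1 - MvPowerSeries.X 0) * (loopSeries K)⁻¹)
          (MvPowerSeries.X 1 * loopSeries K ^ 2) ∧
        (loopSeries K = 1 + 2 * comp F (1 - (1 - MvPowerSeries.X 0) * (loopSeries K)⁻¹)
            (MvPowerSeries.X 1 * loopSeries K ^ 2) ↔
          F = connectedSeries K)) ∧
    -- `S` is the unique solution of `S = 1 + C(1 - 1/S, t S²)`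
    (PowerSeries.constantCoeff (achievableSeries K) = 1 ∧
      ∀ F : PowerSeries K, PowerSeries.constantCoeff F ≠ 0 →
        Composable (connectedSeries K) (1 - F⁻¹) (PowerSeries.X * F ^ 2) ∧
        (F = 1 + comp (connectedSeries K) (1 - F⁻¹) (PowerSeries.X * F ^ 2) ↔
          F = achievableSeries K)) := by
  refine ⟨kernelEquation_iff_eq, ⟨composable_of_constantCoeff _ (by simp) (by simp),
    comp_loopSeries_eq_atOrigin⟩, ⟨constantCoeff_loopSeries, fun F =>
    ⟨composable_of_constantCoeff _ (constantCoeff_one_sub_mul_inv constantCoeff_loopSeries)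
      (by simp), loopSeries_eq_iff F⟩⟩, constantCoeff_achievableSeries, fun F hF =>
    ⟨composable_connectedSeries _ _, fun h => ?_, fun h => h ▸ achievableSeries_eq_one_add_comp⟩⟩
  exact eq_of_eq_one_add_comp hF (by rw [constantCoeff_achievableSeries]; exact one_ne_zero) h
    achievableSeries_eq_one_add_comp
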